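/- **Problems.** All numerical inputs are rational and written in binary; index sets are given by listing their elements. *2-Disjoint Set Cover (2DSC).* Given a finite bipartite graph $G=(A,B,E)$ with $A=\bigcup_{b\in B}\mathcal N(b)$, where $\mathcal N(b)\subseteq A$ is the neighbourhood of $b$: are there disjoint $B_1,B_2\subseteq B$ with $|B_1|+|B_2|=|B|$ and $\bigcup_{b\in B_1}\mathcal N(b)=\bigcup_{b\in B_2}\mathcal N(b)=A$? *Helper Decision Problem.* Given a finite bipartite graph between users $\mathcal U$ and helpers $\mathcal H$, files $\{1,\dots,F\}$ with a probability distribution $(P_f)$, weights $\widetilde\omega_u>0$ $(u\in\mathcal U)$, a cache size $M\in\mathbb N$ and $Q\ge 0$: is there $X\in\{0,1\}^{F\times\mathcal H}$ with $\sum_f x_{f,h}\le M$ for every $h$ and $\sum_{u}\widetilde\omega_u\sum_{f\in\mathcal A_u}P_f\ge Q$, where $\mathcal A_u$ is the set of files $f$ with $x_{f,h}=1$ for some helper $h$ adjacent to $u$? *Optimal uncoded file placement (decision version).* Given a finite bipartite graph between users and helpers, $F$, $(P_f)$, $M$, $Q\ge0$ as above, delays $\omega_{h,u}\ge 0$ and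 base-station delays $\omega_{0,u}\ge 0$ with $\omega_{h,u}\le\omega_{0,u}$ for every link $(h,u)$: is there $X\in\{0,1\}^{F\times\mathcal H}$ with $\sum_f x_{f,h}\le M$ for every $h$ and $\sum_u(\omega_{0,u}-\bar D_u)\ge Q$? Here, if $(1)_u,\dots,(k)_u$ are the helpers adjacent to $u$ in order of increasing delay, $$\bar D_u=\sum_{j=1}^{k}\omega_{(j)_u,u}\sum_{f}\Big[\prod_{i<j}(1-x_{f,(i)_u})\Big]x_{f,(j)_u}P_f+\omega_{0,u}\sum_f\Big[\prod_{i=1}^{k}(1-x_{f,(i)_u})\Big]P_f .$$ **Statement.** 1. Let $\varepsilon>0$ be real and let $G=(A,B,E)$ be a 2DSC instance. Then $G$ is a yes-instance if and only if the following instance of the Helper Decision Problem (with real data) is one: graph $G$ with users $A$ and helpers $B$, two files with popularities $\left(\frac1{1+\varepsilon},\frac{\varepsilon}{1+\varepsilon}\right)$, all weights $1$, $M=1$ and $Q=|A|$. 2. For every fixed rational $\varepsilon>0$ this map is computable in polynomial time by a Turing machine, hence is a polynomial-time many-one reduction. In particular 2DSC reduces in polynomial time to the Helper Decision Problem. 3.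 The Helper Decision Problem and the decision version of optimal uncoded file placement are in NP. If 2DSC is NP-hard (which is known), then both problems are NP-hard, and hence NP-complete. -/

import Mathlib

open Computability

noncomputable section

/-! ## Decision problems, polynomial time, NP -/

/-- A decision problem: a type of instances, an encoding of the instances as strings over a finite
alphabet, and the set of yes-instances. -/
structure DecisionProblem where
  Inst : Type
  Alphabet : Type
  finiteAlphabet : Finite Alphabet
  encode : Inst → List Alphabet
  encode_injective : Function.Injective encode
  yes : Set Inst

/-- `f` is computed in polynomial time by a (multi-stack) Turing machine. -/
def PolyTime {α β Γ Δ : Type} (ea : α → List Γ) (eb : β → List Δ) (f : α → β) : Prop :=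
  Nonempty (Turing.TM2ComputableInPolyTime ea eb f)

namespace DecisionProblem

/-- `f` is a polynomial-time (many-one) reduction from `P` to `P'`. -/
def IsReduction (P P' : DecisionProblem) (f : P.Inst → P'.Inst) : Prop :=
  PolyTime P.encode P'.encode f ∧ ∀ x, x ∈ P.yes ↔ f x ∈ P'.yes

/-- `P` reduces to `P'` in polynomial time. -/
def Reduces (P P' : DecisionProblem) : Prop :=
  ∃ f : P.Inst → P'.Inst, IsReduction P P' f

/-- Encoding of a pair (instance, certificate); certificates are bit strings. -/
def encodeWithCert (P : DecisionProblem) (y : P.Inst × List Bool) : List (P.Alphabet ⊕ Bool) :=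
  (P.encode y.1).map Sum.inl ++ y.2.map Sum.inr

/-- The class NP: yes-instances are those having a certificate of polynomially bounded length that
a polynomial-time verifier accepts. -/
def InNP (P : DecisionProblem) : Prop :=
  ∃ (V : P.Inst × List Bool → Bool) (p : Polynomial ℕ),
    PolyTime P.encodeWithCert encodeBool V ∧
    ∀ x, x ∈ P.yes ↔ ∃ c : List Bool, c.length ≤ p.eval (P.encode x).length ∧ V (x, c) = true

/-- The membership problem of a language of bit strings. -/
def ofLanguage (L : Language Bool) : DecisionProblem where
  Inst := List Bool
  Alphabet := Bool
  finiteAlphabet := inferInstance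
  encode := id
  encode_injective := Function.injective_id
  yes := {w | w ∈ L}

/-- Every language in NP reduces to `P` in polynomial time. -/
def NPHard (P : DecisionProblem) : Prop :=
  ∀ L : Language Bool, InNP (ofLanguage L) → Reduces (ofLanguage L) P

def NPComplete (P : DecisionProblem) : Prop :=
  InNP P ∧ NPHard P

end DecisionProblem

/-! ## String encodings of the data

Sizes of index sets are written in unary, other numbers in binary. Every encoding is
self-delimiting. -/

def encUnary (n : ℕ) : List Γ' := List.replicate n (Γ'.bit true) ++ [Γ'.comma]

def encBinary (n : ℕ) : List Γ' := (encodeNat n).map Γ'.bit ++ [Γ'.comma]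

def encBit (b : Bool) : List Γ' := [Γ'.bit b]

/-- Sign bit, absolute value of the numerator, denominator. -/
def encRat (q : ℚ) : List Γ' :=
  encBit (decide (q.num < 0)) ++ encBinary q.num.natAbs ++ encBinary q.den

/-- A finite sequence, terminated by `Γ'.ket`. -/
def encSeq {α : Type} (e : α → List Γ') {n : ℕ} (f : Fin n → α) : List Γ' :=
  (List.ofFn f).flatMap e ++ [Γ'.ket]

/-- Self-delimiting encodings. -/
def SelfDelimiting {α : Type} (e : α → List Γ') : Prop :=
  ∀ x y s t, e x ++ s = e y ++ t → x = y ∧ s = t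

theorem selfDelimiting_bits : ∀ (l l' : List Bool) (s t : List Γ'),
    (l.map Γ'.bit ++ [Γ'.comma]) ++ s = (l'.map Γ'.bit ++ [Γ'.comma]) ++ t → l = l' ∧ s = t
  | [], [], s, t, h => by simpa using h
  | [], _ :: _, s, t, h => by simp at h
  | _ :: _, [], s, t, h => by simp at h
  | a :: l, b :: l', s, t, h => by
      simp only [List.map_cons, List.cons_append, List.cons.injEq, Γ'.bit.injEq] at h
      obtain ⟨h1, h2⟩ := selfDelimiting_bits l l' s t h.2
      exact ⟨by rw [h.1, h1], h2⟩

theorem selfDelimiting_unary : SelfDelimiting encUnary := by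
  intro x y s t h
  have h' := selfDelimiting_bits (List.replicate x true) (List.replicate y true) s t
    (by simpa [encUnary] using h)
  exact ⟨by simpa using congrArg List.length h'.1, h'.2⟩

theorem selfDelimiting_binary : SelfDelimiting encBinary := by
  intro x y s t h
  have h' := selfDelimiting_bits _ _ s t h
  exact ⟨by simpa using congrArg decodeNat h'.1, h'.2⟩

theorem selfDelimiting_bit : SelfDelimiting encBit := by
  intro x y s t h
  simpa [encBit] using h

theorem selfDelimiting_rat : SelfDelimiting encRat := by
  intro x y s t h
  simp only [encRat, List.append_assoc] at h
  obtain ⟨h0, h⟩ := selfDelimiting_bit _ _ _ _ h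
  obtain ⟨h1, h⟩ := selfDelimiting_binary _ _ _ _ h
  obtain ⟨h2, h⟩ := selfDelimiting_binary _ _ _ _ h
  refine ⟨Rat.ext ?_ h2, h⟩
  have h0' : x.num < 0 ↔ y.num < 0 := by simpa using h0
  omega

theorem selfDelimiting_seq {α : Type} {e : α → List Γ'} (he : SelfDelimiting e) (n : ℕ) :
    ∀ (x y : Fin n → α) (s t : List Γ'), encSeq e x ++ s = encSeq e y ++ t → x = y ∧ s = t := by
  induction n with
  | zero =>
    intro x y s t h
    exact ⟨Subsingleton.elim _ _, by simpa [encSeq] using h⟩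
  | succ n ih =>
    intro x y s t h
    simp only [encSeq, List.ofFn_succ, List.flatMap_cons, List.append_assoc] at h
    obtain ⟨h0, h⟩ := he _ _ _ _ h
    obtain ⟨h1, h⟩ := ih (fun i => x i.succ) (fun i => y i.succ) s t
      (by simpa only [encSeq, List.append_assoc] using h)
    refine ⟨?_, h⟩
    funext i
    refine Fin.cases h0 (fun j => ?_) i
    exact congrFun h1 j

/-! ## Bipartite graphs and the 2-Disjoint Set Cover Problem -/

/-- A finite bipartite graph with parts `A = Fin nA` and `B = Fin nB`. -/
structure BipGraph where
  nA : ℕ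
  nB : ℕ
  adj : Fin nA → Fin nB → Bool

namespace BipGraph

/-- The neighbourhood in `A` of a vertex `b` of `B`. -/
def nbhd (G : BipGraph) (b : Fin G.nB) : Finset (Fin G.nA) :=
  Finset.univ.filter fun a => G.adj a b = true

/-- The neighbourhoods of the vertices in `S` cover `A`. -/
def Covers (G : BipGraph) (S : Finset (Fin G.nB)) : Prop :=
  S.biUnion G.nbhd = Finset.univ

def encode (G : BipGraph) : List Γ' :=
  encUnary G.nA ++ encUnary G.nB ++ encSeq (encSeq encBit) G.adj

theorem selfDelimiting_encode : SelfDelimiting encode := by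
  rintro ⟨a, b, f⟩ ⟨a', b', f'⟩ s t h
  simp only [encode, List.append_assoc] at h
  obtain ⟨rfl, h1⟩ := selfDelimiting_unary _ _ _ _ h
  obtain ⟨rfl, h2⟩ := selfDelimiting_unary _ _ _ _ h1
  obtain ⟨rfl, h3⟩ := selfDelimiting_seq (e := encSeq encBit) (selfDelimiting_seq selfDelimiting_bit b) a _ _ _ _ h2
  exact ⟨rfl, h3⟩

end BipGraph

/-- Instances of 2-Disjoint Set Cover: bipartite graphs in which `A` is the union of the
neighbourhoods of all vertices of `B`. -/
def TwoDSCInst : Type := {G : BipGraph // G.Covers Finset.univ}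

/-- There are disjoint `B₁, B₂ ⊆ B` with `|B₁| + |B₂| = |B|`, each covering `A`. -/
def TwoDSCInst.IsYes (I : TwoDSCInst) : Prop :=
  ∃ B₁ B₂ : Finset (Fin I.1.nB), Disjoint B₁ B₂ ∧ B₁.card + B₂.card = I.1.nB ∧
    I.1.Covers B₁ ∧ I.1.Covers B₂

/-- The 2-Disjoint Set Cover Problem. -/
def twoDSC : DecisionProblem where
  Inst := TwoDSCInst
  Alphabet := Γ'
  finiteAlphabet := inferInstance
  encode I := I.1.encode
  encode_injective := fun x y h => Subtype.ext
    (BipGraph.selfDelimiting_encode x.1 y.1 [] [] (by simpa using h)).1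
  yes := {I | I.IsYes}

/-! ## Cache placements -/

/-- A cache placement, i.e. a 0/1 matrix: `X f h` says that helper `h` stores file `f`. -/
abbrev CachePlacement (F H : ℕ) : Type := Fin F → Fin H → Bool

/-- Every helper stores at most `M` files. -/
def CachePlacement.Feasible {F H : ℕ} (X : CachePlacement F H) (M : ℕ) : Prop :=
  ∀ h, (Finset.univ.filter fun f => X f h = true).card ≤ M

/-! ## The Helper Decision Problem -/

/-- Instances of the Helper Decision Problem with numerical data in `R`. The part `A` of the graph
is the set of users, the part `B` is the set of helpers (without the base station). -/
structure HelperInst (R : Type) [Field R] [LinearOrder R] where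
  graph : BipGraph
  /-- number of files -/
  nF : ℕ
  /-- popularity distribution -/
  pop : Fin nF → R
  /-- weights of the users -/
  weight : Fin graph.nA → R
  /-- cache size -/
  M : ℕ
  /-- target value -/
  Q : R
  pop_nonneg : ∀ f, 0 ≤ pop f
  pop_sum : ∑ f, pop f = 1
  weight_pos : ∀ u, 0 < weight u
  Q_nonneg : 0 ≤ Q

namespace HelperInst

variable {R : Type} [Field R] [LinearOrder R]

/-- The union of the caches of the helpers adjacent to user `u`. -/
def available (I : HelperInst R) (X : CachePlacement I.nF I.graph.nB) (u : Fin I.graph.nA) :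
    Finset (Fin I.nF) :=
  Finset.univ.filter fun f => ∃ h, I.graph.adj u h = true ∧ X f h = true

/-- The sum of the values seen by all users. -/
def value (I : HelperInst R) (X : CachePlacement I.nF I.graph.nB) : R :=
  ∑ u, I.weight u * ∑ f ∈ I.available X u, I.pop f

def IsYes (I : HelperInst R) : Prop :=
  ∃ X : CachePlacement I.nF I.graph.nB, X.Feasible I.M ∧ I.Q ≤ I.value X

def encode (I : HelperInst ℚ) : List Γ' :=
  I.graph.encode ++ encUnary I.nF ++ encSeq encRat I.pop ++ encSeq encRat I.weight ++
    encBinary I.M ++ encRat I.Q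

theorem encode_injective : Function.Injective encode := by
  rintro ⟨G, F, P, w, M, Q, _, _, _, _⟩ ⟨G', F', P', w', M', Q', _, _, _, _⟩ h
  have h : _ ++ [] = _ ++ [] := congrArg (· ++ []) h
  simp only [encode, List.append_assoc] at h
  obtain ⟨rfl, h1⟩ := BipGraph.selfDelimiting_encode _ _ _ _ h
  obtain ⟨rfl, h2⟩ := selfDelimiting_unary _ _ _ _ h1
  obtain ⟨rfl, h3⟩ := selfDelimiting_seq selfDelimiting_rat _ _ _ _ _ h2
  obtain ⟨rfl, h4⟩ := selfDelimiting_seq selfDelimiting_rat _ _ _ _ _ h3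
  obtain ⟨rfl, h5⟩ := selfDelimiting_binary _ _ _ _ h4
  obtain ⟨rfl, h6⟩ := selfDelimiting_rat _ _ _ _ h5
  rfl

end HelperInst

/-- The Helper Decision Problem (with rational data). -/
def helperProblem : DecisionProblem where
  Inst := HelperInst ℚ
  Alphabet := Γ'
  finiteAlphabet := inferInstance
  encode := HelperInst.encode
  encode_injective := HelperInst.encode_injective
  yes := {I | I.IsYes}

/-- The instance built from a graph: the users are `A`, the helpers are `B`, there are two files
with popularities `1 / (1 + ε)` and `ε / (1 + ε)`, all weights are `1`, the cache size is `1`, and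
the target is the number of users. -/
def reductionInst {R : Type} [Field R] [LinearOrder R] [IsStrictOrderedRing R]
    (ε : R) (hε : 0 < ε) (G : TwoDSCInst) : HelperInst R where
  graph := G.1
  nF := 2
  pop := ![1 / (1 + ε), ε / (1 + ε)]
  weight := fun _ => 1
  M := 1
  Q := (G.1.nA : R)
  pop_nonneg := by
    intro f
    fin_cases f
    · simp only [Fin.zero_eta, Matrix.cons_val_zero]; positivity
    · simp only [Fin.mk_one, Matrix.cons_val_one, Matrix.cons_val_fin_one]; positivity
  pop_sum := by
    have h : 1 + ε ≠ 0 := (add_pos one_pos hε).ne'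
    rw [Fin.sum_univ_two]
    simp only [Matrix.cons_val_zero, Matrix.cons_val_one]
    field_simp
  weight_pos := fun _ => one_pos
  Q_nonneg := Nat.cast_nonneg _

/-! ## The uncoded file placement problem with general link delays -/

/-- Instances of (the decision version of) the optimal uncoded file placement problem. Users are
the part `A` and helpers other than the base station are the part `B` of the graph. The entries
`delay h u` are used only for links `(h, u)` of the graph. The base station serves all users. -/
structure UncodedInst where
  graph : BipGraph
  /-- number of files -/
  nF : ℕ
  /-- popularity distribution -/
  pop : Fin nF → ℚ
  /-- download time per bit from helper `h` to user `u` -/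
  delay : Fin graph.nB → Fin graph.nA → ℚ
  /-- download time per bit from the base station to user `u` -/
  delayBS : Fin graph.nA → ℚ
  /-- cache size -/
  M : ℕ
  /-- target value -/
  Q : ℚ
  pop_nonneg : ∀ f, 0 ≤ pop f
  pop_sum : ∑ f, pop f = 1
  delay_nonneg : ∀ h u, 0 ≤ delay h u
  delayBS_nonneg : ∀ u, 0 ≤ delayBS u
  delay_le_delayBS : ∀ h u, graph.adj u h = true → delay h u ≤ delayBS u
  Q_nonneg : 0 ≤ Q

namespace UncodedInst

/-- The helpers adjacent to user `u` (without the base station), in order of increasing delay. -/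
def sortedHelpers (I : UncodedInst) (u : Fin I.graph.nA) : List (Fin I.graph.nB) :=
  ((List.finRange I.graph.nB).filter fun h => I.graph.adj u h).mergeSort
    fun h h' => decide (I.delay h u ≤ I.delay h' u)

/-- The matrix entry `x_{f,h}` as a number. -/
def entry {I : UncodedInst} (X : CachePlacement I.nF I.graph.nB) (f : Fin I.nF)
    (h : Fin I.graph.nB) : ℚ :=
  if X f h = true then 1 else 0

/-- The average delay per information bit of user `u`: each file is downloaded from the adjacent
helper of smallest delay that stores it, and from the base station if there is none. -/
def avgDelay (I : UncodedInst) (X : CachePlacement I.nF I.graph.nB) (u : Fin I.graph.nA) : ℚ :=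
  (∑ j : Fin (I.sortedHelpers u).length, I.delay ((I.sortedHelpers u).get j) u *
    ∑ f, (∏ i ∈ Finset.Iio j, (1 - entry X f ((I.sortedHelpers u).get i))) *
      entry X f ((I.sortedHelpers u).get j) * I.pop f) +
  I.delayBS u *
    ∑ f, (∏ i : Fin (I.sortedHelpers u).length,
      (1 - entry X f ((I.sortedHelpers u).get i))) * I.pop f

/-- The objective: the total delay reduction over all users. -/
def objective (I : UncodedInst) (X : CachePlacement I.nF I.graph.nB) : ℚ :=
  ∑ u, (I.delayBS u - I.avgDelay X u)

def IsYes (I : UncodedInst) : Prop :=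
  ∃ X : CachePlacement I.nF I.graph.nB, X.Feasible I.M ∧ I.Q ≤ I.objective X

def encode (I : UncodedInst) : List Γ' :=
  I.graph.encode ++ encUnary I.nF ++ encSeq encRat I.pop ++ encSeq (encSeq encRat) I.delay ++
    encSeq encRat I.delayBS ++ encBinary I.M ++ encRat I.Q

theorem encode_injective : Function.Injective encode := by
  rintro ⟨G, F, P, d, d₀, M, Q, _, _, _, _, _, _⟩ ⟨G', F', P', d', d₀', M', Q', _, _, _, _, _, _⟩ h
  have h : _ ++ [] = _ ++ [] := congrArg (· ++ []) h
  simp only [encode, List.append_assoc] at h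
  obtain ⟨rfl, h1⟩ := BipGraph.selfDelimiting_encode _ _ _ _ h
  obtain ⟨rfl, h2⟩ := selfDelimiting_unary _ _ _ _ h1
  obtain ⟨rfl, h3⟩ := selfDelimiting_seq selfDelimiting_rat _ _ _ _ _ h2
  obtain ⟨rfl, h4⟩ := selfDelimiting_seq (e := encSeq encRat) (selfDelimiting_seq selfDelimiting_rat _) _ _ _ _ _ h3
  obtain ⟨rfl, h5⟩ := selfDelimiting_seq selfDelimiting_rat _ _ _ _ _ h4
  obtain ⟨rfl, h6⟩ := selfDelimiting_binary _ _ _ _ h5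
  obtain ⟨rfl, h7⟩ := selfDelimiting_rat _ _ _ _ h6
  rfl

end UncodedInst

/-- The decision version of the optimal uncoded file placement problem. -/
def uncodedPlacement : DecisionProblem where
  Inst := UncodedInst
  Alphabet := Γ'
  finiteAlphabet := inferInstance
  encode := UncodedInst.encode
  encode_injective := UncodedInst.encode_injective
  yes := {I | I.IsYes}

end

/-!
The combinatorial part is short. With all weights equal to `1`, a user contributes at most `1` to
the value of a placement, and contributes `1` only if both files are available to it, since both
have positive popularity. So a placement reaches the target `|A|` if and only if the helpers storing
the first file cover `A` and so do those storing the second; as a cache holds one file, these two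
sets of helpers are disjoint (`isYes_iff_reductionInst`). The placement problem contains the Helper
Decision Problem: let all links have delay `0` and let the delay of the base station be the weight
of the user (`HelperInst.objective_toUncoded`).

Most of the text shows that functions are computable in polynomial time by a `Turing.TM2` machine.
A machine is written as a structured program `Prog` acting on stacks, with a step-counting semantics
`Runs`; such a program compiles to a `TM2` machine (`Prog.polyTime`). Data are binary trees, kept on
a stack in prefix notation, and a type is `Coded` if its elements are represented by trees.
The predicate `PT` says that some program transforms the tree of `x` to that of `f x` within
polynomial time. It is closed under composition, pairing, case distinction, and under folding along
a list as long as the intermediate results have polynomially bounded size (`PT.foldl_of_bound`);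
this gives list functions, arithmetic of binary numbers and comparison of fractions. The bridge to
string encodings is `PT.polyTime`, and polynomial-time functions compose (`PolyTime.comp`), which
transports hardness along a reduction.

For membership in NP, the certificate is the list of entries of the placement, which is no longer
than the square of the length of the encoding. The verifier splits the encoding at its separators
(`tokens`), reads the numerical data from it and evaluates the objective with fractions of binary
numbers. The formula for the average delay is evaluated without sorting: the product over the
preceding helpers selects the first helper in the sorted list that stores the file, whose delay is
the minimum over all adjacent helpers storing it (`UncodedInst.firstValue_sortedHelpers`).
-/

/-! ### Structured stack programs and their compilation to Turing machines -/

/-- Structured programs acting on a family of stacks with alphabets `Γ k`. The tests of `ifte` and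
`loop` look at the top symbol of one stack (`none` if the stack is empty). -/
inductive Prog {K : Type} (Γ : K → Type) : Type
  | skip : Prog Γ
  | push (k : K) (a : Γ k) : Prog Γ
  | pop (k : K) : Prog Γ
  | seq (p q : Prog Γ) : Prog Γ
  | ifte (k : K) (f : Option (Γ k) → Bool) (p q : Prog Γ) : Prog Γ
  | loop (k : K) (f : Option (Γ k) → Bool) (p : Prog Γ) : Prog Γ

namespace Prog

variable {K : Type} {Γ : K → Type}

/-- `Runs p S S' n`: started on the stacks `S`, the program `p` stops with the stacks `S'` after at
most `n` elementary steps. -/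
inductive Runs [DecidableEq K] : Prog Γ → (∀ k, List (Γ k)) → (∀ k, List (Γ k)) → ℕ → Prop
  | skip (S) : Runs skip S S 1
  | push (k a S) : Runs (push k a) S (Function.update S k (a :: S k)) 1
  | pop (k S) : Runs (pop k) S (Function.update S k (S k).tail) 1
  | seq {p q S S' S'' m n} : Runs p S S' m → Runs q S' S'' n → Runs (seq p q) S S'' (m + n)
  | ifTrue {k f p q S S' n} : f (S k).head? = true → Runs p S S' n → Runs (ifte k f p q) S S' (n + 1)
  | ifFalse {k f p q S S' n} : f (S k).head? = false → Runs q S S' n →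
      Runs (ifte k f p q) S S' (n + 1)
  | loopStop {k f p S} : f (S k).head? = false → Runs (loop k f p) S S 1
  | loopStep {k f p S S' S'' m n} : f (S k).head? = true → Runs p S S' m →
      Runs (loop k f p) S' S'' n → Runs (loop k f p) S S'' (m + n + 1)
  | weaken {p S S' m n} : Runs p S S' m → m ≤ n → Runs p S S' n

/-- The labels of the Turing machine program compiled from a structured program. -/
def Lbl : Prog Γ → Type
  | skip => Unit
  | push _ _ => Unit
  | pop _ => Unit
  | seq p q => Lbl p ⊕ Lbl q
  | ifte _ _ p q => Option (Lbl p ⊕ Lbl q)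
  | loop _ _ p => Option (Lbl p)

/-- The label at which the compiled program starts. -/
def entry : (p : Prog Γ) → Lbl p
  | skip => ()
  | push _ _ => ()
  | pop _ => ()
  | seq p _ => .inl (entry p)
  | ifte _ _ _ _ => none
  | loop _ _ _ => none

theorem finite_lbl : (p : Prog Γ) → Finite (Lbl p)
  | skip => inferInstanceAs (Finite Unit)
  | push _ _ => inferInstanceAs (Finite Unit)
  | pop _ => inferInstanceAs (Finite Unit)
  | seq p q => by
      have := finite_lbl p; have := finite_lbl q
      exact inferInstanceAs (Finite (Lbl p ⊕ Lbl q))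
  | ifte _ _ p q => by
      have := finite_lbl p; have := finite_lbl q
      exact inferInstanceAs (Finite (Option (Lbl p ⊕ Lbl q)))
  | loop _ _ p => by
      have := finite_lbl p
      exact inferInstanceAs (Finite (Option (Lbl p)))

/-- The statements compiled from a program whose labels are embedded by `e` into the label set `Λ`
of a larger machine, and which continues at the label `x`. The internal state of the machine is one
bit, the result of the latest test. -/
def code {Λ : Type} : (p : Prog Γ) → (Lbl p → Λ) → Λ → Lbl p → Turing.TM2.Stmt Γ Λ Bool
  | skip, _, x => fun _ => .goto fun _ => x
  | push k a, _, x => fun _ => .push k (fun _ => a) (.goto fun _ => x)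
  | pop k, _, x => fun _ => .pop k (fun v _ => v) (.goto fun _ => x)
  | seq p q, e, x => Sum.elim (code p (fun l => e (.inl l)) (e (.inr (entry q))))
      (code q (fun l => e (.inr l)) x)
  | ifte k f p q, e, x => fun l => match l with
      | none => .peek k (fun _ a => f a)
          (.goto fun v => bif v then e (some (.inl (entry p))) else e (some (.inr (entry q))))
      | some (.inl l) => code p (fun l => e (some (.inl l))) x l
      | some (.inr l) => code q (fun l => e (some (.inr l))) x l
  | loop k f p, e, x => fun l => match l with
      | none => .peek k (fun _ a => f a) (.goto fun v => bif v then e (some (entry p)) else x)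
      | some l => code p (fun l => e (some l)) (e none) l

end Prog

/-- `Reach f n a b`: iterating the partial step function `f` leads from `a` to `b` in at most `n`
steps. -/
def Reach {C : Type} (f : C → Option C) (n : ℕ) (a b : C) : Prop :=
  ∃ m ≤ n, (flip bind f)^[m] (some a) = some b

namespace Reach

variable {C : Type} {f : C → Option C} {a b c : C} {m n : ℕ}

theorem single (h : f a = some b) : Reach f 1 a b := ⟨1, le_rfl, h⟩

theorem mono (h : Reach f m a b) (hmn : m ≤ n) : Reach f n a b := by
  obtain ⟨i, hi, h⟩ := h
  exact ⟨i, hi.trans hmn, h⟩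

theorem trans (h : Reach f m a b) (h' : Reach f n b c) : Reach f (m + n) a c := by
  obtain ⟨i, hi, h⟩ := h
  obtain ⟨j, hj, h'⟩ := h'
  exact ⟨j + i, by omega, by rw [Function.iterate_add_apply, h, h']⟩

theorem head (h : f a = some b) (h' : Reach f n b c) : Reach f (n + 1) a c :=
  ((single h).trans h').mono (by omega)

end Reach

namespace Prog

variable {K : Type} {Γ : K → Type} [DecidableEq K]

theorem Runs.reach {p : Prog Γ} {S S' : ∀ k, List (Γ k)} {n : ℕ} (h : Runs p S S' n) :
    ∀ {Λ : Type} (m : Λ → Turing.TM2.Stmt Γ Λ Bool) (e : Lbl p → Λ) (x : Λ),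
      (∀ l, m (e l) = code p e x l) → ∀ v, ∃ v',
        Reach (Turing.TM2.step m) n ⟨some (e (entry p)), v, S⟩ ⟨some x, v', S'⟩ := by
  induction h with
  | skip S =>
    intro Λ m e x hm v
    exact ⟨v, .single (by simp [Turing.TM2.step, hm, code])⟩
  | push k a S =>
    intro Λ m e x hm v
    exact ⟨v, .single (by simp [Turing.TM2.step, hm, code])⟩
  | pop k S =>
    intro Λ m e x hm v
    exact ⟨v, .single (by simp [Turing.TM2.step, hm, code])⟩
  | @seq p q S S' S'' i j _ _ ihp ihq =>
    intro Λ m e x hm v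
    obtain ⟨v', h'⟩ := ihp m (fun l => e (.inl l)) (e (.inr (entry q))) (fun l => hm (.inl l)) v
    obtain ⟨v'', h''⟩ := ihq m (fun l => e (.inr l)) x (fun l => hm (.inr l)) v'
    exact ⟨v'', h'.trans h''⟩
  | @ifTrue k f p q S S' n hf _ ih =>
    intro Λ m e x hm v
    obtain ⟨v', h'⟩ := ih m (fun l => e (some (.inl l))) x (fun l => hm (some (.inl l))) true
    refine ⟨v', .head ?_ h'⟩
    have h0 := hm none
    simp only [code] at h0
    simp [Turing.TM2.step, h0, hf, entry]
  | @ifFalse k f p q S S' n hf _ ih =>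
    intro Λ m e x hm v
    obtain ⟨v', h'⟩ := ih m (fun l => e (some (.inr l))) x (fun l => hm (some (.inr l))) false
    refine ⟨v', .head ?_ h'⟩
    have h0 := hm none
    simp only [code] at h0
    simp [Turing.TM2.step, h0, hf, entry]
  | @loopStop k f p S hf =>
    intro Λ m e x hm v
    have h0 := hm none
    simp only [code] at h0
    exact ⟨false, .single (by simp [Turing.TM2.step, h0, hf, entry])⟩
  | @loopStep k f p S S' S'' i j hf _ _ ihp ihq =>
    intro Λ m e x hm v
    obtain ⟨v', h'⟩ := ihp m (fun l => e (some l)) (e none) (fun l => hm (some l)) true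
    obtain ⟨v'', h''⟩ := ihq m e x hm v'
    refine ⟨v'', .head ?_ (h'.trans h'')⟩
    have h0 := hm none
    simp only [code] at h0
    simp [Turing.TM2.step, h0, hf, entry]
  | weaken _ hmn ih =>
    intro Λ m e x hm v
    obtain ⟨v', h'⟩ := ih m e x hm v
    exact ⟨v', h'.mono hmn⟩

/-- The bundled Turing machine that runs `p` and then halts. -/
noncomputable def toTM [Fintype K] (p : Prog Γ) (k₀ k₁ : K) [Fintype (Γ k₀)] : Turing.FinTM2 :=
  letI := finite_lbl p
  letI : Fintype (Option (Lbl p)) := Fintype.ofFinite _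
  { k₀ := k₀
    k₁ := k₁
    Γ := Γ
    Λ := Option (Lbl p)
    main := some (entry p)
    σ := Bool
    initialState := false
    m := fun l => match l with
      | none => .load (fun _ => false) .halt
      | some l => code p some none l }

end Prog

theorem initList_stk (tm : Turing.FinTM2) (s : List (tm.Γ tm.k₀)) :
    (Turing.initList tm s).stk = Function.update (fun _ => []) tm.k₀ s := by
  funext k
  by_cases h : k = tm.k₀
  · subst h; simp [Turing.initList]
  · simp [Turing.initList, h]

theorem haltList_stk (tm : Turing.FinTM2) (s : List (tm.Γ tm.k₁)) :
    (Turing.haltList tm s).stk = Function.update (fun _ => []) tm.k₁ s := by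
  funext k
  by_cases h : k = tm.k₁
  · subst h; simp [Turing.haltList]
  · simp [Turing.haltList, h]

theorem initList_eq (tm : Turing.FinTM2) (s : List (tm.Γ tm.k₀)) :
    Turing.initList tm s =
      ⟨some tm.main, tm.initialState, Function.update (fun _ => []) tm.k₀ s⟩ := by
  rw [← initList_stk]; rfl

theorem haltList_eq (tm : Turing.FinTM2) (s : List (tm.Γ tm.k₁)) :
    Turing.haltList tm s =
      ⟨none, tm.initialState, Function.update (fun _ => []) tm.k₁ s⟩ := by
  rw [← haltList_stk]; rfl

/-- A polynomial-time function, presented by a machine whose input and output alphabets are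
literally the given ones up to bijections, and a run of it on every input. -/
theorem polyTime_iff {α β A B : Type} {ea : α → List A} {eb : β → List B} {f : α → β} :
    PolyTime ea eb f ↔ ∃ (tm : Turing.FinTM2) (i : tm.Γ tm.k₀ ≃ A) (o : tm.Γ tm.k₁ ≃ B)
      (q : Polynomial ℕ), ∀ x, Reach tm.step (q.eval (ea x).length)
        (Turing.initList tm ((ea x).map i.symm)) (Turing.haltList tm ((eb (f x)).map o.symm)) := by
  constructor
  · rintro ⟨⟨⟨tm, i, o⟩, q, h⟩⟩
    exact ⟨tm, i, o, q, fun x => ⟨(h x).steps, (h x).steps_le_m, (h x).evals_in_steps⟩⟩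
  · rintro ⟨tm, i, o, q, h⟩
    refine ⟨⟨⟨tm, i, o⟩, q, fun x => ?_⟩⟩
    exact { steps := (h x).choose
            evals_in_steps := (h x).choose_spec.2
            steps_le_m := (h x).choose_spec.1 }

namespace Prog

theorem polyTime {K : Type} [DecidableEq K] [Fintype K] {Γ : K → Type} (p : Prog Γ) (k₀ k₁ : K)
    [Fintype (Γ k₀)] {α β : Type} (ea : α → List (Γ k₀)) (eb : β → List (Γ k₁)) (f : α → β)
    (q : Polynomial ℕ)
    (h : ∀ x, Runs p (Function.update (fun _ => []) k₀ (ea x))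
      (Function.update (fun _ => []) k₁ (eb (f x))) (q.eval (ea x).length)) :
    PolyTime ea eb f := by
  rw [polyTime_iff]
  refine ⟨toTM p k₀ k₁, Equiv.refl _, Equiv.refl _, q + 1, fun x => ?_⟩
  obtain ⟨v, hv⟩ := (h x).reach (toTM p k₀ k₁).m some none (fun l => rfl) false
  rw [initList_eq, haltList_eq]
  have hlast : Reach (toTM p k₀ k₁).step 1
      ⟨some none, v, Function.update (fun _ => []) k₁ (eb (f x))⟩
      ⟨none, false, Function.update (fun _ => []) k₁ (eb (f x))⟩ := .single rfl
  have key : ∀ l₀ l₁, l₀ = ea x → l₁ = eb (f x) → Reach (toTM p k₀ k₁).step (q.eval (ea x).length + 1)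
      ⟨some (some (entry p)), false, Function.update (fun _ => []) k₀ l₀⟩
      ⟨none, false, Function.update (fun _ => []) k₁ l₁⟩ := by
    rintro _ _ rfl rfl
    exact hv.trans hlast
  simp only [Polynomial.eval_add, Polynomial.eval_one]
  exact key _ _ (List.map_id _) (List.map_id _)

end Prog

/-! ### Tree-shaped data on stacks -/

/-- Finite binary trees, the universal data type of the polynomial-time calculus. -/
inductive BTree : Type
  | nil : BTree
  | cons (l r : BTree) : BTree

namespace BTree

/-- Prefix notation: a leaf is `false`, an inner node is `true` followed by its two subtrees. -/
def code : BTree → List Bool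
  | nil => [false]
  | cons l r => true :: (l.code ++ r.code)

/-- The number of nodes, i.e. the length of the prefix notation. -/
def size (t : BTree) : ℕ := t.code.length

theorem size_nil : size nil = 1 := rfl

theorem size_cons (l r : BTree) : size (cons l r) = l.size + r.size + 1 := by
  simp [size, code]

theorem size_pos (t : BTree) : 0 < t.size := by
  cases t <;> simp [size, code]

end BTree

/-- The stacks of the machines that are built: input, output, two data stacks `a` and `b` that hold
codes of trees, a scratch stack `t` and a unary counter `c`. -/
inductive Stk : Type
  | inp | out | a | b | t | c
  deriving DecidableEq

instance : Fintype Stk where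
  elems := {.inp, .out, .a, .b, .t, .c}
  complete k := by cases k <;> decide

/-- The stack alphabets, for the input alphabet `A` and the output alphabet `B`. -/
@[reducible] def Alph (A B : Type) : Stk → Type
  | .inp => A
  | .out => B
  | .a => Bool
  | .b => Bool
  | .t => Bool
  | .c => Bool

/-- The family of stacks with the given contents. -/
def stks {A B : Type} (i : List A) (o : List B) (a b t c : List Bool) :
    ∀ k, List (Alph A B k)
  | .inp => i
  | .out => o
  | .a => a
  | .b => b
  | .t => t
  | .c => c

namespace Prog

section basic

variable {A B : Type} {i : List A} {o : List B} {a b t c : List Bool}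

theorem push_out (x : B) : Runs (push (Γ := Alph A B) .out x) (stks i o a b t c)
    (stks i (x :: o) a b t c) 1 := by
  convert! Runs.push (Γ := Alph A B) .out x (stks i o a b t c) using 1
  funext k; cases k <;> rfl

theorem push_a (x : Bool) : Runs (push (Γ := Alph A B) .a x) (stks i o a b t c)
    (stks i o (x :: a) b t c) 1 := by
  convert! Runs.push (Γ := Alph A B) .a x (stks i o a b t c) using 1
  funext k; cases k <;> rfl

theorem push_b (x : Bool) : Runs (push (Γ := Alph A B) .b x) (stks i o a b t c)
    (stks i o a (x :: b) t c) 1 := by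
  convert! Runs.push (Γ := Alph A B) .b x (stks i o a b t c) using 1
  funext k; cases k <;> rfl

theorem push_t (x : Bool) : Runs (push (Γ := Alph A B) .t x) (stks i o a b t c)
    (stks i o a b (x :: t) c) 1 := by
  convert! Runs.push (Γ := Alph A B) .t x (stks i o a b t c) using 1
  funext k; cases k <;> rfl

theorem push_c (x : Bool) : Runs (push (Γ := Alph A B) .c x) (stks i o a b t c)
    (stks i o a b t (x :: c)) 1 := by
  convert! Runs.push (Γ := Alph A B) .c x (stks i o a b t c) using 1
  funext k; cases k <;> rfl

theorem pop_inp {x : A} : Runs (pop (Γ := Alph A B) .inp) (stks (x :: i) o a b t c)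
    (stks i o a b t c) 1 := by
  convert! Runs.pop (Γ := Alph A B) .inp (stks (x :: i) o a b t c) using 1
  funext k; cases k <;> rfl

theorem pop_a {x : Bool} : Runs (pop (Γ := Alph A B) .a) (stks i o (x :: a) b t c)
    (stks i o a b t c) 1 := by
  convert! Runs.pop (Γ := Alph A B) .a (stks i o (x :: a) b t c) using 1
  funext k; cases k <;> rfl

theorem pop_b {x : Bool} : Runs (pop (Γ := Alph A B) .b) (stks i o a (x :: b) t c)
    (stks i o a b t c) 1 := by
  convert! Runs.pop (Γ := Alph A B) .b (stks i o a (x :: b) t c) using 1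
  funext k; cases k <;> rfl

theorem pop_t {x : Bool} : Runs (pop (Γ := Alph A B) .t) (stks i o a b (x :: t) c)
    (stks i o a b t c) 1 := by
  convert! Runs.pop (Γ := Alph A B) .t (stks i o a b (x :: t) c) using 1
  funext k; cases k <;> rfl

theorem pop_c {x : Bool} : Runs (pop (Γ := Alph A B) .c) (stks i o a b t (x :: c))
    (stks i o a b t c) 1 := by
  convert! Runs.pop (Γ := Alph A B) .c (stks i o a b t (x :: c)) using 1
  funext k; cases k <;> rfl

end basic

variable (A B : Type)

/-- The body of the loop that reads a tree code from the stack `a`: the counter stack `c` holds one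
symbol for each subtree that is still to be read. -/
def readBodyA : Prog (Alph A B) :=
  (pop .c).seq (.ifte .a (fun x : Option Bool => x == some true)
    ((pop .a).seq ((push .t true).seq ((push .c true).seq (push .c true))))
    ((pop .a).seq (push .t false)))

/-- Move one tree code from the stack `a` to the stack `t`, reversing it. -/
def readA : Prog (Alph A B) :=
  (push .c true).seq (.loop .c (fun x : Option Bool => x.isSome) (readBodyA A B))

/-- The body of the loop that reads a tree code from the stack `b`. -/
def readBodyB : Prog (Alph A B) :=
  (pop .c).seq (.ifte .b (fun x : Option Bool => x == some true)
    ((pop .b).seq ((push .t true).seq ((push .c true).seq (push .c true))))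
    ((pop .b).seq (push .t false)))

/-- Move one tree code from the stack `b` to the stack `t`, reversing it. -/
def readB : Prog (Alph A B) :=
  (push .c true).seq (.loop .c (fun x : Option Bool => x.isSome) (readBodyB A B))

/-- Move the contents of `t` to `a`. -/
def unTA : Prog (Alph A B) :=
  .loop .t (fun x : Option Bool => x.isSome) (.ifte .t (fun x : Option Bool => x == some true)
    ((pop .t).seq (push .a true)) ((pop .t).seq (push .a false)))

/-- Move the contents of `t` to `b`. -/
def unTB : Prog (Alph A B) :=
  .loop .t (fun x : Option Bool => x.isSome) (.ifte .t (fun x : Option Bool => x == some true)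
    ((pop .t).seq (push .b true)) ((pop .t).seq (push .b false)))

/-- Move the contents of `t` to both data stacks. -/
def unTAB : Prog (Alph A B) :=
  .loop .t (fun x : Option Bool => x.isSome) (.ifte .t (fun x : Option Bool => x == some true)
    ((pop .t).seq ((push .a true).seq (push .b true)))
    ((pop .t).seq ((push .a false).seq (push .b false))))

/-- Erase the contents of `t`. -/
def clearT : Prog (Alph A B) :=
  .loop .t (fun x : Option Bool => x.isSome) (pop .t)

/-- Move a tree from `a` to `b`. -/
def mvAB : Prog (Alph A B) := (readA A B).seq (unTB A B)

/-- Move a tree from `b` to `a`. -/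
def mvBA : Prog (Alph A B) := (readB A B).seq (unTA A B)

/-- Duplicate the tree on top of `a`. -/
def dup : Prog (Alph A B) := (readA A B).seq ((unTAB A B).seq (mvBA A B))

/-- Erase the tree on top of `a`. -/
def drop : Prog (Alph A B) := (readA A B).seq (clearT A B)

variable {A B} {i : List A} {o : List B} {a b t c : List Bool}

theorem runs_readA_loop (T : BTree) : ∀ {a t c S n},
    Runs (.loop .c (fun x : Option Bool => x.isSome) (readBodyA A B))
      (stks i o a b (T.code.reverse ++ t) c) S n →
    Runs (.loop .c (fun x : Option Bool => x.isSome) (readBodyA A B))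
      (stks i o (T.code ++ a) b t (true :: c)) S (8 * T.size + n) := by
  induction T with
  | nil =>
    intro a t c S n h
    refine (Runs.loopStep rfl (pop_c.seq (.ifFalse rfl (pop_a.seq (push_t false)))) h).weaken ?_
    simp only [BTree.size_nil]; omega
  | cons l r ihl ihr =>
    intro a t c S n h
    have h' : (BTree.cons l r).code.reverse ++ t =
        r.code.reverse ++ (l.code.reverse ++ (true :: t)) := by simp [BTree.code]
    rw [h'] at h
    have h'' : (BTree.cons l r).code ++ a = true :: (l.code ++ (r.code ++ a)) := by
      simp [BTree.code]
    rw [h'']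
    refine (Runs.loopStep rfl (pop_c.seq (.ifTrue rfl (pop_a.seq ((push_t true).seq
      ((push_c true).seq (push_c true)))))) (ihl (ihr h))).weaken ?_
    simp only [BTree.size_cons]; omega

theorem runs_readA (T : BTree) : Runs (readA A B) (stks i o (T.code ++ a) b t [])
    (stks i o a b (T.code.reverse ++ t) []) (8 * T.size + 2) :=
  ((push_c true).seq (runs_readA_loop T (.loopStop rfl))).weaken (by omega)

theorem runs_readB_loop (T : BTree) : ∀ {b t c S n},
    Runs (.loop .c (fun x : Option Bool => x.isSome) (readBodyB A B))
      (stks i o a b (T.code.reverse ++ t) c) S n →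
    Runs (.loop .c (fun x : Option Bool => x.isSome) (readBodyB A B))
      (stks i o a (T.code ++ b) t (true :: c)) S (8 * T.size + n) := by
  induction T with
  | nil =>
    intro b t c S n h
    refine (Runs.loopStep rfl (pop_c.seq (.ifFalse rfl (pop_b.seq (push_t false)))) h).weaken ?_
    simp only [BTree.size_nil]; omega
  | cons l r ihl ihr =>
    intro b t c S n h
    have h' : (BTree.cons l r).code.reverse ++ t =
        r.code.reverse ++ (l.code.reverse ++ (true :: t)) := by simp [BTree.code]
    rw [h'] at h
    have h'' : (BTree.cons l r).code ++ b = true :: (l.code ++ (r.code ++ b)) := by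
      simp [BTree.code]
    rw [h'']
    refine (Runs.loopStep rfl (pop_c.seq (.ifTrue rfl (pop_b.seq ((push_t true).seq
      ((push_c true).seq (push_c true)))))) (ihl (ihr h))).weaken ?_
    simp only [BTree.size_cons]; omega

theorem runs_readB (T : BTree) : Runs (readB A B) (stks i o a (T.code ++ b) t [])
    (stks i o a b (T.code.reverse ++ t) []) (8 * T.size + 2) :=
  ((push_c true).seq (runs_readB_loop T (.loopStop rfl))).weaken (by omega)

theorem runs_unTA : ∀ {t a : List Bool}, Runs (unTA A B) (stks i o a b t c)
    (stks i o (t.reverse ++ a) b [] c) (4 * t.length + 1)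
  | [], a => .loopStop rfl
  | x :: t, a => by
    have ih := runs_unTA (t := t) (a := x :: a)
    rw [List.reverse_cons, List.append_assoc]
    cases x
    · refine (Runs.loopStep rfl (.ifFalse rfl (pop_t.seq (push_a _))) ih).weaken ?_
      simp only [List.length_cons]; omega
    · refine (Runs.loopStep rfl (.ifTrue rfl (pop_t.seq (push_a _))) ih).weaken ?_
      simp only [List.length_cons]; omega

theorem runs_unTB : ∀ {t b : List Bool}, Runs (unTB A B) (stks i o a b t c)
    (stks i o a (t.reverse ++ b) [] c) (4 * t.length + 1)
  | [], b => .loopStop rfl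
  | x :: t, b => by
    have ih := runs_unTB (t := t) (b := x :: b)
    rw [List.reverse_cons, List.append_assoc]
    cases x
    · refine (Runs.loopStep rfl (.ifFalse rfl (pop_t.seq (push_b _))) ih).weaken ?_
      simp only [List.length_cons]; omega
    · refine (Runs.loopStep rfl (.ifTrue rfl (pop_t.seq (push_b _))) ih).weaken ?_
      simp only [List.length_cons]; omega

theorem runs_unTAB : ∀ {t a b : List Bool}, Runs (unTAB A B) (stks i o a b t c)
    (stks i o (t.reverse ++ a) (t.reverse ++ b) [] c) (5 * t.length + 1)
  | [], a, b => .loopStop rfl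
  | x :: t, a, b => by
    have ih := runs_unTAB (t := t) (a := x :: a) (b := x :: b)
    rw [List.reverse_cons, List.append_assoc, List.append_assoc]
    cases x
    · refine (Runs.loopStep rfl (.ifFalse rfl (pop_t.seq ((push_a _).seq (push_b _)))) ih).weaken ?_
      simp only [List.length_cons]; omega
    · refine (Runs.loopStep rfl (.ifTrue rfl (pop_t.seq ((push_a _).seq (push_b _)))) ih).weaken ?_
      simp only [List.length_cons]; omega

theorem runs_clearT : ∀ {t : List Bool}, Runs (clearT A B) (stks i o a b t c)
    (stks i o a b [] c) (2 * t.length + 1)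
  | [] => .loopStop rfl
  | x :: t => by
    refine (Runs.loopStep rfl pop_t (runs_clearT (t := t))).weaken ?_
    simp only [List.length_cons]; omega

theorem runs_mvAB (T : BTree) : Runs (mvAB A B) (stks i o (T.code ++ a) b [] [])
    (stks i o a (T.code ++ b) [] []) (15 * T.size) := by
  have h := (runs_readA (A := A) (B := B) (i := i) (o := o) (a := a) (b := b) (t := []) T).seq
    runs_unTB
  simp only [List.append_nil, List.reverse_reverse, List.length_reverse] at h
  refine h.weaken ?_
  have := T.size_pos
  simp only [BTree.size] at *; omega

theorem runs_mvBA (T : BTree) : Runs (mvBA A B) (stks i o a (T.code ++ b) [] [])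
    (stks i o (T.code ++ a) b [] []) (15 * T.size) := by
  have h := (runs_readB (A := A) (B := B) (i := i) (o := o) (a := a) (b := b) (t := []) T).seq
    runs_unTA
  simp only [List.append_nil, List.reverse_reverse, List.length_reverse] at h
  refine h.weaken ?_
  have := T.size_pos
  simp only [BTree.size] at *; omega

theorem runs_dup (T : BTree) : Runs (dup A B) (stks i o (T.code ++ a) b [] [])
    (stks i o (T.code ++ (T.code ++ a)) b [] []) (31 * T.size) := by
  have h := (runs_readA (A := A) (B := B) (i := i) (o := o) (a := a) (b := b) (t := []) T).seq
    (runs_unTAB.seq (by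
      simp only [List.append_nil, List.reverse_reverse]
      exact runs_mvBA (a := T.code ++ a) T))
  simp only [List.append_nil, List.length_reverse] at h
  refine h.weaken ?_
  have := T.size_pos
  simp only [BTree.size] at *; omega

theorem runs_drop (T : BTree) : Runs (drop A B) (stks i o (T.code ++ a) b [] [])
    (stks i o a b [] []) (15 * T.size) := by
  have h := (runs_readA (A := A) (B := B) (i := i) (o := o) (a := a) (b := b) (t := []) T).seq
    runs_clearT
  simp only [List.append_nil, List.length_reverse] at h
  refine h.weaken ?_
  have := T.size_pos
  simp only [BTree.size] at *; omega

/-- Push the word `w` on the stack `a`, with its first letter on top. -/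
def pushAll (A B : Type) : List Bool → Prog (Alph A B)
  | [] => skip
  | x :: w => (pushAll A B w).seq (push .a x)

theorem runs_pushAll : ∀ w : List Bool, Runs (pushAll A B w) (stks i o a b t c)
    (stks i o (w ++ a) b t c) (w.length + 1)
  | [] => .skip _
  | x :: w => (runs_pushAll w).seq (push_a x)

end Prog

/-! ### The polynomial-time calculus -/

/-- Types whose elements are represented by trees. -/
class Coded (α : Type) where
  tree : α → BTree

open Coded

/-- The size of the tree that represents `x`. -/
def tsize {α : Type} [Coded α] (x : α) : ℕ := (tree x).size

theorem code_length {α : Type} [Coded α] (x : α) : (tree x).code.length = tsize x := rfl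

/-- A natural number is represented in unary, by a comb. -/
def natTree : ℕ → BTree
  | 0 => .nil
  | n + 1 => .cons .nil (natTree n)

/-- A list is represented by its nested pairs. -/
def listTree {α : Type} [Coded α] : List α → BTree
  | [] => .nil
  | x :: l => .cons (tree x) (listTree l)

instance : Coded Unit := ⟨fun _ => .nil⟩
instance : Coded ℕ := ⟨natTree⟩
instance : Coded Bool := ⟨fun x => natTree x.toNat⟩
instance {α β : Type} [Coded α] [Coded β] : Coded (α × β) := ⟨fun x => .cons (tree x.1) (tree x.2)⟩
instance {α : Type} [Coded α] : Coded (List α) := ⟨listTree⟩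

section sizes

variable {α β : Type} [Coded α] [Coded β]

theorem tree_pair (x : α × β) : tree x = .cons (tree x.1) (tree x.2) := rfl

theorem tree_cons (x : α) (l : List α) : tree (x :: l) = .cons (tree x) (tree l) := rfl

theorem tsize_pair (x : α) (y : β) : tsize (x, y) = tsize x + tsize y + 1 := BTree.size_cons _ _

theorem tsize_eq (x : α × β) : tsize x = tsize x.1 + tsize x.2 + 1 := BTree.size_cons _ _

theorem tsize_nil : tsize ([] : List α) = 1 := rfl

theorem tsize_cons (x : α) (l : List α) : tsize (x :: l) = tsize x + tsize l + 1 :=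
  BTree.size_cons _ _

theorem tsize_nat (n : ℕ) : tsize n = 2 * n + 1 := by
  induction n with
  | zero => rfl
  | succ n ih =>
    have : tsize (n + 1) = 1 + tsize n + 1 := BTree.size_cons _ _
    omega

theorem tsize_bool_le (x : Bool) : tsize x ≤ 3 := by
  cases x <;> decide

theorem tsize_append (l l' : List α) : tsize (l ++ l') + 1 = tsize l + tsize l' := by
  induction l with
  | nil => simp [tsize_nil]; omega
  | cons x l ih => simp only [List.cons_append, tsize_cons]; omega

theorem tsize_reverse (l : List α) : tsize l.reverse = tsize l := by
  induction l with
  | nil => rfl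
  | cons x l ih =>
    have := tsize_append l.reverse [x]
    simp only [List.reverse_cons, tsize_cons, tsize_nil] at *
    omega

theorem length_lt_tsize (l : List α) : l.length < tsize l := by
  induction l with
  | nil => simp [tsize_nil]
  | cons x l ih => simp only [List.length_cons, tsize_cons]; omega

theorem tsize_le_of_mem {x : α} {l : List α} (h : x ∈ l) : tsize x ≤ tsize l := by
  induction l with
  | nil => simp at h
  | cons y l ih =>
    rw [tsize_cons]
    rcases List.mem_cons.1 h with rfl | h
    · omega
    · have := ih h; omega

theorem tsize_le_length_mul {l : List α} {n : ℕ} (h : ∀ x ∈ l, tsize x ≤ n) :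
    tsize l ≤ l.length * (n + 1) + 1 := by
  induction l with
  | nil => simp [tsize_nil]
  | cons y l ih =>
    have h1 := ih fun x hx => h x (List.mem_cons_of_mem _ hx)
    have h2 := h y List.mem_cons_self
    simp only [tsize_cons, List.length_cons, add_mul, one_mul]; omega

end sizes

theorem polyEval_mono (p : Polynomial ℕ) {m n : ℕ} (h : m ≤ n) : p.eval m ≤ p.eval n := by
  rw [Polynomial.eval_eq_sum_range, Polynomial.eval_eq_sum_range]
  gcongr

/-- `PT f`: the function `f` on tree-represented data is computed in polynomial time by a structured
stack program, which replaces the code of `x` on top of the stack `a` by the code of `f x` and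
leaves all that is below untouched. The size of `f x` is polynomially bounded, too. -/
@[fun_prop]
def PT {α β : Type} [Coded α] [Coded β] (f : α → β) : Prop :=
  (∃ q : Polynomial ℕ, ∀ x, tsize (f x) ≤ q.eval (tsize x)) ∧
  ∀ A B : Type, ∃ (p : Prog (Alph A B)) (q : Polynomial ℕ), ∀ x i o a b,
    p.Runs (stks i o ((tree x).code ++ a) b [] []) (stks i o ((tree (f x)).code ++ a) b [] [])
      (q.eval (tsize x))

namespace PT

open Polynomial Prog

variable {α β γ δ : Type} [Coded α] [Coded β] [Coded γ] [Coded δ]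

/-- A function that does not change the representing tree. -/
theorem of_tree_eq {f : α → β} (h : ∀ x, tree (f x) = tree x) : PT f := by
  refine ⟨⟨X, fun x => by simp [tsize, h]⟩, fun A B => ⟨.skip, 1, fun x i o a b => ?_⟩⟩
  simp only [eval_one, h]
  exact .skip _

@[fun_prop]
theorem id : PT (fun x : α => x) := of_tree_eq fun _ => rfl

@[fun_prop]
theorem comp {g : β → γ} {f : α → β} (hg : PT g) (hf : PT f) : PT (fun x => g (f x)) := by
  obtain ⟨⟨sg, hsg⟩, hg⟩ := hg
  obtain ⟨⟨sf, hsf⟩, hf⟩ := hf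
  refine ⟨⟨sg.comp sf, fun x => ?_⟩, fun A B => ?_⟩
  · rw [eval_comp]
    exact (hsg _).trans (polyEval_mono _ (hsf x))
  · obtain ⟨pg, qg, hg⟩ := hg A B
    obtain ⟨pf, qf, hf⟩ := hf A B
    refine ⟨pf.seq pg, qf + qg.comp sf, fun x i o a b => ((hf x i o a b).seq (hg _ i o a b)).weaken ?_⟩
    rw [eval_add, eval_comp]
    gcongr
    exact polyEval_mono _ (hsf x)

@[fun_prop]
theorem const (y : β) : PT (fun _ : α => y) := by
  refine ⟨⟨C (tsize y), fun x => by simp⟩, fun A B =>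
    ⟨(drop A B).seq (pushAll A B (tree y).code), 15 * X + C (tsize y + 1), fun x i o a b =>
      ((runs_drop _).seq (runs_pushAll _)).weaken ?_⟩⟩
  simp [code_length, tsize]

@[fun_prop]
theorem pair {f : α → β} {g : α → γ} (hf : PT f) (hg : PT g) : PT (fun x => (f x, g x)) := by
  obtain ⟨⟨sg, hsg⟩, hg⟩ := hg
  obtain ⟨⟨sf, hsf⟩, hf⟩ := hf
  refine ⟨⟨sf + sg + 1, fun x => ?_⟩, fun A B => ?_⟩
  · simp only [tsize_pair, eval_add, eval_one]
    gcongr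
    exacts [hsf x, hsg x]
  · obtain ⟨pg, qg, hg⟩ := hg A B
    obtain ⟨pf, qf, hf⟩ := hf A B
    refine ⟨(dup A B).seq (pf.seq ((mvAB A B).seq (pg.seq ((mvBA A B).seq (push .a true))))),
      31 * X + (qf + (15 * sf + (qg + (15 * sf + 1)))), fun x i o a b => ?_⟩
    have h := (runs_dup (i := i) (o := o) (a := a) (b := b) (tree x)).seq ((hf x i o _ b).seq
      ((runs_mvAB _).seq ((hg x i o a _).seq ((runs_mvBA _).seq (push_a true)))))
    have e : (tree (f x, g x)).code ++ a = true :: ((tree (f x)).code ++ ((tree (g x)).code ++ a)) := by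
      simp [tree_pair, BTree.code]
    rw [e]
    refine h.weaken ?_
    simp only [eval_add, eval_mul, eval_X, eval_one, eval_ofNat]
    gcongr <;> first | exact le_rfl | exact hsf x

theorem fst : PT (fun x : α × β => x.1) := by
  refine ⟨⟨X, fun x => ?_⟩, fun A B => ⟨(pop .a).seq ((mvAB A B).seq ((drop A B).seq (mvBA A B))),
    45 * X + 1, fun x i o a b => ?_⟩⟩
  · have := tsize_eq x
    simp only [eval_X]; omega
  · have e : (tree x).code ++ a = true :: ((tree x.1).code ++ ((tree x.2).code ++ a)) := by
      simp [tree_pair, BTree.code]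
    rw [e]
    refine (pop_a.seq ((runs_mvAB _).seq ((runs_drop _).seq (runs_mvBA _)))).weaken ?_
    have := tsize_eq x
    simp only [tsize, eval_add, eval_mul, eval_X, eval_one, eval_ofNat] at *
    omega

theorem snd : PT (fun x : α × β => x.2) := by
  refine ⟨⟨X, fun x => ?_⟩, fun A B => ⟨(pop .a).seq (drop A B), 45 * X + 1, fun x i o a b => ?_⟩⟩
  · have := tsize_eq x
    simp only [eval_X]; omega
  · have e : (tree x).code ++ a = true :: ((tree x.1).code ++ ((tree x.2).code ++ a)) := by
      simp [tree_pair, BTree.code]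
    rw [e]
    refine (pop_a.seq (runs_drop _)).weaken ?_
    have := tsize_eq x
    simp only [tsize, eval_add, eval_mul, eval_X, eval_one, eval_ofNat] at *
    omega

/-- Case distinction on whether a tree is a leaf or an inner node. Inner nodes are passed on as
elements of a type `δ`. -/
theorem treeCase {F : α × β → γ} {f : β → γ} {g : δ × β → γ} (hf : PT f) (hg : PT g)
    (h : ∀ x, (tree x.1 = .nil ∧ F x = f x.2) ∨
      ∃ d : δ, tree x.1 = tree d ∧ tree d ≠ .nil ∧ F x = g (d, x.2)) : PT F := by
  obtain ⟨⟨sg, hsg⟩, hg⟩ := hg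
  obtain ⟨⟨sf, hsf⟩, hf⟩ := hf
  have key : ∀ (x : α × β) (d : δ), tree x.1 = tree d → tsize (d, x.2) = tsize x := by
    intro x d h
    rw [tsize_pair, tsize_eq x]
    simp only [tsize, h]
  have key' : ∀ x : α × β, tsize x.2 ≤ tsize x := by
    intro x
    have := tsize_eq x
    omega
  refine ⟨⟨sf + sg, fun x => ?_⟩, fun A B => ?_⟩
  · rw [eval_add]
    rcases h x with ⟨-, hF⟩ | ⟨d, hd, -, hF⟩
    · rw [hF]
      exact ((hsf _).trans (polyEval_mono _ (key' x))).trans (Nat.le_add_right _ _)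
    · rw [hF]
      have := hsg (d, x.2)
      rw [key x d hd] at this
      omega
  · obtain ⟨pg, qg, hg⟩ := hg A B
    obtain ⟨pf, qf, hf⟩ := hf A B
    refine ⟨(pop .a).seq (.ifte .a (fun x : Option Bool => x == some true)
      ((push .a true).seq pg) ((pop .a).seq pf)), 3 + qf + qg, fun x i o a b => ?_⟩
    have e : (tree x).code ++ a = true :: ((tree x.1).code ++ ((tree x.2).code ++ a)) := by
      simp [tree_pair, BTree.code]
    rw [e]
    simp only [eval_add, eval_ofNat]
    rcases h x with ⟨h1, hF⟩ | ⟨d, hd, hn, hF⟩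
    · rw [hF, h1]
      have := polyEval_mono qf (key' x)
      exact (pop_a.seq (.ifFalse rfl (pop_a.seq (hf x.2 i o a b)))).weaken (by omega)
    · have := hg (d, x.2) i o a b
      rw [key x d hd] at this
      have e' : (tree (d, x.2)).code ++ a = true :: ((tree d).code ++ ((tree x.2).code ++ a)) := by
        simp [tree_pair, BTree.code]
      rw [e'] at this
      rw [hF, hd]
      refine (pop_a.seq (.ifTrue ?_ ((push_a true).seq this))).weaken (by omega)
      cases h : tree d with
      | nil => exact absurd h hn
      | cons l r => rfl

theorem runs_fold {A B : Type} {H : β × γ → γ} {p : Prog (Alph A B)} {q : Polynomial ℕ}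
    (hp : ∀ x i o a b, p.Runs (stks i o ((tree x).code ++ a) b [] [])
      (stks i o ((tree (H x)).code ++ a) b [] []) (q.eval (tsize x))) (N : ℕ)
    {i : List A} {o : List B} {a b : List Bool} : ∀ (l : List β) (z : γ),
    (∀ l', l' <+: l → tsize (l'.foldl (fun s e => H (e, s)) z) ≤ N) → (∀ e ∈ l, tsize e ≤ N) →
    Runs (.loop .b (fun x : Option Bool => x == some true)
      ((pop .b).seq ((mvBA A B).seq ((push .a true).seq p))))
      (stks i o ((tree z).code ++ a) ((tree l).code ++ b) [] [])
      (stks i o ((tree (l.foldl (fun s e => H (e, s)) z)).code ++ a) (false :: b) [] [])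
      (l.length * (15 * N + q.eval (2 * N + 1) + 3) + 1)
  | [], z, _, _ => (Runs.loopStop rfl).weaken (by simp)
  | e :: l, z, h1, h2 => by
    have ih := runs_fold hp N (i := i) (o := o) (a := a) (b := b) l (H (e, z))
      (fun l' hl' => h1 (e :: l') (by simpa using hl')) (fun e he => h2 e (List.mem_cons_of_mem _ he))
    have e1 : (tree (e :: l)).code ++ b = true :: ((tree e).code ++ ((tree l).code ++ b)) := by
      simp [tree_cons, BTree.code]
    have e2 : (tree (e, z)).code ++ a = true :: ((tree e).code ++ ((tree z).code ++ a)) := by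
      simp [tree_pair, BTree.code]
    have hpe := hp (e, z) i o a ((tree l).code ++ b)
    rw [e2] at hpe
    rw [e1]
    refine (Runs.loopStep rfl (pop_b.seq ((runs_mvBA _).seq ((push_a true).seq hpe))) ih).weaken ?_
    have h3 := h2 e List.mem_cons_self
    have h4 := h1 [] (by simp)
    rw [List.foldl_nil] at h4
    have h5 : q.eval (tsize (e, z)) ≤ q.eval (2 * N + 1) := polyEval_mono _ (by rw [tsize_pair]; omega)
    have h6 : BTree.size (tree e) = tsize e := rfl
    simp only [List.length_cons, add_mul, one_mul, h6]
    omega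

/-- Iteration over a list, provided that the intermediate results are of polynomial size. -/
theorem foldl_of_size {l : α → List β} {s : α → γ} {H : β × γ → γ} (hl : PT l) (hs : PT s)
    (hH : PT H) (q : Polynomial ℕ) (hq : ∀ x l', l' <+: l x →
      tsize (l'.foldl (fun s e => H (e, s)) (s x)) ≤ q.eval (tsize x)) :
    PT fun x => (l x).foldl (fun s e => H (e, s)) (s x) := by
  refine ⟨⟨q, fun x => hq x _ (List.prefix_refl _)⟩, fun A B => ?_⟩
  obtain ⟨⟨sz, hsz⟩, hpair⟩ := pair hl hs
  obtain ⟨p, qp, hp⟩ := hpair A B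
  obtain ⟨pH, qH, hpH⟩ := hH.2 A B
  refine ⟨p.seq ((pop .a).seq ((mvAB A B).seq ((Prog.loop .b (fun x : Option Bool => x == some true)
      ((pop .b).seq ((mvBA A B).seq ((push .a true).seq pH)))).seq (pop .b)))),
    qp + (1 + (15 * sz + (sz * (15 * (q + sz) + qH.comp (2 * (q + sz) + 1) + 3) + 1 + 1))),
    fun x i o a b => ?_⟩
  have e1 : (tree (l x, s x)).code ++ a = true :: ((tree (l x)).code ++ ((tree (s x)).code ++ a)) := by
    simp [tree_pair, BTree.code]
  have h1 := hp x i o a b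
  rw [e1] at h1
  have hlx : tsize (l x) ≤ sz.eval (tsize x) := by
    have := hsz x
    rw [tsize_pair] at this
    omega
  have h2 := runs_fold hpH (q.eval (tsize x) + sz.eval (tsize x)) (i := i) (o := o) (a := a) (b := b)
    (l x) (s x) (fun l' hl' => (hq x l' hl').trans (Nat.le_add_right _ _))
    (fun e he => (tsize_le_of_mem he).trans (hlx.trans (Nat.le_add_left _ _)))
  refine (h1.seq (pop_a.seq ((runs_mvAB _).seq (h2.seq pop_b)))).weaken ?_
  have h3 : (l x).length ≤ sz.eval (tsize x) := (length_lt_tsize _).le.trans hlx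
  simp only [eval_add, eval_mul, eval_comp, eval_one, eval_ofNat]
  gcongr
  exact hlx

end PT

/-- The quantity `g x` is bounded by a polynomial in the size of `x`. -/
def PolyBdd {α : Type} [Coded α] (g : α → ℕ) : Prop :=
  ∃ q : Polynomial ℕ, ∀ x, g x ≤ q.eval (tsize x)

namespace PolyBdd

open Polynomial

variable {α β : Type} [Coded α] [Coded β] {f g : α → ℕ}

theorem mono (hg : PolyBdd g) (h : ∀ x, f x ≤ g x) : PolyBdd f := by
  obtain ⟨q, hq⟩ := hg
  exact ⟨q, fun x => (h x).trans (hq x)⟩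

theorem const (n : ℕ) : PolyBdd (fun _ : α => n) := ⟨C n, fun x => by simp⟩

theorem add (hf : PolyBdd f) (hg : PolyBdd g) : PolyBdd (fun x => f x + g x) := by
  obtain ⟨p, hp⟩ := hf
  obtain ⟨q, hq⟩ := hg
  exact ⟨p + q, fun x => by rw [eval_add]; exact add_le_add (hp x) (hq x)⟩

theorem mul (hf : PolyBdd f) (hg : PolyBdd g) : PolyBdd (fun x => f x * g x) := by
  obtain ⟨p, hp⟩ := hf
  obtain ⟨q, hq⟩ := hg
  exact ⟨p * q, fun x => by rw [eval_mul]; exact Nat.mul_le_mul (hp x) (hq x)⟩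

theorem tsize {f : α → β} (hf : PT f) : PolyBdd (fun x => tsize (f x)) := hf.1

theorem length {f : α → List β} (hf : PT f) : PolyBdd (fun x => (f x).length) :=
  (tsize hf).mono fun _ => (length_lt_tsize _).le

end PolyBdd

namespace PT

open Polynomial

variable {α β γ δ : Type} [Coded α] [Coded β] [Coded γ] [Coded δ]

@[fun_prop]
theorem fst' {f : α → β × γ} (hf : PT f) : PT (fun x => (f x).1) := comp fst hf

@[fun_prop]
theorem snd' {f : α → β × γ} (hf : PT f) : PT (fun x => (f x).2) := comp snd hf

@[fun_prop]
theorem cons {f : α → β} {g : α → List β} (hf : PT f) (hg : PT g) : PT (fun x => f x :: g x) :=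
  comp (f := fun x => (f x, g x)) (g := fun y : β × List β => y.1 :: y.2)
    (of_tree_eq fun _ => rfl) (pair hf hg)

/-- Iteration over a list with a context `x`, provided that the intermediate results are of
polynomial size. -/
theorem foldl_of_bound {l : α → List β} {s : α → γ} {step : α → γ → β → γ} (hl : PT l) (hs : PT s)
    (hstep : PT fun y : α × γ × β => step y.1 y.2.1 y.2.2) (q : Polynomial ℕ)
    (hq : ∀ x l', l' <+: l x → tsize (l'.foldl (step x) (s x)) ≤ q.eval (tsize x)) :
    PT fun x => (l x).foldl (step x) (s x) := by
  have key : ∀ x (l' : List β) (z : γ), l'.foldl (fun (s : γ × α) e => (step s.2 s.1 e, s.2)) (z, x) =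
      (l'.foldl (step x) z, x) := by
    intro x l'
    induction l' with
    | nil => intro z; rfl
    | cons e l' ih => intro z; exact ih _
  have := foldl_of_size (H := fun y : β × γ × α => (step y.2.2 y.2.1 y.1, y.2.2)) hl
    (pair hs id) (by fun_prop) (q + X + 1) (by
      intro x l' hl'
      simp only [key, tsize_pair, eval_add, eval_X, eval_one]
      gcongr
      exact hq x l' hl')
  simp only [key] at this
  exact comp fst this

/-- Iteration over a list, provided that some measure of the size of the intermediate result grows
at each step by an amount that depends only on the context and the current element of the list. -/
theorem foldl_of_growth {l : α → List β} {s : α → γ} {step : α → γ → β → γ} (hl : PT l) (hs : PT s)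
    (hstep : PT fun y : α × γ × β => step y.1 y.2.1 y.2.2) (μ : γ → ℕ) (r : Polynomial ℕ)
    (hr : ∀ z, tsize z ≤ r.eval (μ z)) (hμ : PolyBdd fun x => μ (s x)) (g : α × β → ℕ)
    (hg : PolyBdd g) (h : ∀ x z e, μ (step x z e) ≤ μ z + g (x, e)) :
    PT fun x => (l x).foldl (step x) (s x) := by
  obtain ⟨qs, hqs⟩ := hμ
  obtain ⟨qg, hqg⟩ := hg
  obtain ⟨ql, hql⟩ := PolyBdd.tsize hl
  have key : ∀ x N (l' : List β) (z : γ), (∀ e ∈ l', g (x, e) ≤ N) →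
      μ (l'.foldl (step x) z) ≤ μ z + l'.length * N := by
    intro x N l'
    induction l' with
    | nil => intro z _; simp
    | cons e l' ih =>
      intro z hN
      have h1 := ih (step x z e) fun e he => hN e (List.mem_cons_of_mem _ he)
      have h2 := h x z e
      have h3 := hN e List.mem_cons_self
      simp only [List.foldl_cons, List.length_cons, add_mul, one_mul]
      omega
  refine foldl_of_bound hl hs hstep (r.comp (qs + ql * qg.comp (X + ql + 1))) fun x l' hl' => ?_
  refine (hr _).trans ?_
  rw [eval_comp]
  refine polyEval_mono _ ?_
  simp only [eval_add, eval_mul, eval_comp, eval_X, eval_one]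
  have h1 : ∀ e ∈ l', g (x, e) ≤ qg.eval (tsize x + ql.eval (tsize x) + 1) := by
    intro e he
    refine (hqg _).trans (polyEval_mono _ ?_)
    have := (tsize_le_of_mem (hl'.subset he)).trans (hql x)
    rw [tsize_pair]
    omega
  refine (key x _ l' (s x) h1).trans ?_
  gcongr
  · exact hqs x
  · exact (hl'.length_le.trans (length_lt_tsize _).le).trans (hql x)

/-- Iteration over a list with additive growth of the result. -/
theorem foldl {l : α → List β} {s : α → γ} {step : α → γ → β → γ} (hl : PT l) (hs : PT s)
    (hstep : PT fun y : α × γ × β => step y.1 y.2.1 y.2.2) (g : α × β → ℕ)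
    (hg : PolyBdd g) (h : ∀ x z e, tsize (step x z e) ≤ tsize z + g (x, e)) :
    PT fun x => (l x).foldl (step x) (s x) :=
  foldl_of_growth hl hs hstep tsize X (fun z => by simp) (PolyBdd.tsize hs) g hg h

/-! ### Case distinctions -/

theorem listCase {l : α → List β} {f : α → γ} {g : α → β → List β → γ} (hl : PT l) (hf : PT f)
    (hg : PT fun y : α × β × List β => g y.1 y.2.1 y.2.2) :
    PT fun x => match l x with
      | [] => f x
      | e :: t => g x e t := by
  have : PT (fun y : List β × α => match y.1 with
      | [] => f y.2
      | e :: t => g y.2 e t) := by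
    refine treeCase (f := f) (g := fun y : (β × List β) × α => g y.2 y.1.1 y.1.2) hf ?_ ?_
    · exact comp (f := fun y : (β × List β) × α => (y.2, y.1.1, y.1.2)) hg (by fun_prop)
    · rintro ⟨_ | ⟨e, t⟩, x⟩
      · exact .inl ⟨rfl, rfl⟩
      · exact .inr ⟨(e, t), rfl, by simp [tree_pair], rfl⟩
  exact comp this (pair hl id)

theorem natCase {n : α → ℕ} {f : α → γ} {g : α → ℕ → γ} (hn : PT n) (hf : PT f)
    (hg : PT fun y : α × ℕ => g y.1 y.2) :
    PT fun x => match n x with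
      | 0 => f x
      | m + 1 => g x m := by
  have : PT (fun y : ℕ × α => match y.1 with
      | 0 => f y.2
      | m + 1 => g y.2 m) := by
    refine treeCase (f := f) (g := fun y : (Unit × ℕ) × α => g y.2 y.1.2) hf ?_ ?_
    · exact comp (f := fun y : (Unit × ℕ) × α => (y.2, y.1.2)) hg (by fun_prop)
    · rintro ⟨_ | m, x⟩
      · exact .inl ⟨rfl, rfl⟩
      · exact .inr ⟨((), m), rfl, by simp [tree_pair], rfl⟩
  exact comp this (pair hn id)

@[fun_prop]
theorem toNat {f : α → Bool} (hf : PT f) : PT fun x => (f x).toNat :=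
  comp (of_tree_eq fun _ => rfl) hf

@[fun_prop]
theorem cond {c : α → Bool} {f g : α → γ} (hc : PT c) (hf : PT f) (hg : PT g) :
    PT fun x => bif c x then f x else g x := by
  have := natCase (f := g) (g := fun x _ => f x) (toNat hc) hg (by fun_prop)
  refine (congrArg PT (funext fun x => ?_)).mp this
  cases c x <;> rfl

@[fun_prop]
theorem not {f : α → Bool} (hf : PT f) : PT fun x => !(f x) := by
  have := cond hf (const false) (const true)
  refine (congrArg PT (funext fun x => ?_)).mp this
  cases f x <;> rfl

@[fun_prop]
theorem and {f g : α → Bool} (hf : PT f) (hg : PT g) : PT fun x => f x && g x := by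
  have := cond hf hg (const false)
  refine (congrArg PT (funext fun x => ?_)).mp this
  cases f x <;> rfl

@[fun_prop]
theorem or {f g : α → Bool} (hf : PT f) (hg : PT g) : PT fun x => f x || g x := by
  have := cond hf (const true) hg
  refine (congrArg PT (funext fun x => ?_)).mp this
  cases f x <;> rfl

@[fun_prop]
theorem xor {f g : α → Bool} (hf : PT f) (hg : PT g) : PT fun x => f x ^^ g x := by
  have := cond hf (not hg) hg
  refine (congrArg PT (funext fun x => ?_)).mp this
  cases f x <;> simp

/-! ### Lists and unary numbers -/

@[fun_prop]
theorem succ {f : α → ℕ} (hf : PT f) : PT fun x => f x + 1 :=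
  comp (f := fun x => ((), f x)) (g := fun y : Unit × ℕ => y.2 + 1) (of_tree_eq fun _ => rfl)
    (pair (const ()) hf)

@[fun_prop]
theorem replicate_unit {f : α → ℕ} (hf : PT f) : PT fun x => List.replicate (f x) () := by
  refine comp (g := fun n => List.replicate n ()) (of_tree_eq fun n => ?_) hf
  induction n with
  | zero => rfl
  | succ n ih => rw [List.replicate_succ, tree_cons, ih]; rfl

@[fun_prop]
theorem length {f : α → List β} (hf : PT f) : PT fun x => (f x).length := by
  have := foldl (step := fun (_ : α) n _ => n + 1) hf (const 0) (by fun_prop) (fun _ => 2)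
    (.const 2) (fun x z e => by simp only [tsize_nat]; omega)
  refine (congrArg PT (funext fun x => ?_)).mp this
  have key : ∀ (l : List β) k, l.foldl (fun n _ => n + 1) k = l.length + k := by
    intro l
    induction l with
    | nil => simp
    | cons e l ih => intro k; simp only [List.foldl_cons, ih, List.length_cons]; omega
  rw [key]; rfl

@[fun_prop]
theorem reverse {f : α → List β} (hf : PT f) : PT fun x => (f x).reverse := by
  have := foldl (step := fun (_ : α) l e => e :: l) hf (const []) (by fun_prop)
    (fun y => tsize y.2 + 1) ((PolyBdd.tsize snd).add (.const 1))
    (fun x z e => by simp only [tsize_cons]; omega)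
  refine (congrArg PT (funext fun x => ?_)).mp this
  rw [List.foldl_flip_cons_eq_append']
  simp

@[fun_prop]
theorem append {f g : α → List β} (hf : PT f) (hg : PT g) : PT fun x => f x ++ g x := by
  have := foldl (step := fun (_ : α) l e => e :: l) (reverse hf) hg (by fun_prop)
    (fun y => tsize y.2 + 1) ((PolyBdd.tsize snd).add (.const 1))
    (fun x z e => by simp only [tsize_cons]; omega)
  refine (congrArg PT (funext fun x => ?_)).mp this
  rw [List.foldl_flip_cons_eq_append']
  simp

@[fun_prop]
theorem flatMap {l : α → List β} {f : α → β → List γ} (hl : PT l)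
    (hf : PT fun y : α × β => f y.1 y.2) : PT fun x => (l x).flatMap (f x) := by
  have := foldl (step := fun (x : α) z e => f x e ++ z) (reverse hl) (const [])
    (append (comp (f := fun y : α × List γ × β => (y.1, y.2.2)) hf (by fun_prop)) (by fun_prop))
    (fun y => tsize (f y.1 y.2)) (PolyBdd.tsize hf)
    (fun x z e => by have := tsize_append (f x e) z; dsimp only; omega)
  refine (congrArg PT (funext fun x => ?_)).mp this
  rw [List.foldl_reverse]
  induction l x with
  | nil => rfl
  | cons e t ih => simp [ih]

@[fun_prop]
theorem map {l : α → List β} {f : α → β → γ} (hl : PT l)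
    (hf : PT fun y : α × β => f y.1 y.2) : PT fun x => (l x).map (f x) := by
  have := flatMap (f := fun x e => [f x e]) hl (by fun_prop)
  refine (congrArg PT (funext fun x => ?_)).mp this
  rw [List.map_eq_flatMap]

@[fun_prop]
theorem any {l : α → List β} {f : α → β → Bool} (hl : PT l)
    (hf : PT fun y : α × β => f y.1 y.2) : PT fun x => (l x).any (f x) := by
  have := foldl (step := fun (x : α) z e => z || f x e) hl (const false)
    (or (by fun_prop) (comp (f := fun y : α × Bool × β => (y.1, y.2.2)) hf (by fun_prop)))
    (fun _ => 3) (.const 3) (fun x z e => (tsize_bool_le _).trans (Nat.le_add_left _ _))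
  refine (congrArg PT (funext fun x => ?_)).mp this
  have key : ∀ (l : List β) b, l.foldl (fun z e => z || f x e) b = (b || l.any (f x)) := by
    intro l
    induction l with
    | nil => simp
    | cons e l ih => intro b; simp [ih, Bool.or_assoc]
  rw [key]; rfl

@[fun_prop]
theorem all {l : α → List β} {f : α → β → Bool} (hl : PT l)
    (hf : PT fun y : α × β => f y.1 y.2) : PT fun x => (l x).all (f x) := by
  have := not (any (f := fun x e => !(f x e)) hl (by fun_prop))
  refine (congrArg PT (funext fun x => ?_)).mp this
  rw [List.not_any_eq_all_not]; simp

@[fun_prop]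
theorem tail {f : α → List β} (hf : PT f) : PT fun x => (f x).tail := by
  have := listCase (f := fun x => []) (g := fun x _ t => t) hf (by fun_prop) (by fun_prop)
  refine (congrArg PT (funext fun x => ?_)).mp this
  cases f x <;> rfl

@[fun_prop]
theorem headD {f : α → List β} {d : α → β} (hf : PT f) (hd : PT d) :
    PT fun x => (f x).headD (d x) := by
  have := listCase (f := d) (g := fun x e t => e) hf (by fun_prop) (by fun_prop)
  refine (congrArg PT (funext fun x => ?_)).mp this
  cases f x <;> rfl

@[fun_prop]
theorem drop {f : α → List β} {n : α → ℕ} (hn : PT n) (hf : PT f) :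
    PT fun x => (f x).drop (n x) := by
  have := foldl (step := fun (x : α) z (_ : Unit) => z.tail) (replicate_unit hn) hf (by fun_prop)
    (fun _ => 0) (.const 0) (fun x z e => by cases z <;> simp [tsize_cons, tsize_nil]; omega)
  refine (congrArg PT (funext fun x => ?_)).mp this
  have key : ∀ n (l : List β), (List.replicate n ()).foldl (fun z (_ : Unit) => z.tail) l =
      l.drop n := by
    intro n
    induction n with
    | zero => simp
    | succ n ih => intro l; rw [List.replicate_succ, List.foldl_cons, ih, List.drop_tail]
  exact key _ _

@[fun_prop]
theorem getD {f : α → List β} {n : α → ℕ} {d : α → β} (hf : PT f) (hn : PT n) (hd : PT d) :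
    PT fun x => (f x).getD (n x) (d x) := by
  have := headD (drop hn hf) hd
  refine (congrArg PT (funext fun x => ?_)).mp this
  simp [List.headD_eq_head?_getD, List.head?_drop, List.getD_eq_getElem?_getD]

@[fun_prop]
theorem nat_add {f g : α → ℕ} (hf : PT f) (hg : PT g) : PT fun x => f x + g x := by
  have := length (append (replicate_unit hf) (replicate_unit hg))
  simpa using this

@[fun_prop]
theorem nat_mul {f g : α → ℕ} (hf : PT f) (hg : PT g) : PT fun x => f x * g x := by
  have := length (flatMap (f := fun x _ => List.replicate (g x) ()) (replicate_unit hf)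
    (by fun_prop))
  simpa using this

@[fun_prop]
theorem range {f : α → ℕ} (hf : PT f) : PT fun x => List.range (f x) := by
  have key : ∀ (l : List Unit), l.foldl (fun z (_ : Unit) => z.length :: z) [] =
      (List.range l.length).reverse := by
    intro l
    induction l using List.reverseRecOn with
    | nil => rfl
    | append_singleton l e ih => simp [ih, List.range_succ]
  have := foldl_of_bound (step := fun (x : α) z (_ : Unit) => z.length :: z) (replicate_unit hf)
    (const []) (by fun_prop)
  obtain ⟨q, hq⟩ := hf.1
  have := this (q * (2 * q + 1 + 1) + 1) (fun x l' hl' => by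
    rw [key, tsize_reverse]
    have h1 : l'.length ≤ q.eval (tsize x) := by
      have h2 := hl'.length_le
      have h3 := hq x
      rw [tsize_nat] at h3
      simp at h2
      omega
    refine (tsize_le_length_mul (n := 2 * l'.length + 1) fun k hk => ?_).trans ?_
    · rw [tsize_nat]
      have := List.mem_range.1 hk
      omega
    · simp only [List.length_range, eval_add, eval_mul, eval_one, eval_ofNat]
      gcongr)
  have := reverse this
  simp only [key] at this
  simpa using this

end PT

/-! ### Symbols of finite alphabets -/

/-- An alphabet whose symbols are numbered, and represented by their numbers in unary. -/
class Numbered (A : Type) where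
  symbols : List A
  idx : A → ℕ
  get_idx : ∀ s, symbols[idx s]? = some s

instance {A : Type} [Numbered A] : Coded A := ⟨fun s => natTree (Numbered.idx s)⟩

instance : Numbered Γ' where
  symbols := [.blank, .bit false, .bit true, .bra, .ket, .comma]
  idx
    | .blank => 0
    | .bit x => 1 + x.toNat
    | .bra => 3
    | .ket => 4
    | .comma => 5
  get_idx s := by rcases s with _ | (_ | _) | _ | _ | _ <;> rfl

instance : Numbered (Γ' ⊕ Bool) where
  symbols := [.inl .blank, .inl (.bit false), .inl (.bit true), .inl .bra, .inl .ket, .inl .comma,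
    .inr false, .inr true]
  idx
    | .inl s => Numbered.idx s
    | .inr x => 6 + x.toNat
  get_idx s := by rcases s with (_ | (_ | _) | _ | _ | _) | (_ | _) <;> rfl

/-- The numbering of the truth values that underlies their representation as trees. -/
@[reducible] def numberedBool : Numbered Bool where
  symbols := [false, true]
  idx := Bool.toNat
  get_idx s := by cases s <;> rfl

theorem Numbered.mem_symbols {A : Type} [Numbered A] (s : A) : s ∈ Numbered.symbols (A := A) :=
  List.mem_of_getElem? (Numbered.get_idx s)

namespace PT

variable {A α β : Type} [Coded α] [Coded β]

/-- Case distinction over a finite alphabet. -/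
theorem symbolCase [Numbered A] {f : A → α → β} (hf : ∀ s, PT (f s)) {s : α → A} (hs : PT s) :
    PT fun x => f (s x) x := by
  have key : ∀ (s₀ : A) (l : List A), PT fun y : α × ℕ => f (l.getD y.2 s₀) y.1 := by
    intro s₀ l
    induction l with
    | nil =>
      simp only [List.getD_nil]
      exact comp (hf s₀) (by fun_prop)
    | cons s l ih =>
      have := natCase (n := fun y : α × ℕ => y.2) (f := fun y => f s y.1)
        (g := fun y m => f (l.getD m s₀) y.1) (by fun_prop) (comp (hf s) (by fun_prop))
        (comp (f := fun y : (α × ℕ) × ℕ => (y.1.1, y.2)) ih (by fun_prop))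
      refine (congrArg PT (funext fun x => ?_)).mp this
      rcases x with ⟨x, _ | m⟩ <;> simp
  have hn : PT fun x => Numbered.idx (s x) := comp (of_tree_eq fun _ => rfl) hs
  cases h : Numbered.symbols (A := A) with
  | nil =>
    have e : ∀ s : A, False := fun s => by simpa [h] using Numbered.get_idx s
    exact of_tree_eq fun x => (e (s x)).elim
  | cons s₀ l =>
    have := comp (f := fun x => (x, Numbered.idx (s x))) (key s₀ (Numbered.symbols (A := A)))
      (pair id hn)
    refine (congrArg PT (funext fun x => ?_)).mp this
    simp [List.getD_eq_getElem?_getD, Numbered.get_idx]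

end PT

/-! ### Reading the input and writing the output -/

namespace Prog

variable {A B : Type}

open Classical in
/-- If the top of the input stack is a symbol in `l`, then move it to the list on the stack `a`. -/
noncomputable def readSymbol [Numbered A] (B : Type) : List A → Prog (Alph A B)
  | [] => skip
  | s :: l => .ifte .inp (fun x : Option A => decide (x = some s))
      ((pop .inp).seq ((pushAll A B (tree s).code).seq (push .a true))) (readSymbol B l)

theorem runs_readSymbol [Numbered A] {i : List A} {o : List B} {a b t c : List Bool} {s : A} :
    ∀ {l : List A}, s ∈ l → Runs (readSymbol B l) (stks (s :: i) o a b t c)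
      (stks i o (true :: ((tree s).code ++ a)) b t c) (tsize s + 3 + l.length)
  | [], h => by simp at h
  | s' :: l, h => by
    by_cases e : s = s'
    · subst e
      refine (Runs.ifTrue (by simp [stks]) (pop_inp.seq
        ((runs_pushAll _).seq (push_a true)))).weaken ?_
      simp only [code_length, List.length_cons]; omega
    · refine (Runs.ifFalse (by simp [stks, e])
        (runs_readSymbol ((List.mem_cons.1 h).resolve_left e))).weaken ?_
      simp only [List.length_cons]; omega

/-- Move the input, reversed, to the stack `a`, as a list. -/
noncomputable def readInput [Numbered A] (B : Type) : Prog (Alph A B) :=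
  (push .a false).seq (.loop .inp (fun x : Option A => x.isSome) (readSymbol B Numbered.symbols))

theorem exists_tsize_le (A : Type) [Numbered A] : ∃ n, ∀ s : A, tsize s ≤ n := by
  refine ⟨((Numbered.symbols (A := A)).map tsize).sum, fun s => ?_⟩
  exact List.single_le_sum (by simp) _ (List.mem_map_of_mem (Numbered.mem_symbols s))

theorem runs_readInput [Numbered A] {N : ℕ} (hN : ∀ s : A, tsize s ≤ N) (i : List A) :
    Runs (readInput (A := A) B) (stks i [] [] [] [] [])
      (stks [] [] (tree i.reverse).code [] [] [])
      (i.length * (N + 4 + (Numbered.symbols (A := A)).length) + 2) := by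
  have key : ∀ (i r : List A),
      Runs (.loop .inp (fun x : Option A => x.isSome) (readSymbol B Numbered.symbols))
        (stks i [] (tree r).code [] [] []) (stks [] [] (tree (i.reverse ++ r)).code [] [] [])
        (i.length * (N + 4 + (Numbered.symbols (A := A)).length) + 1) := by
    intro i
    induction i with
    | nil => intro r; exact (Runs.loopStop rfl).weaken (by omega)
    | cons s i ih =>
      intro r
      have h := ih (s :: r)
      rw [tree_cons] at h
      rw [List.reverse_cons, List.append_assoc, List.singleton_append]
      refine (Runs.loopStep rfl (runs_readSymbol (Numbered.mem_symbols s)) h).weaken ?_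
      have := hN s
      simp only [List.length_cons, add_mul, one_mul]; omega
  have := (push_a (A := A) (B := B) (i := i) (o := []) (a := []) (b := []) (t := []) (c := []) false).seq
    (key i [])
  rw [List.append_nil] at this
  exact this.weaken (by omega)

/-- Remove a unary number from the stack `a`, and write the symbol with this number in `l`. -/
def writeSymbol (A : Type) {B : Type} : List B → Prog (Alph A B)
  | [] => skip
  | s :: l => .ifte .a (fun x : Option Bool => x == some true)
      ((pop .a).seq ((pop .a).seq (writeSymbol A l))) ((pop .a).seq (push .out s))

theorem runs_writeSymbol {i : List A} {o : List B} {a b t c : List Bool} {s : B} :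
    ∀ {l : List B} {n : ℕ}, l[n]? = some s → Runs (writeSymbol A l)
      (stks i o ((natTree n).code ++ a) b t c) (stks i (s :: o) a b t c) (3 * (n + 1))
  | [], n, h => by simp at h
  | s' :: l, 0, h => by
    obtain rfl : s' = s := by simpa using h
    exact Runs.ifFalse rfl (pop_a.seq (push_out _))
  | s' :: l, n + 1, h => by
    refine (Runs.ifTrue rfl (pop_a.seq (pop_a.seq (runs_writeSymbol (n := n) ?_)))).weaken
      (by omega)
    simpa using h

/-- Write the list of numbered symbols on the stack `a` to the output stack, reversed. -/
def writeOutput (A : Type) {B : Type} (l : List B) : Prog (Alph A B) :=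
  (loop .a (fun x : Option Bool => x == some true) ((pop .a).seq (writeSymbol A l))).seq (pop .a)

theorem runs_writeOutput [Numbered B] (w : List B) :
    Runs (writeOutput A Numbered.symbols) (stks [] [] (tree w).code [] [] [])
      (stks [] w.reverse [] [] [] []) (10 * tsize w + 2) := by
  have key : ∀ w o : List B,
      Runs (.loop .a (fun x : Option Bool => x == some true)
        ((pop .a).seq (writeSymbol A Numbered.symbols))) (stks [] o (tree w).code [] [] [])
        (stks [] (w.reverse ++ o) [false] [] [] []) (10 * tsize w + 1) := by
    intro w
    induction w with
    | nil => intro o; exact (Runs.loopStop rfl).weaken (by omega)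
    | cons s w ih =>
      intro o
      have h := ih (s :: o)
      rw [List.reverse_cons, List.append_assoc, List.singleton_append]
      have e : (tree (s :: w)).code = true :: ((tree s).code ++ (tree w).code) := by
        simp [tree_cons, BTree.code]
      rw [e]
      refine (Runs.loopStep rfl (pop_a.seq (runs_writeSymbol (Numbered.get_idx s))) h).weaken ?_
      have h1 : tsize s = 2 * Numbered.idx s + 1 := tsize_nat _
      rw [tsize_cons]; omega
  have := (key w []).seq pop_a
  rw [List.append_nil] at this
  exact this.weaken (by omega)

end Prog

open Polynomial in
/-- A string function in the calculus is computed by a Turing machine in polynomial time. -/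
theorem PT.polyTime {A B : Type} [Numbered A] [Numbered B] {F : List A → List B} (hF : PT F)
    {α β : Type} {ea : α → List A} {eb : β → List B} {f : α → β} (h : ∀ x, eb (f x) = F (ea x)) :
    PolyTime ea eb f := by
  classical
  let : Fintype A := Fintype.ofList Numbered.symbols Numbered.mem_symbols
  obtain ⟨N, hN⟩ := Prog.exists_tsize_le A
  have hF' : PT fun w : List A => (F w.reverse).reverse := PT.reverse (hF.comp (PT.reverse PT.id))
  obtain ⟨⟨sF, hsF⟩, hF'⟩ := hF'
  obtain ⟨p, q, hp⟩ := hF' A B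
  let r : Polynomial ℕ := X * C (N + 1) + 1
  refine Prog.polyTime (Γ := Alph A B)
    ((Prog.readInput B).seq (p.seq (Prog.writeOutput A Numbered.symbols))) .inp .out ea eb f
    (X * C (N + 4 + (Numbered.symbols (A := A)).length) + 2 + (q.comp r + (10 * sF.comp r + 2)))
    fun x => ?_
  have e1 : Function.update (β := fun k => List (Alph A B k)) (fun _ => []) Stk.inp (ea x) =
      stks (ea x) [] [] [] [] [] := by
    funext k; cases k <;> rfl
  have e2 : Function.update (β := fun k => List (Alph A B k)) (fun _ => []) Stk.out (eb (f x)) =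
      stks [] (eb (f x)) [] [] [] [] := by
    funext k; cases k <;> rfl
  rw [e1, e2, h]
  have h1 := Prog.runs_readInput (B := B) hN (ea x)
  have h2 := hp (ea x).reverse [] [] [] []
  have h3 := Prog.runs_writeOutput (A := A) (F (ea x)).reverse
  simp only [List.append_nil, List.reverse_reverse] at h2 h3
  refine (h1.seq (h2.seq h3)).weaken ?_
  have hr : tsize (ea x).reverse ≤ r.eval (ea x).length := by
    refine (tsize_le_length_mul fun s _ => hN s).trans ?_
    simp [r]
  have h4 := hsF (ea x).reverse
  simp only [List.reverse_reverse] at h4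
  simp only [eval_add, eval_mul, eval_X, eval_C, eval_comp, eval_ofNat]
  gcongr
  · exact polyEval_mono _ hr
  · exact h4.trans (polyEval_mono _ hr)

/-! ### Composition of polynomial-time Turing machines -/

theorem iterate_flip_bind_none {C : Type} (f : C → Option C) (m : ℕ) :
    (flip bind f)^[m] none = none :=
  Function.iterate_fixed rfl m

theorem Reach.lift {C D : Type} {f : C → Option C} {f' : D → Option D} (g : C → D)
    (h : ∀ a a', f a = some a' → f' (g a) = some (g a')) {n : ℕ} {a b : C} (hr : Reach f n a b) :
    Reach f' n (g a) (g b) := by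
  obtain ⟨m, hm, hr⟩ := hr
  refine ⟨m, hm, ?_⟩
  clear hm
  induction m generalizing a with
  | zero => simpa using congrArg (Option.map g) hr
  | succ m ih =>
    rw [Function.iterate_succ_apply] at hr ⊢
    cases ha : f a with
    | none =>
      have h1 : flip bind f (some a) = none := ha
      rw [h1, iterate_flip_bind_none] at hr
      cases hr
    | some a' =>
      have h1 : flip bind f (some a) = some a' := ha
      have h2 : flip bind f' (some (g a)) = some (g a') := h _ _ ha
      rw [h1] at hr
      rw [h2]
      exact ih hr

/-- A quantity that grows by at most `N` in each step grows by at most `n * N` in `n` steps. -/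
theorem Reach.le_add_mul {C : Type} {f : C → Option C} (μ : C → ℕ) (N : ℕ)
    (h : ∀ a a', f a = some a' → μ a' ≤ μ a + N) {n : ℕ} {a b : C} (hr : Reach f n a b) :
    μ b ≤ μ a + n * N := by
  obtain ⟨m, hm, hr⟩ := hr
  refine le_trans ?_ (Nat.add_le_add_left (Nat.mul_le_mul_right N hm) _)
  clear hm
  induction m generalizing a with
  | zero =>
    obtain rfl : a = b := by simpa using hr
    omega
  | succ m ih =>
    rw [Function.iterate_succ_apply] at hr
    cases ha : f a with
    | none =>
      have h1 : flip bind f (some a) = none := ha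
      rw [h1, iterate_flip_bind_none] at hr
      cases hr
    | some a' =>
      have h1 : flip bind f (some a) = some a' := ha
      rw [h1] at hr
      have := ih hr
      have := h _ _ ha
      rw [add_mul, one_mul]
      omega

namespace Turing.TM2

/-- The number of push operations in a statement. -/
def pushes {K : Type} {Γ : K → Type} {Λ σ : Type} : Stmt Γ Λ σ → ℕ
  | .push _ _ q => pushes q + 1
  | .peek _ _ q => pushes q
  | .pop _ _ q => pushes q
  | .load _ q => pushes q
  | .branch _ q q' => pushes q + pushes q'
  | .goto _ => 0
  | .halt => 0

theorem length_stepAux_le {K : Type} [DecidableEq K] {Γ : K → Type} {Λ σ : Type} (k : K)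
    (q : Stmt Γ Λ σ) : ∀ v S, ((stepAux q v S).stk k).length ≤ (S k).length + pushes q := by
  induction q with
  | push k' f q ih =>
    intro v S
    refine (ih _ _).trans ?_
    by_cases h : k = k'
    · subst h; simp only [pushes, Function.update_self, List.length_cons]; omega
    · simp only [pushes, ne_eq, h, not_false_eq_true, Function.update_of_ne]; omega
  | peek k' f q ih => intro v S; exact ih _ _
  | pop k' f q ih =>
    intro v S
    refine (ih _ _).trans ?_
    by_cases h : k = k'
    · subst h; simp [pushes]
    · simp [pushes, h]
  | load f q ih => intro v S; exact ih _ _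
  | branch f q q' ih ih' =>
    intro v S
    simp only [stepAux, pushes]
    have h1 := ih v S
    have h2 := ih' v S
    cases f v <;> simp only [cond_true, cond_false] <;> omega
  | goto f => intro v S; simp [pushes]
  | halt => intro v S; simp [pushes]

end Turing.TM2

namespace Turing.FinTM2

theorem exists_growth (tm : FinTM2) : ∃ N, ∀ k (a a' : tm.Cfg), tm.step a = some a' →
    (a'.stk k).length ≤ (a.stk k).length + N := by
  let := tm.ΛFin
  refine ⟨∑ l, TM2.pushes (tm.m l), fun k a a' h => ?_⟩
  rcases a with ⟨_ | l, v, S⟩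
  · simp [TM2.step] at h
  · obtain rfl : TM2.stepAux (tm.m l) v S = a' := Option.some.inj h
    refine (TM2.length_stepAux_le k _ v S).trans ?_
    gcongr
    exact Finset.single_le_sum (f := fun l => TM2.pushes (tm.m l)) (fun _ _ => Nat.zero_le _)
      (Finset.mem_univ l)

section comp

variable (M N : FinTM2)

/-- The stack alphabets of the composite machine: those of the two machines and of a stack that is
used for reversing the intermediate result. -/
@[reducible] def compΓ : M.K ⊕ (N.K ⊕ Unit) → Type
  | .inl k => M.Γ k
  | .inr (.inl k) => N.Γ k
  | .inr (.inr _) => M.Γ M.k₁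

/-- Labels of the composite machine. The two additional labels belong to the two copying loops. -/
abbrev CompΛ : Type := M.Λ ⊕ (N.Λ ⊕ Bool)

/-- The internal memory of the composite machine: those of both machines, and a register for the
symbol being copied. -/
abbrev CompVar : Type := M.σ × N.σ × Option (M.Γ M.k₁)

variable {M N}

/-- The stacks of the composite machine with given contents. -/
def compStk (S : ∀ k, List (M.Γ k)) (S' : ∀ k, List (N.Γ k)) (t : List (M.Γ M.k₁)) :
    ∀ k, List (compΓ M N k)
  | .inl k => S k
  | .inr (.inl k) => S' k
  | .inr (.inr _) => t

theorem update_compStk_left (S : ∀ k, List (M.Γ k)) (S' : ∀ k, List (N.Γ k)) (t) (k : M.K)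
    (l : List (M.Γ k)) : Function.update (compStk S S' t) (.inl k) l =
      compStk (Function.update S k l) S' t := by
  funext k'
  rcases k' with k' | k' | k'
  · by_cases h : k' = k
    · subst h; simp [compStk]
    · simp [compStk, h]
  · simp [compStk]
  · simp [compStk]

theorem update_compStk_mid (S : ∀ k, List (M.Γ k)) (S' : ∀ k, List (N.Γ k)) (t) (k : N.K)
    (l : List (N.Γ k)) : Function.update (compStk S S' t) (.inr (.inl k)) l =
      compStk S (Function.update S' k l) t := by
  funext k'
  rcases k' with k' | k' | k'
  · simp [compStk]
  · by_cases h : k' = k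
    · subst h; simp [compStk]
    · simp [compStk, h]
  · simp [compStk]

theorem update_compStk_right (S : ∀ k, List (M.Γ k)) (S' : ∀ k, List (N.Γ k)) (t u) (x : Unit) :
    Function.update (compStk S S' t) (.inr (.inr x)) u = compStk S S' u := by
  funext k'
  rcases k' with k' | k' | k' <;> simp [compStk]

theorem compStk_nil : compStk (M := M) (N := N) (fun _ => []) (fun _ => []) [] = fun _ => [] := by
  funext k
  rcases k with k | k | k <;> rfl

/-- The statements of the first machine. Halting is replaced by a jump to the first copying loop. -/
def trLeft : TM2.Stmt M.Γ M.Λ M.σ → TM2.Stmt (compΓ M N) (CompΛ M N) (CompVar M N)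
  | .push k f q => .push (.inl k) (fun v => f v.1) (trLeft q)
  | .peek k f q => .peek (.inl k) (fun v x => (f v.1 x, v.2)) (trLeft q)
  | .pop k f q => .pop (.inl k) (fun v x => (f v.1 x, v.2)) (trLeft q)
  | .load f q => .load (fun v => (f v.1, v.2)) (trLeft q)
  | .branch f q q' => .branch (fun v => f v.1) (trLeft q) (trLeft q')
  | .goto f => .goto fun v => .inl (f v.1)
  | .halt => .goto fun _ => .inr (.inr false)

/-- The statements of the second machine. -/
def trRight : TM2.Stmt N.Γ N.Λ N.σ → TM2.Stmt (compΓ M N) (CompΛ M N) (CompVar M N)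
  | .push k f q => .push (.inr (.inl k)) (fun v => f v.2.1) (trRight q)
  | .peek k f q => .peek (.inr (.inl k)) (fun v x => (v.1, f v.2.1 x, v.2.2)) (trRight q)
  | .pop k f q => .pop (.inr (.inl k)) (fun v x => (v.1, f v.2.1 x, v.2.2)) (trRight q)
  | .load f q => .load (fun v => (v.1, f v.2.1, v.2.2)) (trRight q)
  | .branch f q q' => .branch (fun v => f v.2.1) (trRight q) (trRight q')
  | .goto f => .goto fun v => .inr (.inl (f v.2.1))
  | .halt => .halt

/-- A configuration of the first machine as a configuration of the composite machine. -/
def liftLeft (w : N.σ × Option (M.Γ M.k₁)) (c : TM2.Cfg M.Γ M.Λ M.σ) :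
    TM2.Cfg (compΓ M N) (CompΛ M N) (CompVar M N) :=
  ⟨some (match c.l with
    | some l => .inl l
    | none => .inr (.inr false)), (c.var, w), compStk c.stk (fun _ => []) []⟩

/-- A configuration of the second machine as a configuration of the composite machine. -/
def liftRight (v : M.σ) (w : Option (M.Γ M.k₁)) (c : TM2.Cfg N.Γ N.Λ N.σ) :
    TM2.Cfg (compΓ M N) (CompΛ M N) (CompVar M N) :=
  ⟨c.l.map fun l => .inr (.inl l), (v, c.var, w), compStk (fun _ => []) c.stk []⟩

theorem stepAux_trLeft (w : N.σ × Option (M.Γ M.k₁)) (q : TM2.Stmt M.Γ M.Λ M.σ) : ∀ v S,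
    TM2.stepAux (trLeft (N := N) q) (v, w) (compStk S (fun _ => []) []) =
      liftLeft w (TM2.stepAux q v S) := by
  induction q with
  | push k f q ih =>
    intro v S
    simp only [trLeft, TM2.stepAux]
    rw [← ih, ← update_compStk_left]; rfl
  | peek k f q ih => intro v S; exact ih _ _
  | pop k f q ih =>
    intro v S
    simp only [trLeft, TM2.stepAux]
    rw [← ih, ← update_compStk_left]; rfl
  | load f q ih => intro v S; exact ih _ _
  | branch f q q' ih ih' =>
    intro v S
    simp only [trLeft, TM2.stepAux]
    cases f v <;> simp only [cond_true, cond_false, ih, ih']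
  | goto f => intro v S; rfl
  | halt => intro v S; rfl

theorem stepAux_trRight (v : M.σ) (w : Option (M.Γ M.k₁)) (q : TM2.Stmt N.Γ N.Λ N.σ) : ∀ u S,
    TM2.stepAux (trRight (M := M) q) (v, u, w) (compStk (fun _ => []) S []) =
      liftRight v w (TM2.stepAux q u S) := by
  induction q with
  | push k f q ih =>
    intro u S
    simp only [trRight, TM2.stepAux]
    rw [← ih, ← update_compStk_mid]; rfl
  | peek k f q ih => intro u S; exact ih _ _
  | pop k f q ih =>
    intro u S
    simp only [trRight, TM2.stepAux]
    rw [← ih, ← update_compStk_mid]; rfl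
  | load f q ih => intro u S; exact ih _ _
  | branch f q q' ih ih' =>
    intro u S
    simp only [trRight, TM2.stepAux]
    cases f u <;> simp only [cond_true, cond_false, ih, ih']
  | goto f => intro u S; rfl
  | halt => intro u S; rfl

/-- The program of the composite machine. -/
def compProg (e : M.Γ M.k₁ → N.Γ N.k₀) (d : M.Γ M.k₁) :
    CompΛ M N → TM2.Stmt (compΓ M N) (CompΛ M N) (CompVar M N)
  | .inl l => trLeft (M.m l)
  | .inr (.inl l) => trRight (N.m l)
  | .inr (.inr false) => .pop (.inl M.k₁) (fun v x => (v.1, v.2.1, x))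
      (.branch (fun v => v.2.2.isSome)
        (.push (.inr (.inr ())) (fun v => v.2.2.getD d) (.goto fun _ => .inr (.inr false)))
        (.goto fun _ => .inr (.inr true)))
  | .inr (.inr true) => .pop (.inr (.inr ())) (fun v x => (v.1, v.2.1, x))
      (.branch (fun v => v.2.2.isSome)
        (.push (.inr (.inl N.k₀)) (fun v => e (v.2.2.getD d)) (.goto fun _ => .inr (.inr true)))
        (.goto fun _ => .inr (.inl N.main)))

theorem reach_copy_left (e : M.Γ M.k₁ → N.Γ N.k₀) (d : M.Γ M.k₁) (v : M.σ) (u : N.σ) :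
    ∀ (s t : List (M.Γ M.k₁)) (w : Option (M.Γ M.k₁)),
    Reach (TM2.step (compProg e d)) (s.length + 1)
      ⟨some (.inr (.inr false)), (v, u, w),
        compStk (Function.update (fun _ => []) M.k₁ s) (fun _ => []) t⟩
      ⟨some (.inr (.inr true)), (v, u, none),
        compStk (fun _ => []) (fun _ => []) (s.reverse ++ t)⟩
  | [], t, w => by
    refine .single ?_
    simp only [TM2.step, compProg, TM2.stepAux, update_compStk_left]
    simp [compStk]
  | x :: s, t, w => by
    refine .head ?_ (by
      have := reach_copy_left e d v u s (x :: t) (some x)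
      rw [List.reverse_cons, List.append_assoc]
      exact this)
    simp only [TM2.step, compProg, TM2.stepAux, update_compStk_left, update_compStk_right]
    simp [compStk]

theorem reach_copy_right (e : M.Γ M.k₁ → N.Γ N.k₀) (d : M.Γ M.k₁) (v : M.σ) (u : N.σ) :
    ∀ (t : List (M.Γ M.k₁)) (s : List (N.Γ N.k₀)) (w : Option (M.Γ M.k₁)),
    Reach (TM2.step (compProg e d)) (t.length + 1)
      ⟨some (.inr (.inr true)), (v, u, w),
        compStk (fun _ => []) (Function.update (fun _ => []) N.k₀ s) t⟩
      ⟨some (.inr (.inl N.main)), (v, u, none),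
        compStk (fun _ => []) (Function.update (fun _ => []) N.k₀ (t.reverse.map e ++ s)) []⟩
  | [], s, w => by
    refine .single ?_
    simp only [TM2.step, compProg, TM2.stepAux, update_compStk_right]
    simp [compStk]
  | x :: t, s, w => by
    refine .head ?_ (by
      have := reach_copy_right e d v u t (e x :: s) (some x)
      rw [List.reverse_cons, List.map_append, List.append_assoc]
      exact this)
    simp only [TM2.step, compProg, TM2.stepAux, update_compStk_right, update_compStk_mid]
    simp [compStk]

variable (M N) in
/-- The composite machine: it runs `M`, copies the output of `M` to the input stack of `N`, and runs
`N`. -/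
noncomputable def comp (e : M.Γ M.k₁ → N.Γ N.k₀) (d : M.Γ M.k₁) [Fintype (M.Γ M.k₁)] : FinTM2 :=
  letI := M.kFin
  letI := N.kFin
  letI := M.ΛFin
  letI := N.ΛFin
  letI := M.σFin
  letI := N.σFin
  letI := M.Γk₀Fin
  { K := M.K ⊕ (N.K ⊕ Unit)
    k₀ := .inl M.k₀
    k₁ := .inr (.inl N.k₁)
    Γ := compΓ M N
    Λ := CompΛ M N
    main := .inl M.main
    σ := CompVar M N
    initialState := (M.initialState, N.initialState, none)
    Γk₀Fin := M.Γk₀Fin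
    m := compProg e d }

theorem initList_comp (e : M.Γ M.k₁ → N.Γ N.k₀) (d : M.Γ M.k₁) [Fintype (M.Γ M.k₁)]
    (s : List (M.Γ M.k₀)) :
    initList (M.comp N e d) s = liftLeft (N.initialState, none) (initList M s) := by
  refine (initList_eq (M.comp N e d) s).trans ?_
  rw [initList_eq]
  simp only [liftLeft, ← update_compStk_left, compStk_nil]
  rfl

theorem haltList_comp (e : M.Γ M.k₁ → N.Γ N.k₀) (d : M.Γ M.k₁) [Fintype (M.Γ M.k₁)]
    (s : List (N.Γ N.k₁)) :
    haltList (M.comp N e d) s = liftRight M.initialState none (haltList N s) := by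
  refine (haltList_eq (M.comp N e d) s).trans ?_
  rw [haltList_eq]
  simp only [liftRight, ← update_compStk_mid, compStk_nil]
  rfl

end comp

end Turing.FinTM2

open Polynomial in
/-- Polynomial-time functions are closed under composition. -/
theorem PolyTime.comp {α β γ A B C : Type} [Finite B] [Inhabited B] {ea : α → List A}
    {eb : β → List B} {ec : γ → List C} {f : α → β} {g : β → γ} (hg : PolyTime eb ec g)
    (hf : PolyTime ea eb f) : PolyTime ea ec (fun x => g (f x)) := by
  rw [polyTime_iff] at *
  obtain ⟨M, iM, oM, p, hM⟩ := hf
  obtain ⟨N, iN, oN, q, hN⟩ := hg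
  have : Finite (M.Γ M.k₁) := .of_equiv _ oM.symm
  let : Fintype (M.Γ M.k₁) := .ofFinite _
  obtain ⟨G, hG⟩ := M.exists_growth
  let r : Polynomial ℕ := X + p * Polynomial.C G
  refine ⟨M.comp N (fun s => iN.symm (oM s)) (oM.symm default), iM, oN,
    p + (r + 1 + (r + 1 + q.comp r)), fun x => ?_⟩
  have hlen : (eb (f x)).length ≤ r.eval (ea x).length := by
    have h1 := Reach.le_add_mul (fun c : M.Cfg => (c.stk M.k₁).length) G (hG M.k₁) (hM x)
    rw [initList_eq, haltList_eq] at h1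
    simp only [Function.update_self, List.length_map] at h1
    refine h1.trans ?_
    simp only [r, eval_add, eval_mul, eval_X, eval_C]
    gcongr
    by_cases h : M.k₁ = M.k₀
    · rw [h]; simp
    · simp [h]
  have h1 := (hM x).lift (f' := Turing.TM2.step (Turing.FinTM2.compProg (fun s => iN.symm (oM s)) (oM.symm default)))
    (Turing.FinTM2.liftLeft (N.initialState, none)) (by
      rintro ⟨_ | l, v, S⟩ c' h
      · simp [Turing.TM2.step] at h
      · obtain rfl : Turing.TM2.stepAux (M.m l) v S = c' := Option.some.inj h
        exact congrArg some (Turing.FinTM2.stepAux_trLeft _ _ _ _))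
  have h4 := (hN (f x)).lift (f' := Turing.TM2.step (Turing.FinTM2.compProg (fun s => iN.symm (oM s)) (oM.symm default)))
    (Turing.FinTM2.liftRight M.initialState none) (by
      rintro ⟨_ | l, v, S⟩ c' h
      · simp [Turing.TM2.step] at h
      · obtain rfl : Turing.TM2.stepAux (N.m l) v S = c' := Option.some.inj h
        exact congrArg some (Turing.FinTM2.stepAux_trRight _ _ _ _ _))
  have h2 := Turing.FinTM2.reach_copy_left (N := N) (fun s => iN.symm (oM s)) (oM.symm default)
    M.initialState N.initialState ((eb (f x)).map oM.symm) [] none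
  have h3 := Turing.FinTM2.reach_copy_right (M := M) (N := N) (fun s => iN.symm (oM s))
    (oM.symm default) M.initialState N.initialState ((eb (f x)).map oM.symm).reverse [] none
  have e2 : Turing.FinTM2.liftLeft (N.initialState, none)
      (Turing.haltList M ((eb (f x)).map oM.symm)) =
      ⟨some (.inr (.inr false)), (M.initialState, N.initialState, none), Turing.FinTM2.compStk
        (Function.update (fun _ => []) M.k₁ ((eb (f x)).map oM.symm)) (fun _ => []) []⟩ := by
    rw [haltList_eq]; rfl
  have e3 : Turing.FinTM2.liftRight M.initialState none
      (Turing.initList N ((eb (f x)).map iN.symm)) =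
      ⟨some (.inr (.inl N.main)), (M.initialState, N.initialState, none), Turing.FinTM2.compStk
        (fun _ => []) (Function.update (fun _ => []) N.k₀ ((eb (f x)).map iN.symm)) []⟩ := by
    rw [initList_eq]; rfl
  have e4 : Function.update (fun _ => []) N.k₀ ([] : List (N.Γ N.k₀)) = fun _ => [] :=
    Function.update_eq_self _ _
  rw [e2] at h1
  rw [e3] at h4
  rw [List.append_nil] at h2
  simp only [e4, List.reverse_reverse, List.map_map, List.append_nil, List.length_reverse,
    List.length_map] at h2 h3
  have e5 : (fun s => iN.symm (oM s)) ∘ oM.symm = iN.symm := by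
    funext s; simp
  rw [e5] at h3
  have := (h1.trans (h2.trans (h3.trans h4))).mono
    (n := (p + (r + 1 + (r + 1 + q.comp r))).eval (ea x).length) (by
      simp only [eval_add, eval_one, eval_comp]
      gcongr
      exact polyEval_mono _ hlen)
  rw [← Turing.FinTM2.initList_comp, ← Turing.FinTM2.haltList_comp] at this
  exact this

/-! ### Binary arithmetic -/

/-- The number with the given binary digits, least significant digit first. -/
def bval : List Bool → ℕ
  | [] => 0
  | b :: l => b.toNat + 2 * bval l

theorem bval_encodeNat (n : ℕ) : bval (encodeNat n) = n := by
  have pos : ∀ m : PosNum, bval (encodePosNum m) = (m : ℕ) := by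
    intro m
    induction m with
    | one => rfl
    | bit0 m ih => simp [encodePosNum, bval, ih, PosNum.cast_bit0]; omega
    | bit1 m ih => simp [encodePosNum, bval, ih, PosNum.cast_bit1]; omega
  have num : ∀ m : Num, bval (encodeNum m) = (m : ℕ) := by
    intro m
    cases m with
    | zero => rfl
    | pos m => exact pos m
  rw [encodeNat, num, Num.to_of_nat]

/-- Addition with carry. The digits of the second number are read off as long as there are digits of
the first one. -/
def addCarry : Bool → List Bool → List Bool → List Bool
  | c, [], _ => [c]
  | c, x :: p, l => (x ^^ l.headD false ^^ c) ::
      addCarry (x && l.headD false || x && c || l.headD false && c) p l.tail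

/-- Pad `p` with zeros to at least the length of `l`. -/
def padZeros (p l : List Bool) : List Bool := p ++ (l.drop p.length).map fun _ => false

/-- Addition of binary numbers. -/
def binAdd (p l : List Bool) : List Bool := addCarry false (padZeros p l) l

/-- Multiplication of binary numbers by repeated shifting and adding. -/
def binMul : List Bool → List Bool → List Bool
  | [], _ => []
  | x :: p, l => binAdd (false :: binMul p l) (bif x then l else [])

/-- Comparison digit by digit. The truth value is the result for the digits read so far. -/
def leCarry : Bool → List Bool → List Bool → Bool
  | r, [], _ => r
  | r, x :: p, l => leCarry (bif x ^^ l.headD false then l.headD false else r) p l.tail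

/-- The order relation between binary numbers. -/
def binLe (p l : List Bool) : Bool := leCarry true (padZeros p l) l

theorem length_padZeros (p l : List Bool) : (padZeros p l).length = max p.length l.length := by
  simp [padZeros]; omega

theorem bval_padZeros (p l : List Bool) : bval (padZeros p l) = bval p := by
  have h0 : ∀ l : List Bool, bval (l.map fun _ => false) = 0 := by
    intro l
    induction l with
    | nil => rfl
    | cons x l ih => simp only [List.map_cons, bval, ih]; rfl
  have h1 : ∀ p l : List Bool, bval (p ++ l.map fun _ => false) = bval p := by
    intro p l
    induction p with
    | nil => exact h0 l
    | cons x p ih => simp only [List.cons_append, bval, ih]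
  exact h1 _ _

theorem bval_eq_headD (l : List Bool) : bval l = (l.headD false).toNat + 2 * bval l.tail := by
  cases l <;> rfl

theorem length_addCarry (p : List Bool) : ∀ c l, (addCarry c p l).length = p.length + 1 := by
  induction p with
  | nil => intro c l; rfl
  | cons x p ih => intro c l; simp [addCarry, ih]

theorem bval_addCarry (p : List Bool) : ∀ c l, l.length ≤ p.length →
    bval (addCarry c p l) = bval p + bval l + c.toNat := by
  induction p with
  | nil =>
    intro c l h
    obtain rfl : l = [] := by simpa using h
    simp [addCarry, bval]
  | cons x p ih =>
    intro c l h
    have h1 := ih (x && l.headD false || x && c || l.headD false && c) l.tail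
      (by simp at h ⊢; omega)
    rw [bval_eq_headD l, addCarry, bval, bval, h1]
    cases x <;> cases l.headD false <;> cases c <;> simp <;> omega

theorem bval_binAdd (p l : List Bool) : bval (binAdd p l) = bval p + bval l := by
  rw [binAdd, bval_addCarry _ _ _ (by rw [length_padZeros]; omega), bval_padZeros]
  simp

theorem length_binAdd (p l : List Bool) : (binAdd p l).length = max p.length l.length + 1 := by
  rw [binAdd, length_addCarry, length_padZeros]

theorem bval_binMul (p l : List Bool) : bval (binMul p l) = bval p * bval l := by
  induction p with
  | nil => simp [binMul, bval]
  | cons x p ih =>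
    rw [binMul, bval_binAdd, bval, bval, ih]
    cases x <;> simp [bval] <;> ring

theorem length_binMul_le (p l : List Bool) : (binMul p l).length ≤ 2 * p.length + l.length := by
  induction p with
  | nil => simp [binMul]
  | cons x p ih =>
    rw [binMul, length_binAdd]
    cases x <;> simp <;> omega

theorem leCarry_iff (p : List Bool) : ∀ r l, l.length ≤ p.length →
    (leCarry r p l = true ↔ bval p < bval l ∨ bval p = bval l ∧ r = true) := by
  induction p with
  | nil =>
    intro r l h
    obtain rfl : l = [] := by simpa using h
    simp [leCarry, bval]
  | cons x p ih =>
    intro r l h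
    rw [leCarry, ih _ l.tail (by simp at h ⊢; omega), bval_eq_headD l, bval]
    cases x <;> cases l.headD false <;> cases r <;> simp <;> omega

theorem binLe_iff (p l : List Bool) : binLe p l = true ↔ bval p ≤ bval l := by
  rw [binLe, leCarry_iff _ _ _ (by rw [length_padZeros]; omega), bval_padZeros]
  simp only [and_true]; omega

theorem tsize_bits_le (l : List Bool) : tsize l ≤ 4 * l.length + 1 := by
  have := tsize_le_length_mul (l := l) (n := 3) fun x _ => tsize_bool_le x
  omega

namespace PT

variable {α : Type} [Coded α] {f g : α → List Bool}

@[fun_prop]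
theorem padZeros (hf : PT f) (hg : PT g) : PT fun x => padZeros (f x) (g x) := by
  unfold _root_.padZeros
  fun_prop

@[fun_prop]
theorem binAdd (hf : PT f) (hg : PT g) : PT fun x => binAdd (f x) (g x) := by
  have h := foldl (s := fun x => (false, g x, ([] : List Bool)))
    (step := fun (_ : α) (z : Bool × List Bool × List Bool) (x : Bool) =>
      ((x && z.2.1.headD false || x && z.1 || z.2.1.headD false && z.1), z.2.1.tail,
        (x ^^ z.2.1.headD false ^^ z.1) :: z.2.2))
    (padZeros hf hg) (by fun_prop) (by fun_prop) (fun _ => 7) (.const 7) (by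
      rintro x ⟨c, l, w⟩ e
      have h1 := tsize_bool_le (e && l.headD false || e && c || l.headD false && c)
      have h2 := tsize_bool_le (e ^^ l.headD false ^^ c)
      have h3 : tsize l.tail ≤ tsize l := by
        cases l with
        | nil => simp
        | cons x l => simp only [List.tail_cons, tsize_cons]; omega
      simp only [tsize_pair, tsize_cons]
      omega)
  have key : ∀ (p : List Bool) c l w, (fun z : Bool × List Bool × List Bool => (z.1 :: z.2.2).reverse)
      (p.foldl (fun (z : Bool × List Bool × List Bool) (x : Bool) =>
      ((x && z.2.1.headD false || x && z.1 || z.2.1.headD false && z.1), z.2.1.tail,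
        (x ^^ z.2.1.headD false ^^ z.1) :: z.2.2)) (c, l, w)) = w.reverse ++ addCarry c p l := by
    intro p
    induction p with
    | nil => intro c l w; simp [addCarry]
    | cons x p ih =>
      intro c l w
      rw [List.foldl_cons, ih, addCarry]
      simp
  have := comp (g := fun z : Bool × List Bool × List Bool => (z.1 :: z.2.2).reverse) (by fun_prop) h
  simp only [key] at this
  exact this

@[fun_prop]
theorem binLe (hf : PT f) (hg : PT g) : PT fun x => binLe (f x) (g x) := by
  have h := foldl (s := fun x => (true, g x))
    (step := fun (_ : α) (z : Bool × List Bool) (x : Bool) =>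
      (bif x ^^ z.2.headD false then z.2.headD false else z.1, z.2.tail))
    (padZeros hf hg) (by fun_prop) (by fun_prop) (fun _ => 3) (.const 3) (by
      rintro x ⟨c, l⟩ e
      have h1 := tsize_bool_le (bif e ^^ l.headD false then l.headD false else c)
      have h3 : tsize l.tail ≤ tsize l := by
        cases l with
        | nil => simp
        | cons x l => simp only [List.tail_cons, tsize_cons]; omega
      simp only [tsize_pair]
      omega)
  have key : ∀ (p : List Bool) c l, (p.foldl (fun (z : Bool × List Bool) (x : Bool) =>
      (bif x ^^ z.2.headD false then z.2.headD false else z.1, z.2.tail)) (c, l)).1 =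
        leCarry c p l := by
    intro p
    induction p with
    | nil => intro c l; rfl
    | cons x p ih =>
      intro c l
      rw [List.foldl_cons, ih, leCarry]
  have := comp (g := fun z : Bool × List Bool => z.1) (by fun_prop) h
  simp only [key] at this
  exact this

@[fun_prop]
theorem binMul (hf : PT f) (hg : PT g) : PT fun x => binMul (f x) (g x) := by
  have := foldl_of_growth (s := fun _ => ([] : List Bool))
    (step := fun (x : α) z e => _root_.binAdd (false :: z) (bif e then g x else []))
    (reverse hf) (const []) (by fun_prop) List.length (4 * Polynomial.X + 1)
    (fun z => by simpa using tsize_bits_le z) (.const 0) (fun y => (g y.1).length + 2)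
    ((PolyBdd.length (by fun_prop)).add (.const 2)) (fun x z e => by
      rw [length_binAdd]
      cases e <;> simp
      omega)
  refine (congrArg PT (funext fun x => ?_)).mp this
  rw [List.foldl_reverse]
  induction f x with
  | nil => rfl
  | cons e t ih => simp [ih, _root_.binMul]

end PT

/-! ### Nonnegative fractions -/

/-- Nonnegative fractions, not necessarily in lowest terms, with binary numerators and
denominators. -/
abbrev BinFrac : Type := List Bool × List Bool

namespace BinFrac

/-- The value of a fraction; meaningful only for a nonzero denominator. -/
def val (x : BinFrac) : ℚ := (bval x.1 : ℚ) / bval x.2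

/-- The product, without cancelling. -/
def mul (x y : BinFrac) : BinFrac := (binMul x.1 y.1, binMul x.2 y.2)

/-- The sum over the product of the denominators, without cancelling. -/
def add (x y : BinFrac) : BinFrac :=
  (binAdd (binMul y.2 x.1) (binMul y.1 x.2), binMul y.2 x.2)

/-- Comparison by cross-multiplication; meaningful only for nonzero denominators. -/
def le (x y : BinFrac) : Bool := binLe (binMul x.1 y.2) (binMul y.1 x.2)

/-- The sum of a list, starting from `0 / 1`. -/
def sum (l : List BinFrac) : BinFrac := l.foldl add ([], [true])

theorem val_mul (x y : BinFrac) : (x.mul y).val = x.val * y.val := by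
  simp only [val, mul, bval_binMul, Nat.cast_mul]
  rw [div_mul_div_comm]

theorem den_mul_ne_zero {x y : BinFrac} (hx : bval x.2 ≠ 0) (hy : bval y.2 ≠ 0) :
    bval (x.mul y).2 ≠ 0 := by
  simpa [mul, bval_binMul] using ⟨hx, hy⟩

theorem den_add_ne_zero {x y : BinFrac} (hx : bval x.2 ≠ 0) (hy : bval y.2 ≠ 0) :
    bval (x.add y).2 ≠ 0 := by
  simpa [add, bval_binMul] using ⟨hy, hx⟩

theorem val_add {x y : BinFrac} (hx : bval x.2 ≠ 0) (hy : bval y.2 ≠ 0) :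
    (x.add y).val = x.val + y.val := by
  have hx' : (bval x.2 : ℚ) ≠ 0 := by exact_mod_cast hx
  have hy' : (bval y.2 : ℚ) ≠ 0 := by exact_mod_cast hy
  simp only [val, add, bval_binMul, bval_binAdd, Nat.cast_mul, Nat.cast_add]
  field_simp

theorem le_iff {x y : BinFrac} (hx : bval x.2 ≠ 0) (hy : bval y.2 ≠ 0) :
    x.le y = true ↔ x.val ≤ y.val := by
  have hx' : (0 : ℚ) < bval x.2 := by exact_mod_cast Nat.pos_of_ne_zero hx
  have hy' : (0 : ℚ) < bval y.2 := by exact_mod_cast Nat.pos_of_ne_zero hy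
  rw [le, binLe_iff, bval_binMul, bval_binMul, val, val, div_le_div_iff₀ hx' hy']
  exact_mod_cast Iff.rfl

theorem sum_spec {l : List BinFrac} (h : ∀ x ∈ l, bval x.2 ≠ 0) :
    bval (sum l).2 ≠ 0 ∧ (sum l).val = (l.map val).sum := by
  have key : ∀ (l : List BinFrac) (s : BinFrac), (∀ x ∈ l, bval x.2 ≠ 0) → bval s.2 ≠ 0 →
      bval (l.foldl add s).2 ≠ 0 ∧ (l.foldl add s).val = s.val + (l.map val).sum := by
    intro l
    induction l with
    | nil => intro s _ hs; simpa using hs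
    | cons x l ih =>
      intro s h hs
      have hx := h x List.mem_cons_self
      obtain ⟨h1, h2⟩ := ih (s.add x) (fun y hy => h y (List.mem_cons_of_mem _ hy))
        (den_add_ne_zero hs hx)
      refine ⟨h1, ?_⟩
      rw [List.foldl_cons, h2, val_add hs hx, List.map_cons, List.sum_cons, add_assoc]
  have := key l ([], [true]) h (by decide)
  simpa [val, bval, sum] using this

end BinFrac

namespace PT

variable {α : Type} [Coded α] {f g : α → BinFrac}

@[fun_prop]
theorem fracMul (hf : PT f) (hg : PT g) : PT fun x => (f x).mul (g x) := by
  unfold BinFrac.mul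
  fun_prop

@[fun_prop]
theorem fracAdd (hf : PT f) (hg : PT g) : PT fun x => (f x).add (g x) := by
  unfold BinFrac.add
  fun_prop

@[fun_prop]
theorem fracLe (hf : PT f) (hg : PT g) : PT fun x => (f x).le (g x) := by
  unfold BinFrac.le
  fun_prop

@[fun_prop]
theorem fracSum {l : α → List BinFrac} (hl : PT l) : PT fun x => BinFrac.sum (l x) := by
  refine foldl_of_growth (s := fun _ => (([], [true]) : BinFrac))
    (step := fun (_ : α) z e => BinFrac.add z e) hl (const _) (by fun_prop)
    (fun z => max z.1.length z.2.length) (8 * Polynomial.X + 3) (fun z => ?_) (.const 1)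
    (fun y => 2 * y.2.1.length + 2 * y.2.2.length + 1)
    (((PolyBdd.const 2).mul (.length (by fun_prop))).add ((PolyBdd.const 2).mul
      (.length (by fun_prop))) |>.add (.const 1)) (fun x z e => ?_)
  · have h1 := tsize_bits_le z.1
    have h2 := tsize_bits_le z.2
    rw [tsize_eq]
    simp only [Polynomial.eval_add, Polynomial.eval_mul, Polynomial.eval_X, Polynomial.eval_ofNat]
    omega
  · have h1 := length_binMul_le e.2 z.1
    have h2 := length_binMul_le e.1 z.2
    have h3 := length_binMul_le e.2 z.2
    simp only [BinFrac.add, length_binAdd]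
    omega

end PT

/-! ### Binary representation of unary numbers -/

/-- The successor of a number in binary. -/
def binSucc : List Bool → List Bool
  | [] => [true]
  | false :: l => true :: l
  | true :: l => false :: binSucc l

theorem encodeNat_succ (n : ℕ) : encodeNat (n + 1) = binSucc (encodeNat n) := by
  have pos : ∀ m : PosNum, encodePosNum m.succ = binSucc (encodePosNum m) := by
    intro m
    induction m with
    | one => rfl
    | bit0 m ih => rfl
    | bit1 m ih => simp [PosNum.succ, encodePosNum, binSucc, ih]
  have num : ∀ m : Num, encodeNum m.succ = binSucc (encodeNum m) := by
    intro m
    cases m with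
    | zero => rfl
    | pos m => exact pos m
  have h : ((n + 1 : ℕ) : Num) = (n : Num).succ := by
    rw [Nat.cast_succ, Num.add_one]
  rw [encodeNat, encodeNat, ← num, ← h]

theorem length_binSucc_le (l : List Bool) : (binSucc l).length ≤ l.length + 1 := by
  induction l with
  | nil => simp [binSucc]
  | cons x l ih => cases x <;> simp [binSucc]; omega

theorem encodeNat_eq_foldl (n : ℕ) :
    encodeNat n = (List.replicate n ()).foldl (fun z _ => binSucc z) [] := by
  induction n with
  | zero => rfl
  | succ n ih => rw [encodeNat_succ, ih, List.replicate_succ', List.foldl_append]; rfl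

namespace PT

variable {α : Type} [Coded α]

@[fun_prop]
theorem binSucc {f : α → List Bool} (hf : PT f) : PT fun x => binSucc (f x) := by
  have h := foldl (s := fun _ => (true, ([] : List Bool)))
    (step := fun (_ : α) (z : Bool × List Bool) (x : Bool) => (z.1 && x, (x ^^ z.1) :: z.2))
    hf (by fun_prop) (by fun_prop) (fun _ => 7) (.const 7) (by
      rintro x ⟨c, l⟩ e
      have h1 := tsize_bool_le (c && e)
      have h2 := tsize_bool_le (e ^^ c)
      simp only [tsize_pair, tsize_cons]
      omega)
  have key0 : ∀ (p w : List Bool), p.foldl (fun (z : Bool × List Bool) (x : Bool) =>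
      (z.1 && x, (x ^^ z.1) :: z.2)) (false, w) = (false, p.reverse ++ w) := by
    intro p
    induction p with
    | nil => intro w; rfl
    | cons x p ih => intro w; rw [List.foldl_cons, Bool.false_and, ih]; simp
  have key : ∀ (p w : List Bool), (fun z : Bool × List Bool => (bif z.1 then true :: z.2 else z.2).reverse)
      (p.foldl (fun (z : Bool × List Bool) (x : Bool) => (z.1 && x, (x ^^ z.1) :: z.2)) (true, w)) =
      w.reverse ++ _root_.binSucc p := by
    intro p
    induction p with
    | nil => intro w; simp [_root_.binSucc]
    | cons x p ih =>
      intro w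
      cases x
      · rw [List.foldl_cons, Bool.true_and, key0]
        simp [_root_.binSucc]
      · rw [List.foldl_cons, Bool.true_and, ih]
        simp [_root_.binSucc]
  have := comp (g := fun z : Bool × List Bool => (bif z.1 then true :: z.2 else z.2).reverse)
    (by fun_prop) h
  simp only [key] at this
  exact this

@[fun_prop]
theorem encodeNat {f : α → ℕ} (hf : PT f) : PT fun x => encodeNat (f x) := by
  have := foldl_of_growth (s := fun _ => ([] : List Bool))
    (step := fun (_ : α) z (_ : Unit) => _root_.binSucc z) (replicate_unit hf) (const [])
    (by fun_prop) List.length (4 * Polynomial.X + 1) (fun z => by simpa using tsize_bits_le z)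
    (.const 0) (fun _ => 1) (.const 1) (fun x z e => length_binSucc_le z)
  simpa only [← encodeNat_eq_foldl] using this

end PT

/-! ### Splitting a string into tokens -/

/-- The maximal words of bits terminated by `Γ'.ket` or `Γ'.comma`, preceded by the bits `cur`. -/
def tokensAux : List Bool → List Γ' → List (List Bool)
  | _, [] => []
  | cur, .bit b :: w => tokensAux (cur ++ [b]) w
  | cur, .ket :: w => cur :: tokensAux [] w
  | cur, .comma :: w => cur :: tokensAux [] w
  | cur, .blank :: w => tokensAux cur w
  | cur, .bra :: w => tokensAux cur w

/-- The maximal words of bits in `w` that are terminated by `Γ'.ket` or `Γ'.comma`. -/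
def tokens (w : List Γ') : List (List Bool) := tokensAux [] w

theorem tokensAux_bits (l : List Bool) : ∀ (cur : List Bool) (w : List Γ'),
    tokensAux cur (l.map Γ'.bit ++ w) = tokensAux (cur ++ l) w := by
  induction l with
  | nil => intro cur w; simp
  | cons b l ih => intro cur w; simp [tokensAux, ih]

theorem tokens_bits_comma (l : List Bool) (w : List Γ') :
    tokens (l.map Γ'.bit ++ .comma :: w) = l :: tokens w := by
  rw [tokens, tokensAux_bits]; rfl

theorem tokens_bits_ket (l : List Bool) (w : List Γ') :
    tokens (l.map Γ'.bit ++ .ket :: w) = l :: tokens w := by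
  rw [tokens, tokensAux_bits]; rfl

theorem tokens_encUnary (n : ℕ) (w : List Γ') :
    tokens (encUnary n ++ w) = List.replicate n true :: tokens w := by
  have := tokens_bits_comma (List.replicate n true) w
  simpa [encUnary] using this

theorem tokens_encBinary (n : ℕ) (w : List Γ') :
    tokens (encBinary n ++ w) = encodeNat n :: tokens w := by
  have := tokens_bits_comma (encodeNat n) w
  simpa [encBinary] using this

/-- The tokens of the encoding of a rational number. -/
def ratTokens (q : ℚ) : List (List Bool) :=
  [decide (q.num < 0) :: encodeNat q.num.natAbs, encodeNat q.den]

theorem tokens_encRat (q : ℚ) (w : List Γ') :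
    tokens (encRat q ++ w) = ratTokens q ++ tokens w := by
  have := tokens_bits_comma (decide (q.num < 0) :: encodeNat q.num.natAbs) (encBinary q.den ++ w)
  rw [tokens_encBinary] at this
  simpa [encRat, encBit, encBinary, ratTokens] using this

theorem tokens_encSeq {α : Type} {e : α → List Γ'} {t : α → List (List Bool)}
    (h : ∀ x w, tokens (e x ++ w) = t x ++ tokens w) {n : ℕ} (f : Fin n → α) (w : List Γ') :
    tokens (encSeq e f ++ w) = (List.ofFn f).flatMap t ++ [] :: tokens w := by
  have key : ∀ l : List α, tokens (l.flatMap e ++ .ket :: w) = l.flatMap t ++ [] :: tokens w := by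
    intro l
    induction l with
    | nil => exact tokens_bits_ket [] w
    | cons x l ih => simp [h, ih]
  simpa [encSeq] using key (List.ofFn f)

theorem tokens_encSeq_encBit {n : ℕ} (f : Fin n → Bool) (w : List Γ') :
    tokens (encSeq encBit f ++ w) = List.ofFn f :: tokens w := by
  have := tokens_bits_ket (List.ofFn f) w
  have e : (List.ofFn f).flatMap encBit = (List.ofFn f).map Γ'.bit := by
    rw [List.map_eq_flatMap]; rfl
  rw [encSeq, e]
  simpa using this

/-- The tokens of a graph. -/
def BipGraph.tokens (G : BipGraph) : List (List Bool) :=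
  List.replicate G.nA true :: List.replicate G.nB true ::
    ((List.ofFn G.adj).map (fun f => List.ofFn f) ++ [[]])

theorem BipGraph.tokens_encode (G : BipGraph) (w : List Γ') :
    _root_.tokens (G.encode ++ w) = G.tokens ++ _root_.tokens w := by
  rw [BipGraph.encode, List.append_assoc, List.append_assoc, tokens_encUnary, tokens_encUnary,
    tokens_encSeq (t := fun f => [List.ofFn f]) (fun f w => tokens_encSeq_encBit f w), BipGraph.tokens,
    List.map_eq_flatMap]
  simp

/-- The scanner of strings that consist of an encoded instance and a certificate: one step of the
computation of the current token, the list of tokens read so far, and the part of the certificate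
read so far, all of them reversed. -/
def scanStep : Γ' ⊕ Bool → List Bool × List (List Bool) × List Bool →
    List Bool × List (List Bool) × List Bool
  | .inl (.bit b), z => (b :: z.1, z.2)
  | .inl .ket, z => ([], z.1.reverse :: z.2.1, z.2.2)
  | .inl .comma, z => ([], z.1.reverse :: z.2.1, z.2.2)
  | .inl .blank, z => z
  | .inl .bra, z => z
  | .inr b, z => (z.1, z.2.1, b :: z.2.2)

/-- The tokens and the certificate contained in a string. -/
def scan (w : List (Γ' ⊕ Bool)) : List (List Bool) × List Bool :=
  let z := w.foldl (fun z s => scanStep s z) ([], [], [])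
  (z.2.1.reverse, z.2.2.reverse)

theorem scan_eq (w : List Γ') (c : List Bool) :
    scan (w.map Sum.inl ++ c.map Sum.inr) = (tokens w, c) := by
  have h1 : ∀ (w : List Γ') (cur : List Bool) T C,
      (fun z : List Bool × List (List Bool) × List Bool => (z.2.1.reverse, z.2.2))
        ((w.map Sum.inl).foldl (fun z s => scanStep s z) (cur, T, C)) =
          (T.reverse ++ tokensAux cur.reverse w, C) := by
    intro w
    induction w with
    | nil => intro cur T C; simp [tokensAux]
    | cons s w ih =>
      intro cur T C
      rw [List.map_cons, List.foldl_cons]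
      rcases s with _ | b | _ | _ | _ <;> exact (ih _ _ _).trans (by simp [tokensAux])
  have h2 : ∀ (c : List Bool) (z : List Bool × List (List Bool) × List Bool),
      (c.map Sum.inr).foldl (fun z s => scanStep s z) z = (z.1, z.2.1, c.reverse ++ z.2.2) := by
    intro c
    induction c with
    | nil => intro z; rfl
    | cons b c ih => intro z; rw [List.map_cons, List.foldl_cons, ih]; simp [scanStep]
  have h3 := h1 w [] [] []
  simp only [Prod.mk.injEq] at h3
  rw [scan, List.foldl_append, h2]
  simp [h3.1, h3.2, tokens]

namespace PT

variable {α : Type} [Coded α]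

@[fun_prop]
theorem scan {f : α → List (Γ' ⊕ Bool)} (hf : PT f) : PT fun x => scan (f x) := by
  have := foldl (s := fun _ => (([], [], []) : List Bool × List (List Bool) × List Bool))
    (step := fun (_ : α) z s => scanStep s z) hf (const _)
    (symbolCase (f := fun s (y : α × (List Bool × List (List Bool) × List Bool) × (Γ' ⊕ Bool)) =>
      scanStep s y.2.1) (fun s => by
        rcases s with (_ | b | _ | _ | _) | b <;> simp only [scanStep] <;> fun_prop) (by fun_prop))
    (fun _ => 6) (.const 6) (by
      rintro x ⟨cur, T, C⟩ s
      rcases s with (_ | b | _ | _ | _) | b <;>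
        simp only [scanStep, tsize_pair, tsize_cons, tsize_reverse, tsize_nil] <;>
        first | omega | (have := tsize_bool_le b; omega))
  exact comp (g := fun z : List Bool × List (List Bool) × List Bool => (z.2.1.reverse, z.2.2.reverse))
    (by fun_prop) this

@[fun_prop]
theorem tokens {f : α → List Γ'} (hf : PT f) : PT fun x => tokens (f x) := by
  have h : PT (fun s : Γ' => (Sum.inl s : Γ' ⊕ Bool)) := of_tree_eq fun _ => rfl
  have : PT fun x => _root_.scan ((f x).map Sum.inl) := by fun_prop
  have e : ∀ w : List Γ', _root_.scan (w.map Sum.inl) = (_root_.tokens w, []) := fun w => by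
    simpa using scan_eq w []
  simp only [e] at this
  exact fst' this

end PT

/-! ### Reading the data of an instance off its tokens -/

/-- The fraction that encodes the absolute value of a rational number. -/
def ratFrac (q : ℚ) : BinFrac := (encodeNat q.num.natAbs, encodeNat q.den)

/-- The fraction `x` is well-formed and has the value `q`. -/
def BinFrac.Represents (x : BinFrac) (q : ℚ) : Prop := bval x.2 ≠ 0 ∧ x.val = q

namespace BinFrac.Represents

variable {x y : BinFrac} {p q : ℚ}

theorem mul (hx : x.Represents p) (hy : y.Represents q) : (BinFrac.mul x y).Represents (p * q) :=
  ⟨den_mul_ne_zero hx.1 hy.1, by rw [val_mul, hx.2, hy.2]⟩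

theorem add (hx : x.Represents p) (hy : y.Represents q) : (BinFrac.add x y).Represents (p + q) :=
  ⟨den_add_ne_zero hx.1 hy.1, by rw [val_add hx.1 hy.1, hx.2, hy.2]⟩

theorem le_iff (hx : x.Represents p) (hy : y.Represents q) : BinFrac.le x y = true ↔ p ≤ q := by
  rw [BinFrac.le_iff hx.1 hy.1, hx.2, hy.2]

theorem zero : BinFrac.Represents ([], [true]) 0 := ⟨by decide, by simp [val, bval]⟩

theorem ratFrac (hq : 0 ≤ q) : (ratFrac q).Represents q := by
  refine ⟨by simp [_root_.ratFrac, bval_encodeNat], ?_⟩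
  simp only [val, _root_.ratFrac, bval_encodeNat]
  have h : (q.num.natAbs : ℚ) = (q.num : ℚ) := by
    rw [← Int.cast_natCast, Int.natAbs_of_nonneg (Rat.num_nonneg.2 hq)]
  rw [h, Rat.num_div_den]

theorem sum {n : ℕ} {g : ℕ → BinFrac} {p : Fin n → ℚ} (h : ∀ i : Fin n, (g i).Represents (p i)) :
    (BinFrac.sum ((List.range n).map g)).Represents (∑ i, p i) := by
  obtain ⟨h1, h2⟩ := sum_spec (l := (List.range n).map g) (by
    intro x hx
    obtain ⟨i, hi, rfl⟩ := List.mem_map.1 hx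
    exact (h ⟨i, List.mem_range.1 hi⟩).1)
  refine ⟨h1, h2.trans ?_⟩
  have h3 : ∀ i : Fin n, p i = val (g i) := fun i => (h i).2.symm
  rw [List.map_map, Finset.sum_congr rfl fun i _ => h3 i, ← List.sum_ofFn, List.ofFn_eq_map,
    ← List.map_coe_finRange_eq_range, List.map_map]
  rfl

end BinFrac.Represents

/-- The `k`-th fraction in a list of tokens. Its first token starts with the sign. -/
def fracAt (L : List (List Bool)) (k : ℕ) : BinFrac :=
  ((L.getD (2 * k) []).tail, L.getD (2 * k + 1) [])

/-- The number of users, given in unary by the first token. -/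
def userCount (L : List (List Bool)) : ℕ := (L.getD 0 []).length

/-- The number of helpers, given in unary by the second token. -/
def helperCount (L : List (List Bool)) : ℕ := (L.getD 1 []).length

/-- The entry of the adjacency matrix, each row of which is a token. -/
def adjAt (L : List (List Bool)) (u h : ℕ) : Bool := (L.getD (u + 2) []).getD h false

/-- The tokens that follow those of the graph. -/
def graphRest (L : List (List Bool)) : List (List Bool) := L.drop (userCount L + 3)

/-- The number of files, given in unary by the token after the graph. -/
def fileCount (L : List (List Bool)) : ℕ := ((graphRest L).getD 0 []).length

/-- The popularity of the file `f`. -/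
def popAt (L : List (List Bool)) (f : ℕ) : BinFrac := fracAt ((graphRest L).drop 1) f

/-- The tokens that follow those of the graph and the popularities. -/
def popRest (L : List (List Bool)) : List (List Bool) := (graphRest L).drop (2 * fileCount L + 2)

/-- The cache placement described by a certificate, for `H` helpers. -/
def placedAt (c : List Bool) (H f h : ℕ) : Bool := c.getD (h + H * f) false

/-- The helpers store at most `M` files each, where `M` is given in binary. -/
def feasibleCheck (L : List (List Bool)) (c M : List Bool) : Bool :=
  (List.range (helperCount L)).all fun h => binLe
    (encodeNat ((List.range (fileCount L)).flatMap fun f =>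
      bif placedAt c (helperCount L) f h then [()] else []).length) M

/-- A helper adjacent to the user `u` stores the file `f`. -/
def availableAt (L : List (List Bool)) (c : List Bool) (u f : ℕ) : Bool :=
  (List.range (helperCount L)).any fun h => adjAt L u h && placedAt c (helperCount L) f h

namespace PT

variable {α : Type} [Coded α] {L : α → List (List Bool)} {c M : α → List Bool} {k u f h : α → ℕ}

@[fun_prop]
theorem fracAt (hL : PT L) (hk : PT k) : PT fun x => fracAt (L x) (k x) := by
  unfold _root_.fracAt; fun_prop

@[fun_prop]
theorem userCount (hL : PT L) : PT fun x => userCount (L x) := by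
  unfold _root_.userCount; fun_prop

@[fun_prop]
theorem helperCount (hL : PT L) : PT fun x => helperCount (L x) := by
  unfold _root_.helperCount; fun_prop

@[fun_prop]
theorem adjAt (hL : PT L) (hu : PT u) (hh : PT h) : PT fun x => adjAt (L x) (u x) (h x) := by
  unfold _root_.adjAt; fun_prop

@[fun_prop]
theorem graphRest (hL : PT L) : PT fun x => graphRest (L x) := by
  unfold _root_.graphRest; fun_prop

@[fun_prop]
theorem fileCount (hL : PT L) : PT fun x => fileCount (L x) := by
  unfold _root_.fileCount; fun_prop

@[fun_prop]
theorem popAt (hL : PT L) (hf : PT f) : PT fun x => popAt (L x) (f x) := by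
  unfold _root_.popAt; fun_prop

@[fun_prop]
theorem popRest (hL : PT L) : PT fun x => popRest (L x) := by
  unfold _root_.popRest; fun_prop

@[fun_prop]
theorem placedAt (hc : PT c) (hk : PT k) (hf : PT f) (hh : PT h) :
    PT fun x => placedAt (c x) (k x) (f x) (h x) := by
  unfold _root_.placedAt; fun_prop

@[fun_prop]
theorem feasibleCheck (hL : PT L) (hc : PT c) (hM : PT M) :
    PT fun x => feasibleCheck (L x) (c x) (M x) := by
  unfold _root_.feasibleCheck; fun_prop

@[fun_prop]
theorem availableAt (hL : PT L) (hc : PT c) (hu : PT u) (hf : PT f) :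
    PT fun x => availableAt (L x) (c x) (u x) (f x) := by
  unfold _root_.availableAt; fun_prop

end PT

/-- The part of a list that follows `i` blocks of length `m`. -/
theorem drop_flatMap {α β : Type} {t : α → List β} {m : ℕ} (ht : ∀ x, (t x).length = m)
    {n : ℕ} (f : Fin n → α) (i : Fin n) (R : List β) :
    ∃ R', ((List.ofFn f).flatMap t ++ R).drop (m * i) = t (f i) ++ R' := by
  have key : ∀ (l : List α) (i : ℕ) (hi : i < l.length),
      ∃ R', (l.flatMap t ++ R).drop (m * i) = t l[i] ++ R' := by
    intro l
    induction l with
    | nil => intro i hi; simp at hi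
    | cons x l ih =>
      intro i hi
      cases i with
      | zero => exact ⟨l.flatMap t ++ R, by simp⟩
      | succ i =>
        obtain ⟨R', h⟩ := ih i (by simpa using hi)
        refine ⟨R', ?_⟩
        rw [List.getElem_cons_succ, ← h, List.flatMap_cons, List.append_assoc, mul_add, mul_one,
          add_comm, ← List.drop_drop]
        rw [List.drop_left' (ht x)]
  simpa using key (List.ofFn f) i (by simp)

theorem length_flatMap_ofFn {α β : Type} {t : α → List β} {m : ℕ} (ht : ∀ x, (t x).length = m)
    {n : ℕ} (f : Fin n → α) : ((List.ofFn f).flatMap t).length = m * n := by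
  simp only [List.length_flatMap, ht, List.map_const', List.sum_replicate, List.length_ofFn,
    smul_eq_mul, mul_comm]

theorem fracAt_flatMap {n : ℕ} (p : Fin n → ℚ) (i : Fin n) (R : List (List Bool)) :
    fracAt ((List.ofFn p).flatMap ratTokens ++ R) i = ratFrac (p i) := by
  obtain ⟨R', h⟩ := drop_flatMap (t := ratTokens) (m := 2) (fun x => rfl) p i R
  have h0 := congrArg (fun l => l.getD 0 []) h
  have h1 := congrArg (fun l => l.getD 1 []) h
  simp only [List.getD_eq_getElem?_getD, List.getElem?_drop] at h0 h1
  simp only [fracAt, List.getD_eq_getElem?_getD]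
  rw [Nat.add_zero] at h0
  rw [h0, h1]
  rfl

/-- The tokens of a graph, a number of files, popularities, and further data. -/
def layout (G : BipGraph) {F : ℕ} (p : Fin F → ℚ) (R : List (List Bool)) : List (List Bool) :=
  G.tokens ++ List.replicate F true :: ((List.ofFn p).flatMap ratTokens ++ [] :: R)

section layout

variable (G : BipGraph) {F : ℕ} (p : Fin F → ℚ) (R : List (List Bool))

theorem userCount_layout : userCount (layout G p R) = G.nA := by
  simp [userCount, layout, BipGraph.tokens]

theorem helperCount_layout : helperCount (layout G p R) = G.nB := by
  simp [helperCount, layout, BipGraph.tokens]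

theorem adjAt_layout (u : Fin G.nA) (h : Fin G.nB) : adjAt (layout G p R) u h = G.adj u h := by
  simp [adjAt, layout, BipGraph.tokens, List.getElem?_append]

theorem graphRest_layout : graphRest (layout G p R) =
    List.replicate F true :: ((List.ofFn p).flatMap ratTokens ++ [] :: R) := by
  rw [graphRest, userCount_layout, layout, List.drop_left']
  simp [BipGraph.tokens]

theorem fileCount_layout : fileCount (layout G p R) = F := by
  simp [fileCount, graphRest_layout]

theorem popAt_layout (f : Fin F) : popAt (layout G p R) f = ratFrac (p f) := by
  rw [popAt, graphRest_layout, List.drop_succ_cons, List.drop_zero, fracAt_flatMap]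

theorem popRest_layout : popRest (layout G p R) = R := by
  have h := length_flatMap_ofFn (t := ratTokens) (m := 2) (fun x => rfl) p
  rw [popRest, graphRest_layout, fileCount_layout, List.drop_succ_cons, ← List.drop_drop,
    List.drop_left' h]
  rfl

end layout

/-- The cache placement described by a certificate. -/
def certPlacement (c : List Bool) (F H : ℕ) : CachePlacement F H :=
  fun f h => placedAt c H f h

theorem exists_certPlacement {F H : ℕ} (X : CachePlacement F H) :
    ∃ c : List Bool, c.length = F * H ∧ certPlacement c F H = X := by
  refine ⟨List.ofFn fun k : Fin (F * H) =>
    X (finProdFinEquiv.symm k).1 (finProdFinEquiv.symm k).2, by simp, ?_⟩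
  funext f h
  have h1 : (h : ℕ) + H * f = (finProdFinEquiv (f, h) : Fin (F * H)) := rfl
  rw [certPlacement, placedAt, h1, List.getD_eq_getElem?_getD, List.getElem?_ofFn,
    dif_pos (finProdFinEquiv (f, h)).2]
  simp only [Fin.eta, Equiv.symm_apply_apply, Option.getD_some]

theorem feasibleCheck_iff (G : BipGraph) {F : ℕ} (p : Fin F → ℚ) (R : List (List Bool))
    (c : List Bool) (M : ℕ) : feasibleCheck (layout G p R) c (encodeNat M) = true ↔
      (certPlacement c F G.nB).Feasible M := by
  have key : ∀ g : ℕ → Bool, ((List.range F).flatMap fun f => bif g f then [()] else []).length =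
      (Finset.univ.filter fun f : Fin F => g f = true).card := by
    intro g
    have h1 : ∀ l : List ℕ, (l.flatMap fun f => bif g f then [()] else []).length = l.countP g := by
      intro l
      induction l with
      | nil => rfl
      | cons x l ih =>
        rw [List.flatMap_cons, List.length_append, ih, List.countP_cons]
        cases g x <;> simp [add_comm]
    rw [h1, ← List.map_coe_finRange_eq_range, List.countP_map, List.countP_eq_length_filter,
      ← List.toFinset_card_of_nodup ((List.nodup_finRange F).filter _)]
    congr 1
    ext f
    simp
  simp only [feasibleCheck, helperCount_layout, fileCount_layout, List.all_eq_true, List.mem_range,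
    binLe_iff, bval_encodeNat, CachePlacement.Feasible, key]
  exact ⟨fun h i => h i i.2, fun h i hi => h ⟨i, hi⟩⟩

theorem availableAt_iff (G : BipGraph) {F : ℕ} (p : Fin F → ℚ) (R : List (List Bool))
    (c : List Bool) (u : Fin G.nA) (f : Fin F) : availableAt (layout G p R) c u f = true ↔
      ∃ h, G.adj u h = true ∧ certPlacement c F G.nB f h = true := by
  simp only [availableAt, helperCount_layout, List.any_eq_true, List.mem_range, Bool.and_eq_true]
  constructor
  · rintro ⟨h, hh, h1, h2⟩
    exact ⟨⟨h, hh⟩, by rw [← h1, ← adjAt_layout G p R], h2⟩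
  · rintro ⟨h, h1, h2⟩
    exact ⟨h, h.2, by rw [adjAt_layout, h1], h2⟩

/-! ### Membership in NP -/

/-- A problem is in NP if certificates of polynomial length are checked in polynomial time on the
list of tokens of the instance. -/
theorem inNP_of_check {Inst : Type} {enc : Inst → List Γ'} {fin : Finite Γ'}
    {inj : Function.Injective enc} {yes : Set Inst} {check : List (List Bool) × List Bool → Bool}
    (hcheck : PT check) (q : Polynomial ℕ)
    (h : ∀ x, x ∈ yes ↔
      ∃ c : List Bool, c.length ≤ q.eval (enc x).length ∧ check (tokens (enc x), c) = true) :
    DecisionProblem.InNP ⟨Inst, Γ', fin, enc, inj, yes⟩ := by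
  refine ⟨fun y => check (tokens (enc y.1), y.2), q, ?_, h⟩
  have hF : PT fun w : List (Γ' ⊕ Bool) => [check (scan w)] := by fun_prop
  -- This numbering induces the same representation of truth values by trees as the one in `hF`.
  let := numberedBool
  refine PT.polyTime (F := fun w : List (Γ' ⊕ Bool) => [check (scan w)]) hF fun y => ?_
  dsimp only
  rw [DecisionProblem.encodeWithCert, scan_eq]
  rfl

/-- The verifier of the Helper Decision Problem. -/
def helperCheck (y : List (List Bool) × List Bool) : Bool :=
  feasibleCheck y.1 y.2 ((popRest y.1).getD (2 * userCount y.1 + 1) []) &&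
  (fracAt ((popRest y.1).drop (2 * userCount y.1 + 2)) 0).le
    (BinFrac.sum ((List.range (userCount y.1)).map fun u => (fracAt (popRest y.1) u).mul
      (BinFrac.sum ((List.range (fileCount y.1)).map fun f =>
        bif availableAt y.1 y.2 u f then popAt y.1 f else ([], [true])))))

theorem PT.helperCheck : PT helperCheck := by
  unfold _root_.helperCheck
  fun_prop

theorem HelperInst.tokens_encode (I : HelperInst ℚ) : tokens I.encode =
    layout I.graph I.pop ((List.ofFn I.weight).flatMap ratTokens ++
      [] :: encodeNat I.M :: ratTokens I.Q) := by
  have h := tokens_encRat I.Q []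
  rw [List.append_nil] at h
  simp only [HelperInst.encode, List.append_assoc]
  rw [BipGraph.tokens_encode, tokens_encUnary, tokens_encSeq tokens_encRat,
    tokens_encSeq tokens_encRat, tokens_encBinary, h, layout]
  simp [tokens, tokensAux]

/-- The tokens that follow `n` rational numbers. -/
theorem drop_ratTokens {n : ℕ} (p : Fin n → ℚ) (R : List (List Bool)) (k : ℕ) :
    ((List.ofFn p).flatMap ratTokens ++ R).drop (2 * n + k) = R.drop k := by
  rw [← List.drop_drop, List.drop_left' (length_flatMap_ofFn (t := ratTokens) (m := 2) (fun x => rfl) p)]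

theorem getD_ratTokens {n : ℕ} (p : Fin n → ℚ) (R : List (List Bool)) (k : ℕ) :
    ((List.ofFn p).flatMap ratTokens ++ R).getD (2 * n + k) [] = R.getD k [] := by
  have h := congrArg (fun l => l.getD 0 []) (drop_ratTokens p R k)
  simpa [List.getD_eq_getElem?_getD, List.getElem?_drop] using h

theorem helperCheck_iff (I : HelperInst ℚ) (c : List Bool) :
    helperCheck (tokens I.encode, c) = true ↔
      (certPlacement c I.nF I.graph.nB).Feasible I.M ∧
        I.Q ≤ I.value (certPlacement c I.nF I.graph.nB) := by
  rw [HelperInst.tokens_encode, helperCheck, Bool.and_eq_true]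
  simp only [popRest_layout, userCount_layout, fileCount_layout, getD_ratTokens, drop_ratTokens]
  refine and_congr (feasibleCheck_iff _ _ _ _ _) (BinFrac.Represents.le_iff ?_ ?_)
  · exact BinFrac.Represents.ratFrac I.Q_nonneg
  · refine BinFrac.Represents.sum fun u => .mul ?_ ?_
    · rw [fracAt_flatMap]
      exact .ratFrac (I.weight_pos u).le
    · rw [HelperInst.available, Finset.sum_filter]
      refine BinFrac.Represents.sum fun f => ?_
      have h := availableAt_iff I.graph I.pop ((List.ofFn I.weight).flatMap ratTokens ++
        [] :: encodeNat I.M :: ratTokens I.Q) c u f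
      split_ifs with h1
      · rw [h.2 h1, cond_true, popAt_layout]
        exact .ratFrac (I.pop_nonneg f)
      · rw [Bool.eq_false_iff.2 fun h2 => h1 (h.1 h2), cond_false]
        exact .zero

theorem nB_le_length_encode (G : BipGraph) : G.nB ≤ G.encode.length := by
  simp [BipGraph.encode, encUnary]; omega

theorem inNP_helperProblem : DecisionProblem.InNP helperProblem := by
  refine inNP_of_check PT.helperCheck (Polynomial.X * Polynomial.X) fun I => ?_
  constructor
  · rintro ⟨X, h1, h2⟩
    obtain ⟨c, hc, rfl⟩ := exists_certPlacement X
    refine ⟨c, ?_, (helperCheck_iff I c).2 ⟨h1, h2⟩⟩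
    have h3 := nB_le_length_encode I.graph
    rw [hc, Polynomial.eval_mul, Polynomial.eval_X]
    refine Nat.mul_le_mul ?_ ?_ <;> simp [HelperInst.encode, encUnary] <;> omega
  · rintro ⟨c, -, hc⟩
    exact ⟨_, (helperCheck_iff I c).1 hc⟩

/-! ### The average delay as a minimum over helpers -/

/-- `v` is the least element of the set that consists of `d₀` and the values `d h` for the elements
`h` of `l` with `s h`. -/
def IsBest {α : Type} (l : List α) (s : α → Bool) (d : α → ℚ) (d₀ v : ℚ) : Prop :=
  v ≤ d₀ ∧ (∀ h ∈ l, s h = true → v ≤ d h) ∧ (v = d₀ ∨ ∃ h ∈ l, s h = true ∧ v = d h)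

namespace IsBest

variable {α : Type} {s : α → Bool} {d : α → ℚ} {d₀ : ℚ}

theorem unique {l l' : List α} {s' : α → Bool} {v w : ℚ} (hv : IsBest l s d d₀ v)
    (hw : IsBest l' s' d d₀ w) (h : ∀ h, h ∈ l ∧ s h = true ↔ h ∈ l' ∧ s' h = true) : v = w := by
  obtain ⟨v1, v2, v3⟩ := hv
  obtain ⟨w1, w2, w3⟩ := hw
  refine le_antisymm ?_ ?_
  · rcases w3 with rfl | ⟨a, ha, hs, rfl⟩
    · exact v1
    · obtain ⟨h1, h2⟩ := (h a).2 ⟨ha, hs⟩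
      exact v2 a h1 h2
  · rcases v3 with rfl | ⟨a, ha, hs, rfl⟩
    · exact w1
    · obtain ⟨h1, h2⟩ := (h a).1 ⟨ha, hs⟩
      exact w2 a h1 h2

theorem foldl (l : List α) : ∀ z : ℚ,
    IsBest l s d z (l.foldl (fun z h => bif s h && decide (d h ≤ z) then d h else z) z) := by
  induction l with
  | nil => intro z; simp [IsBest]
  | cons a l ih =>
    intro z
    obtain ⟨h1, h2, h3⟩ := ih (bif s a && decide (d a ≤ z) then d a else z)
    rw [List.foldl_cons]
    generalize l.foldl (fun z h => bif s h && decide (d h ≤ z) then d h else z)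
      (bif s a && decide (d a ≤ z) then d a else z) = v at h1 h2 h3
    by_cases hs : s a = true
    · by_cases hd : d a ≤ z
      · simp only [hs, hd, decide_true, Bool.and_self, cond_true] at h1 h3
        refine ⟨h1.trans hd, ?_, ?_⟩
        · intro h hh hsh
          rcases List.mem_cons.1 hh with rfl | hh
          exacts [h1, h2 h hh hsh]
        · rcases h3 with rfl | ⟨h, hh, hsh, rfl⟩
          · exact .inr ⟨a, List.mem_cons_self, hs, rfl⟩
          · exact .inr ⟨h, List.mem_cons_of_mem _ hh, hsh, rfl⟩
      · simp only [hs, hd, decide_false, Bool.and_false, cond_false] at h1 h3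
        refine ⟨h1, ?_, ?_⟩
        · intro h hh hsh
          rcases List.mem_cons.1 hh with rfl | hh
          exacts [h1.trans (not_le.1 hd).le, h2 h hh hsh]
        · rcases h3 with rfl | ⟨h, hh, hsh, rfl⟩
          · exact .inl rfl
          · exact .inr ⟨h, List.mem_cons_of_mem _ hh, hsh, rfl⟩
    · simp only [hs, Bool.false_and, cond_false] at h1 h3
      refine ⟨h1, ?_, ?_⟩
      · intro h hh hsh
        rcases List.mem_cons.1 hh with rfl | hh
        exacts [absurd hsh hs, h2 h hh hsh]
      · rcases h3 with rfl | ⟨h, hh, hsh, rfl⟩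
        · exact .inl rfl
        · exact .inr ⟨h, List.mem_cons_of_mem _ hh, hsh, rfl⟩

end IsBest

/-- The value of `d` at the first element of a list that satisfies `s`, with default value `d₀`. -/
def firstValue {α : Type} (s : α → Bool) (d : α → ℚ) (d₀ : ℚ) : List α → ℚ
  | [] => d₀
  | h :: l => bif s h then d h else firstValue s d d₀ l

theorem isBest_firstValue {α : Type} {s : α → Bool} {d : α → ℚ} {d₀ : ℚ} : ∀ {l : List α},
    l.Pairwise (fun h h' => d h ≤ d h') → (∀ h ∈ l, d h ≤ d₀) →
      IsBest l s d d₀ (firstValue s d d₀ l)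
  | [], _, _ => by simp [IsBest, firstValue]
  | a :: l, h1, h2 => by
    rw [List.pairwise_cons] at h1
    obtain ⟨i1, i2, i3⟩ := isBest_firstValue (s := s) h1.2 fun h hh => h2 h (List.mem_cons_of_mem _ hh)
    by_cases hs : s a = true
    · simp only [firstValue, hs, cond_true]
      refine ⟨h2 a List.mem_cons_self, ?_, .inr ⟨a, List.mem_cons_self, hs, rfl⟩⟩
      intro h hh _
      rcases List.mem_cons.1 hh with rfl | hh
      exacts [le_rfl, h1.1 h hh]
    · simp only [firstValue, hs, cond_false]
      refine ⟨i1, ?_, ?_⟩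
      · intro h hh hsh
        rcases List.mem_cons.1 hh with rfl | hh
        exacts [absurd hsh hs, i2 h hh hsh]
      · rcases i3 with i3 | ⟨h, hh, hsh, i3⟩
        · exact .inl i3
        · exact .inr ⟨h, List.mem_cons_of_mem _ hh, hsh, i3⟩

theorem prod_Iio_succ {n : ℕ} (g : Fin (n + 1) → ℚ) (j : Fin n) :
    ∏ i ∈ Finset.Iio j.succ, g i = g 0 * ∏ i ∈ Finset.Iio j, g i.succ := by
  have h : ∀ {m : ℕ} (k : Fin m), Finset.Iio k = Finset.univ.filter (· < k) := by
    intro m k; ext; simp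
  rw [h, h, Finset.prod_filter, Finset.prod_filter, Fin.prod_univ_succ]
  simp

theorem sum_eq_firstValue {α : Type} (s : α → Bool) (d : α → ℚ) (d₀ : ℚ) : ∀ l : List α,
    (∑ j : Fin l.length, d (l.get j) * ((∏ i ∈ Finset.Iio j, (1 - if s (l.get i) = true then 1 else 0)) *
      if s (l.get j) = true then 1 else 0)) +
      d₀ * ∏ i : Fin l.length, (1 - if s (l.get i) = true then (1 : ℚ) else 0) = firstValue s d d₀ l
  | [] => by simp [firstValue]
  | a :: l => by
    have ih := sum_eq_firstValue s d d₀ l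
    simp only [List.length_cons, Fin.sum_univ_succ, prod_Iio_succ, Fin.prod_univ_succ]
    have h0 : Finset.Iio (0 : Fin (l.length + 1)) = ∅ := by ext; simp
    rw [h0]
    simp only [List.get_cons_zero, Finset.prod_empty, firstValue]
    by_cases hs : s a = true
    · simp [hs]
    · simp only [hs, ← ih]
      simp

theorem UncodedInst.avgDelay_eq (I : UncodedInst) (X : CachePlacement I.nF I.graph.nB)
    (u : Fin I.graph.nA) : I.avgDelay X u = ∑ f, I.pop f *
      firstValue (X f) (fun h => I.delay h u) (I.delayBS u) (I.sortedHelpers u) := by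
  simp only [← sum_eq_firstValue, UncodedInst.avgDelay, UncodedInst.entry, mul_add, Finset.mul_sum,
    Finset.sum_add_distrib]
  congr 1
  · rw [Finset.sum_comm]
    exact Finset.sum_congr rfl fun f _ => Finset.sum_congr rfl fun j _ => by ring
  · exact Finset.sum_congr rfl fun f _ => by ring

/-- The delay with which the user `u` obtains the file `f`, computed as a minimum. -/
def UncodedInst.fileDelay (I : UncodedInst) (X : CachePlacement I.nF I.graph.nB)
    (u : Fin I.graph.nA) (f : Fin I.nF) : ℚ :=
  (List.finRange I.graph.nB).foldl (fun z h => bif (I.graph.adj u h && X f h) &&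
    decide (I.delay h u ≤ z) then I.delay h u else z) (I.delayBS u)

/-- Since the helpers are sorted by their delays, and none is slower than the base station, the
first helper that stores a file yields the minimal delay. -/
theorem UncodedInst.firstValue_sortedHelpers (I : UncodedInst)
    (X : CachePlacement I.nF I.graph.nB) (u : Fin I.graph.nA) (f : Fin I.nF) :
    firstValue (X f) (fun h => I.delay h u) (I.delayBS u) (I.sortedHelpers u) =
      I.fileDelay X u f := by
  have hmem : ∀ h, h ∈ I.sortedHelpers u ↔ I.graph.adj u h = true := by
    intro h
    simp [UncodedInst.sortedHelpers, List.mem_mergeSort]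
  refine IsBest.unique (isBest_firstValue ?_ ?_) (IsBest.foldl _ _) ?_
  · have := List.pairwise_mergeSort (le := fun h h' => decide (I.delay h u ≤ I.delay h' u))
      (fun a b c h1 h2 => by
        simp only [decide_eq_true_eq] at *
        exact h1.trans h2)
      (fun a b => by simpa using le_total _ _)
      ((List.finRange I.graph.nB).filter fun h => I.graph.adj u h)
    exact this.imp fun h => by simpa using h
  · intro h hh
    exact I.delay_le_delayBS h u ((hmem h).1 hh)
  · intro h
    simp [hmem]

theorem UncodedInst.le_objective_iff (I : UncodedInst) (X : CachePlacement I.nF I.graph.nB) :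
    I.Q ≤ I.objective X ↔
      I.Q + ∑ u, ∑ f, I.pop f * I.fileDelay X u f ≤ ∑ u, I.delayBS u := by
  simp only [UncodedInst.objective, UncodedInst.avgDelay_eq, UncodedInst.firstValue_sortedHelpers,
    Finset.sum_sub_distrib]
  exact le_sub_iff_add_le

/-! ### The verifier of the placement problem -/

/-- The delay of the link from the helper `h` to the user `u`. -/
def delayAt (L : List (List Bool)) (h u : ℕ) : BinFrac :=
  fracAt ((popRest L).drop ((2 * userCount L + 1) * h)) u

/-- The tokens that follow those of the delays of the helpers. -/
def delayRest (L : List (List Bool)) : List (List Bool) :=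
  (popRest L).drop ((2 * userCount L + 1) * helperCount L + 1)

/-- The minimal delay with which the user `u` obtains the file `f`. -/
def fileDelayAt (L : List (List Bool)) (c : List Bool) (u f : ℕ) : BinFrac :=
  (List.range (helperCount L)).foldl (fun z h =>
    bif (adjAt L u h && placedAt c (helperCount L) f h) && (delayAt L h u).le z then
      delayAt L h u else z) (fracAt (delayRest L) u)

/-- The verifier of the placement problem. -/
def uncodedCheck (y : List (List Bool) × List Bool) : Bool :=
  feasibleCheck y.1 y.2 ((delayRest y.1).getD (2 * userCount y.1 + 1) []) &&
  ((fracAt ((delayRest y.1).drop (2 * userCount y.1 + 2)) 0).add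
    (BinFrac.sum ((List.range (userCount y.1)).map fun u =>
      BinFrac.sum ((List.range (fileCount y.1)).map fun f =>
        (popAt y.1 f).mul (fileDelayAt y.1 y.2 u f))))).le
    (BinFrac.sum ((List.range (userCount y.1)).map fun u => fracAt (delayRest y.1) u))

namespace PT

variable {α : Type} [Coded α] {L : α → List (List Bool)} {c : α → List Bool} {u f h : α → ℕ}

@[fun_prop]
theorem delayAt (hL : PT L) (hh : PT h) (hu : PT u) : PT fun x => delayAt (L x) (h x) (u x) := by
  unfold _root_.delayAt; fun_prop

@[fun_prop]
theorem delayRest (hL : PT L) : PT fun x => delayRest (L x) := by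
  unfold _root_.delayRest; fun_prop

@[fun_prop]
theorem fileDelayAt (hL : PT L) (hc : PT c) (hu : PT u) (hf : PT f) :
    PT fun x => fileDelayAt (L x) (c x) (u x) (f x) := by
  unfold _root_.fileDelayAt
  refine foldl (step := fun x z h =>
    bif (_root_.adjAt (L x) (u x) h &&
        _root_.placedAt (c x) (_root_.helperCount (L x)) (f x) h) &&
      (_root_.delayAt (L x) h (u x)).le z then _root_.delayAt (L x) h (u x) else z)
    (by fun_prop) (by fun_prop) (by fun_prop)
    (fun y => tsize (_root_.delayAt (L y.1) y.2 (u y.1))) (PolyBdd.tsize (by fun_prop))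
    fun x z e => ?_
  cases (_root_.adjAt (L x) (u x) e && _root_.placedAt (c x) (_root_.helperCount (L x)) (f x) e) &&
    (_root_.delayAt (L x) e (u x)).le z <;> simp

theorem uncodedCheck : PT uncodedCheck := by
  unfold _root_.uncodedCheck
  fun_prop

end PT

/-- The tokens of the delays of one helper. -/
def rowTokens {n : ℕ} (f : Fin n → ℚ) : List (List Bool) := (List.ofFn f).flatMap ratTokens ++ [[]]

theorem length_rowTokens {n : ℕ} (f : Fin n → ℚ) : (rowTokens f).length = 2 * n + 1 := by
  rw [rowTokens, List.length_append, length_flatMap_ofFn (t := ratTokens) (m := 2) (fun x => rfl)]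
  rfl

/-- The tokens that follow the popularities in an instance of the placement problem. -/
def UncodedInst.restTokens (I : UncodedInst) : List (List Bool) :=
  (List.ofFn I.delay).flatMap rowTokens ++ [] :: ((List.ofFn I.delayBS).flatMap ratTokens ++
    [] :: encodeNat I.M :: ratTokens I.Q)

theorem UncodedInst.tokens_encode (I : UncodedInst) : tokens I.encode =
    layout I.graph I.pop I.restTokens := by
  have h := tokens_encRat I.Q []
  rw [List.append_nil] at h
  have hrow : ∀ (f : Fin I.graph.nA → ℚ) w, tokens (encSeq encRat f ++ w) = rowTokens f ++ tokens w := by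
    intro f w
    rw [tokens_encSeq tokens_encRat, rowTokens]
    simp
  simp only [UncodedInst.encode, List.append_assoc]
  rw [BipGraph.tokens_encode, tokens_encUnary, tokens_encSeq tokens_encRat,
    tokens_encSeq hrow, tokens_encSeq tokens_encRat, tokens_encBinary, h, layout,
    UncodedInst.restTokens]
  simp [tokens, tokensAux]

theorem delayAt_layout (I : UncodedInst) (h : Fin I.graph.nB) (u : Fin I.graph.nA) :
    delayAt (layout I.graph I.pop I.restTokens) h u = ratFrac (I.delay h u) := by
  rw [delayAt, popRest_layout, userCount_layout, UncodedInst.restTokens]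
  obtain ⟨R', h'⟩ := drop_flatMap length_rowTokens I.delay h ([] :: ((List.ofFn I.delayBS).flatMap
    ratTokens ++ [] :: encodeNat I.M :: ratTokens I.Q))
  rw [h', rowTokens, List.append_assoc, fracAt_flatMap]

theorem delayRest_layout (I : UncodedInst) : delayRest (layout I.graph I.pop I.restTokens) =
    (List.ofFn I.delayBS).flatMap ratTokens ++ [] :: encodeNat I.M :: ratTokens I.Q := by
  rw [delayRest, popRest_layout, userCount_layout, helperCount_layout, UncodedInst.restTokens,
    ← List.drop_drop, List.drop_left' (length_flatMap_ofFn length_rowTokens I.delay)]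
  rfl

theorem represents_fileDelayAt (I : UncodedInst) (c : List Bool) (u : Fin I.graph.nA)
    (f : Fin I.nF) : (fileDelayAt (layout I.graph I.pop I.restTokens) c u f).Represents
      (I.fileDelay (certPlacement c I.nF I.graph.nB) u f) := by
  rw [fileDelayAt, UncodedInst.fileDelay, helperCount_layout, delayRest_layout, fracAt_flatMap,
    ← List.map_coe_finRange_eq_range, List.foldl_map]
  simp only [adjAt_layout, delayAt_layout]
  have key : ∀ (l : List (Fin I.graph.nB)) (z : BinFrac) (v : ℚ), z.Represents v →
      BinFrac.Represents (l.foldl (fun z h => bif (I.graph.adj u h && placedAt c I.graph.nB f h) &&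
        (ratFrac (I.delay h u)).le z then ratFrac (I.delay h u) else z) z)
      (l.foldl (fun z h => bif (I.graph.adj u h && certPlacement c I.nF I.graph.nB f h) &&
        decide (I.delay h u ≤ z) then I.delay h u else z) v) := by
    intro l
    induction l with
    | nil => intro z v hz; exact hz
    | cons h l ih =>
      intro z v hz
      rw [List.foldl_cons, List.foldl_cons]
      refine ih _ _ ?_
      have hd : (ratFrac (I.delay h u)).Represents (I.delay h u) := .ratFrac (I.delay_nonneg h u)
      have e : (ratFrac (I.delay h u)).le z = decide (I.delay h u ≤ v) := by
        rw [Bool.eq_iff_iff, hd.le_iff hz, decide_eq_true_eq]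
      rw [e, certPlacement]
      cases (I.graph.adj u h && placedAt c I.graph.nB f h) && decide (I.delay h u ≤ v)
      exacts [hz, hd]
  exact key _ _ _ (.ratFrac (I.delayBS_nonneg u))

theorem uncodedCheck_iff (I : UncodedInst) (c : List Bool) :
    uncodedCheck (tokens I.encode, c) = true ↔
      (certPlacement c I.nF I.graph.nB).Feasible I.M ∧
        I.Q ≤ I.objective (certPlacement c I.nF I.graph.nB) := by
  rw [UncodedInst.tokens_encode, uncodedCheck, Bool.and_eq_true, UncodedInst.le_objective_iff]
  simp only [delayRest_layout, userCount_layout, fileCount_layout, getD_ratTokens, drop_ratTokens]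
  refine and_congr (feasibleCheck_iff _ _ _ _ _) (BinFrac.Represents.le_iff (.add ?_ ?_) ?_)
  · exact BinFrac.Represents.ratFrac I.Q_nonneg
  · refine BinFrac.Represents.sum fun u => BinFrac.Represents.sum fun f => .mul ?_ ?_
    · rw [popAt_layout]
      exact .ratFrac (I.pop_nonneg f)
    · exact represents_fileDelayAt I c u f
  · refine BinFrac.Represents.sum fun u => ?_
    rw [fracAt_flatMap]
    exact .ratFrac (I.delayBS_nonneg u)

theorem inNP_uncodedPlacement : DecisionProblem.InNP uncodedPlacement := by
  refine inNP_of_check PT.uncodedCheck (Polynomial.X * Polynomial.X) fun I => ?_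
  constructor
  · rintro ⟨X, h1, h2⟩
    obtain ⟨c, hc, rfl⟩ := exists_certPlacement X
    refine ⟨c, ?_, (uncodedCheck_iff I c).2 ⟨h1, h2⟩⟩
    have h3 := nB_le_length_encode I.graph
    rw [hc, Polynomial.eval_mul, Polynomial.eval_X]
    refine Nat.mul_le_mul ?_ ?_ <;> simp [UncodedInst.encode, encUnary] <;> omega
  · rintro ⟨c, -, hc⟩
    exact ⟨_, (uncodedCheck_iff I c).1 hc⟩

/-! ### The reduction from 2-Disjoint Set Cover -/

theorem BipGraph.covers_iff (G : BipGraph) (S : Finset (Fin G.nB)) :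
    G.Covers S ↔ ∀ a, ∃ b ∈ S, G.adj a b = true := by
  simp [BipGraph.Covers, Finset.ext_iff, BipGraph.nbhd]

theorem HelperInst.mem_available {R : Type} [Field R] [LinearOrder R] (I : HelperInst R)
    (X : CachePlacement I.nF I.graph.nB) (u : Fin I.graph.nA) (f : Fin I.nF) :
    f ∈ I.available X u ↔ ∃ h, I.graph.adj u h = true ∧ X f h = true := by
  simp [HelperInst.available]

/-- The value of a user is at most its weight. If every file has positive popularity, then it
equals the weight only if all files are available to the user. -/
theorem HelperInst.sum_weight_le_value_iff {R : Type} [Field R] [LinearOrder R]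
    [IsStrictOrderedRing R] (I : HelperInst R) (hpos : ∀ f, 0 < I.pop f)
    (X : CachePlacement I.nF I.graph.nB) :
    ∑ u, I.weight u ≤ I.value X ↔ ∀ u f, ∃ h, I.graph.adj u h = true ∧ X f h = true := by
  simp only [← I.mem_available]
  have hle : ∀ u, I.weight u * ∑ f ∈ I.available X u, I.pop f ≤ I.weight u := by
    intro u
    refine mul_le_of_le_one_right (I.weight_pos u).le ?_
    rw [← I.pop_sum]
    exact Finset.sum_le_sum_of_subset_of_nonneg (Finset.subset_univ _) fun f _ _ => I.pop_nonneg f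
  constructor
  · intro h u f
    by_contra hf
    refine absurd h (not_le.2 (Finset.sum_lt_sum (fun u _ => hle u) ⟨u, Finset.mem_univ u, ?_⟩))
    refine mul_lt_of_lt_one_right (I.weight_pos u) ?_
    rw [← I.pop_sum]
    exact Finset.sum_lt_sum_of_subset (Finset.subset_univ _) (Finset.mem_univ f) hf (hpos f)
      fun f _ _ => I.pop_nonneg f
  · intro h
    refine Finset.sum_le_sum fun u _ => ?_
    rw [Finset.eq_univ_iff_forall.2 (h u), I.pop_sum, mul_one]

/-- With room for one file, the helpers storing the one file and those storing the other form
disjoint sets. -/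
theorem BipGraph.exists_disjoint_covers_iff (G : BipGraph) :
    (∃ B₁ B₂ : Finset (Fin G.nB), Disjoint B₁ B₂ ∧ B₁.card + B₂.card = G.nB ∧
      G.Covers B₁ ∧ G.Covers B₂) ↔
    ∃ X : CachePlacement 2 G.nB, X.Feasible 1 ∧
      ∀ u f, ∃ h, G.adj u h = true ∧ X f h = true := by
  simp only [BipGraph.covers_iff]
  constructor
  · rintro ⟨B₁, B₂, hd, -, h1, h2⟩
    refine ⟨![fun h => decide (h ∈ B₁), fun h => decide (h ∈ B₂)], ?_, ?_⟩
    · intro h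
      have hn : ¬(h ∈ B₁ ∧ h ∈ B₂) := fun hh => Finset.disjoint_left.1 hd hh.1 hh.2
      refine Finset.card_le_one.2 fun f hf g hg => ?_
      fin_cases f <;> fin_cases g <;> simp_all
    · intro u f
      obtain ⟨b₁, hb₁, ha₁⟩ := h1 u
      obtain ⟨b₂, hb₂, ha₂⟩ := h2 u
      fin_cases f
      · exact ⟨b₁, ha₁, by simpa using hb₁⟩
      · exact ⟨b₂, ha₂, by simpa using hb₂⟩
  · rintro ⟨X, hX, hcov⟩
    -- The complement of the helpers storing file `0` contains those storing file `1`, and taking it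
    -- as the second set makes the cardinalities add up.
    refine ⟨Finset.univ.filter fun h => X 0 h = true, Finset.univ.filter fun h => ¬X 0 h = true,
      Finset.disjoint_filter_filter_not _ _ _, ?_, fun u => ?_, fun u => ?_⟩
    · rw [Finset.card_filter_add_card_filter_not, Finset.card_univ, Fintype.card_fin]
    · obtain ⟨h, h1, h2⟩ := hcov u 0
      exact ⟨h, by simpa using h2, h1⟩
    · obtain ⟨h, h1, h2⟩ := hcov u 1
      refine ⟨h, ?_, h1⟩
      simp only [Finset.mem_filter, Finset.mem_univ, true_and]
      intro h3
      exact absurd (Finset.card_le_one.1 (hX h) 0 (by simpa using h3) 1 (by simpa using h2))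
        (by decide)

theorem isYes_iff_reductionInst {R : Type} [Field R] [LinearOrder R] [IsStrictOrderedRing R]
    (ε : R) (hε : 0 < ε) (G : TwoDSCInst) : G.IsYes ↔ (reductionInst ε hε G).IsYes := by
  have hpos : ∀ f : Fin 2, 0 < (![1 / (1 + ε), ε / (1 + ε)] : Fin 2 → R) f := by
    refine Fin.forall_fin_two.2 ⟨?_, ?_⟩
    · change 0 < 1 / (1 + ε)
      positivity
    · change 0 < ε / (1 + ε)
      positivity
  have hQ : (reductionInst ε hε G).Q = ∑ u, (reductionInst ε hε G).weight u := by
    change (G.1.nA : R) = ∑ _u : Fin G.1.nA, (1 : R)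
    rw [Finset.sum_const, Finset.card_univ, Fintype.card_fin, nsmul_one]
  refine (BipGraph.exists_disjoint_covers_iff G.1).trans (exists_congr fun X =>
    and_congr Iff.rfl ?_)
  exact (HelperInst.sum_weight_le_value_iff (reductionInst ε hε G) hpos X).symm.trans
    (by rw [hQ])

/-! ### The placement problem generalizes the Helper Decision Problem -/

/-- The instance of the placement problem in which the helpers have delay `0` and the delay of the
base station to a user is the weight of the user. -/
def HelperInst.toUncoded (I : HelperInst ℚ) : UncodedInst where
  graph := I.graph
  nF := I.nF
  pop := I.pop
  delay := fun _ _ => 0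
  delayBS := I.weight
  M := I.M
  Q := I.Q
  pop_nonneg := I.pop_nonneg
  pop_sum := I.pop_sum
  delay_nonneg := fun _ _ => le_rfl
  delayBS_nonneg := fun u => (I.weight_pos u).le
  delay_le_delayBS := fun _ u _ => (I.weight_pos u).le
  Q_nonneg := I.Q_nonneg

/-- A user waits for a file as long as its weight, unless an adjacent helper stores the file. -/
theorem HelperInst.fileDelay_toUncoded (I : HelperInst ℚ) (X : CachePlacement I.nF I.graph.nB)
    (u : Fin I.graph.nA) (f : Fin I.nF) : I.toUncoded.fileDelay X u f =
      if f ∈ I.available X u then 0 else I.weight u := by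
  obtain ⟨-, h2, h3⟩ := IsBest.foldl (s := fun h => I.graph.adj u h && X f h)
    (d := fun _ => (0 : ℚ)) (List.finRange I.graph.nB) (I.weight u)
  have hnn : 0 ≤ I.toUncoded.fileDelay X u f := by
    rcases h3 with h3 | ⟨_, _, _, h3⟩
    · exact (I.weight_pos u).le.trans_eq h3.symm
    · exact h3.ge
  split_ifs with hf
  · obtain ⟨h, ha, hs⟩ := (I.mem_available X u f).1 hf
    exact le_antisymm (h2 h (List.mem_finRange h) (by simp [ha, hs])) hnn
  · rcases h3 with h3 | ⟨h, _, hh, _⟩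
    · exact h3
    · exact absurd ((I.mem_available X u f).2 ⟨h, by simpa using hh⟩) hf

theorem HelperInst.objective_toUncoded (I : HelperInst ℚ) (X : CachePlacement I.nF I.graph.nB) :
    I.toUncoded.objective X = I.value X := by
  have key : ∀ u : Fin I.graph.nA, I.weight u - ∑ f : Fin I.nF, I.pop f *
      (if f ∈ I.available X u then 0 else I.weight u) =
      I.weight u * ∑ f ∈ I.available X u, I.pop f := by
    intro u
    rw [sub_eq_iff_eq_add, ← Finset.univ_inter (I.available X u), ← Finset.sum_ite_mem,
      Finset.mul_sum, ← Finset.sum_add_distrib]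
    conv_lhs => rw [← mul_one (I.weight u), ← I.pop_sum, Finset.mul_sum]
    refine Finset.sum_congr rfl fun f _ => ?_
    rw [Finset.univ_inter]
    split_ifs <;> ring
  refine Finset.sum_congr rfl fun u _ => ?_
  refine (congrArg (I.weight u - ·) ((I.toUncoded.avgDelay_eq X u).trans
    (Finset.sum_congr rfl fun f _ => congrArg (I.pop f * ·)
      ((I.toUncoded.firstValue_sortedHelpers X u f).trans (I.fileDelay_toUncoded X u f))))).trans ?_
  exact key u

theorem HelperInst.isYes_toUncoded (I : HelperInst ℚ) : I.IsYes ↔ I.toUncoded.IsYes := by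
  refine exists_congr fun X => and_congr Iff.rfl ?_
  rw [HelperInst.objective_toUncoded]
  exact Iff.rfl

/-! ### Computing the reductions -/

namespace PT

variable {α : Type} [Coded α]

@[fun_prop]
theorem bit {f : α → Bool} (hf : PT f) : PT fun x => Γ'.bit (f x) := by
  have : PT fun x => bif f x then Γ'.bit true else Γ'.bit false := by fun_prop
  refine (congrArg PT (funext fun x => ?_)).mp this
  cases f x <;> rfl

@[fun_prop]
theorem encBinary {f : α → ℕ} (hf : PT f) : PT fun x => encBinary (f x) := by
  unfold _root_.encBinary; fun_prop

end PT

theorem encRat_natCast (n : ℕ) : encRat n = .bit false :: (encBinary n ++ encBinary 1) := by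
  simp [encRat, encBit, Int.not_lt.2 (Int.natCast_nonneg n)]

/-- The encoding of a constant sequence. -/
def encConst (n : ℕ) (s : List Γ') : List Γ' :=
  ((List.replicate n ()).flatMap fun _ => s) ++ [Γ'.ket]

theorem encSeq_const {α : Type} (e : α → List Γ') (n : ℕ) (x : α) :
    encSeq e (fun _ : Fin n => x) = encConst n (e x) := by
  rw [encSeq, encConst, List.ofFn_const]
  congr 1
  induction n with
  | zero => rfl
  | succ n ih => rw [List.replicate_succ, List.replicate_succ, List.flatMap_cons, List.flatMap_cons, ih]

@[fun_prop]
theorem PT.encConst {α : Type} [Coded α] {n : α → ℕ} {s : α → List Γ'} (hn : PT n) (hs : PT s) :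
    PT fun x => encConst (n x) (s x) := by
  unfold _root_.encConst; fun_prop

theorem userCount_tokens_encode (G : BipGraph) : userCount (tokens G.encode) = G.nA := by
  have h := G.tokens_encode []
  rw [List.append_nil] at h
  rw [h]
  simp [userCount, BipGraph.tokens]

theorem helperCount_tokens_encode (G : BipGraph) : helperCount (tokens G.encode) = G.nB := by
  have h := G.tokens_encode []
  rw [List.append_nil] at h
  rw [h]
  simp [helperCount, BipGraph.tokens]

theorem isReduction_reductionInst (ε : ℚ) (hε : 0 < ε) :
    DecisionProblem.IsReduction twoDSC helperProblem (reductionInst ε hε) := by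
  refine ⟨?_, fun G => isYes_iff_reductionInst ε hε G⟩
  have hF : PT fun w : List Γ' => w ++ ((encUnary 2 ++ encSeq encRat ![1 / (1 + ε), ε / (1 + ε)]) ++
      (encConst (userCount (tokens w)) (encRat 1) ++ (encBinary 1 ++
        (Γ'.bit false :: (encBinary (userCount (tokens w)) ++ encBinary 1))))) := by fun_prop
  refine hF.polyTime fun G => ?_
  change HelperInst.encode (reductionInst ε hε G) = _
  change _ = G.1.encode ++ ((encUnary 2 ++ encSeq encRat ![1 / (1 + ε), ε / (1 + ε)]) ++
      (encConst (userCount (tokens G.1.encode)) (encRat 1) ++ (encBinary 1 ++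
        (Γ'.bit false :: (encBinary (userCount (tokens G.1.encode)) ++ encBinary 1)))))
  rw [userCount_tokens_encode, ← encRat_natCast, ← encSeq_const]
  simp only [HelperInst.encode, reductionInst, List.append_assoc]

theorem isReduction_toUncoded :
    DecisionProblem.IsReduction twoDSC uncodedPlacement
      (fun G => (reductionInst 1 one_pos G).toUncoded) := by
  refine ⟨?_, fun G => (isYes_iff_reductionInst (1 : ℚ) one_pos G).trans
    (HelperInst.isYes_toUncoded _)⟩
  have hF : PT fun w : List Γ' => w ++
      ((encUnary 2 ++ encSeq encRat ![1 / (1 + 1), 1 / (1 + 1)]) ++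
      (encConst (helperCount (tokens w)) (encConst (userCount (tokens w)) (encRat 0)) ++
      (encConst (userCount (tokens w)) (encRat 1) ++ (encBinary 1 ++
        (Γ'.bit false :: (encBinary (userCount (tokens w)) ++ encBinary 1)))))) := by fun_prop
  refine hF.polyTime fun G => ?_
  change UncodedInst.encode (reductionInst 1 one_pos G).toUncoded = _
  change _ = G.1.encode ++ ((encUnary 2 ++ encSeq encRat ![1 / (1 + 1), 1 / (1 + 1)]) ++
      (encConst (helperCount (tokens G.1.encode))
        (encConst (userCount (tokens G.1.encode)) (encRat 0)) ++
      (encConst (userCount (tokens G.1.encode)) (encRat 1) ++ (encBinary 1 ++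
        (Γ'.bit false :: (encBinary (userCount (tokens G.1.encode)) ++ encBinary 1))))))
  rw [userCount_tokens_encode, helperCount_tokens_encode, ← encRat_natCast,
    ← encSeq_const encRat G.1.nA (0 : ℚ), ← encSeq_const encRat G.1.nA (1 : ℚ),
    ← encSeq_const (encSeq encRat) G.1.nB (fun _ : Fin G.1.nA => (0 : ℚ))]
  simp only [UncodedInst.encode, HelperInst.toUncoded, reductionInst, List.append_assoc]

/-- NP-hardness of 2-Disjoint Set Cover is inherited by every problem to which it reduces. -/
theorem npHard_of_reduces {P : DecisionProblem} (h : DecisionProblem.Reduces twoDSC P)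
    (hard : DecisionProblem.NPHard twoDSC) : DecisionProblem.NPHard P := by
  intro L hL
  obtain ⟨f, hf, hyes⟩ := hard L hL
  obtain ⟨g, hg, hyes'⟩ := h
  exact ⟨fun x => g (f x), PolyTime.comp (B := Γ') hg hf, fun x => (hyes x).trans (hyes' (f x))⟩

theorem mainTheorem1 :
    (∀ (ε : ℝ) (hε : 0 < ε) (G : TwoDSCInst), G.IsYes ↔ (reductionInst ε hε G).IsYes) ∧
    (∀ (ε : ℚ) (hε : 0 < ε),
      DecisionProblem.IsReduction twoDSC helperProblem (reductionInst ε hε)) ∧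
    DecisionProblem.Reduces twoDSC helperProblem ∧
    DecisionProblem.InNP helperProblem ∧
    DecisionProblem.InNP uncodedPlacement ∧
    (DecisionProblem.NPHard twoDSC →
      DecisionProblem.NPComplete helperProblem ∧ DecisionProblem.NPComplete uncodedPlacement) :=
  ⟨isYes_iff_reductionInst, isReduction_reductionInst,
    ⟨_, isReduction_reductionInst 1 one_pos⟩, inNP_helperProblem, inNP_uncodedPlacement,
    fun hard => ⟨⟨inNP_helperProblem, npHard_of_reduces ⟨_, isReduction_reductionInst 1 one_pos⟩ hard⟩,
      inNP_uncodedPlacement, npHard_of_reduces ⟨_, isReduction_toUncoded⟩ hard⟩⟩
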